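/- **Setting.** Let $I_1,\dots,I_\ell\subseteq\{1,\dots,n\}$ be such that for $j\ne k$ either $I_j\subsetneq I_k$, or $I_k\subsetneq I_j$, or $I_j\cap I_k=\emptyset$, and such that $\bigcup_{I_k\subsetneq I_j}I_k\subsetneq I_j$ for every $j$. Put $\hat I_j=I_j\setminus\bigcup_{I_k\subsetneq I_j}I_k$, $Z_j=\{z\in\mathbb C^n: z_i=0 \text{ for } i\in I_j\}$, and write $\mathbb C^n=\mathbb C^{\hat I_1}\times\dots\times\mathbb C^{\hat I_\ell}\times\mathbb C^d$ and $z_I=(z_i)_{i\in I}$. Norms and distances are Euclidean. A *proper multi-cone* is a set $$S=S(U,\{G_j\},\epsilon)=\{z\in U:\ z_{\hat I_j}\in G_j \text{ for all } j,\ |z_{\hat I_k}|<\epsilon|z_{\hat I_j}| \text{ whenever } I_k\subsetneq I_j\},$$ where $U=B_1\times\dots\times B_\ell\times W$ with open balls $B_j\subset\mathbb C^{\hat I_j}$ of positive radius centred at $0$ and $W\subset\mathbb C^d$ nonempty, open and convex, where $G_j\subset\mathbb C^{\hat I_j}$ is a nonempty open convex cone with $G_j\cap(-G_j)=\emptyset$,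 and where $\epsilon>0$. A proper multi-cone $S'=S(U',\{G'_j\},\epsilon')$ is *properly contained* in $S$ if $\epsilon'<\epsilon$, $\overline{U'}$ is a compact subset of $U$, and $\overline{G'_j}\setminus\{0\}\subset G_j$ for all $j$. For nonempty $J\subseteq\{1,\dots,\ell\}$ let $I_J=\bigcup_{j\in J}I_j$, $Z_J=\bigcap_{j\in J}Z_j$ (with coordinates $z_i$, $i\notin I_J$), let $\pi_J:\mathbb C^n\to Z_J$ be the coordinate projection and let $S_J$ be the interior in $Z_J$ of $\overline S\cap Z_J$. Put $J^*=\{j: I_j\not\subseteq I_J\}$. The set $S_J$ is regarded as the proper multi-cone $S(U\cap Z_J,\{G_j\}_{j\in J^*},\epsilon)$ in $Z_J$ for the family $\{Z_j\cap Z_J\}_{j\in J^*}$. A *total family of coefficients* on $S$ is a family $F=\{f_{J,\alpha}\}$ of holomorphic functions $f_{J,\alpha}$ on $S_J$, for $J\neq\emptyset$ and $\alpha\in\mathbb Z_{\ge0}^{I_J}$. For $N=(n_1,\dots,n_\ell)\in\mathbb Z_{\ge0}^\ell$ set $$\mathrm{App}^{<N}(F;z)=\sum_{J\ne\emptyset}(-1)^{\#J+1}\sum_{\alpha}f_{J,\alpha}(\pi_J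 z)\,\frac{z^\alpha}{\alpha!},$$ where the inner sum is over the $\alpha\in\mathbb Z_{\ge0}^{I_J}$ with $\sum_{i\in I_j}\alpha_i<n_j$ for all $j\in J$, and set $w_j(N)=n_j-\sum_k n_k$, the sum being over the $k$ such that $Z_k\supsetneq Z_j$ and no $Z_m$ satisfies $Z_k\supsetneq Z_m\supsetneq Z_j$. A holomorphic function $f$ on $S$ is *multi-asymptotically developable to $F$* if for every proper multi-cone $S'$ properly contained in $S$ and every $N$ there is $C>0$ with $$|f(z)-\mathrm{App}^{<N}(F;z)|\le C\prod_{j=1}^{\ell}\mathrm{dist}(z,Z_j)^{w_j(N)}\qquad(z\in S'),$$ and it is *multi-asymptotically developable* along $\bigcup_j Z_j$ on $S$ if this holds for some total family $F$. A *Whitney extension* to $\overline{S'}$ of a holomorphic function $g$ on $S'$ is a $C^\infty$-Whitney jet on $\overline{S'}$ (for the underlying real manifold) which coincides on $S'$ with the jet of $g$. **Proposition.** Let $S$ be a proper multi-cone, $f$ a holomorphic function on $S$, and $F=\{f_{J,\alpha}\}$ a total family of coefficients on $S$ such that $f$ is multi-asymptotically developable to $F$. Let $J\neq\emptyset$ and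 $\alpha\in\mathbb Z_{\ge0}^{I_J}$. 1. For every proper multi-cone $S'$ properly contained in $S$, the function $\partial^\alpha f/\partial z^\alpha|_{S'}$ has a Whitney extension to $\overline{S'}$, and the values of every such extension on $S'_J$ are those of $f_{J,\alpha}$. The sets $S'_J$ cover $S_J$. In this sense $$\frac{\partial^\alpha f}{\partial z^\alpha}\Big|_{S_J}=f_{J,\alpha}.$$ 2. The coefficients are unique: if $f$ is also multi-asymptotically developable to a total family $F'=\{f'_{J,\alpha}\}$ on $S$, then $f'_{J,\alpha}=f_{J,\alpha}$ on $S_J$. 3. The function $f_{J,\alpha}$ is multi-asymptotically developable along $\bigcup_{j\in J^*}(Z_j\cap Z_J)$ on the multi-cone $S_J$ in $Z_J$. -/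

import Mathlib

noncomputable section

namespace MultiAsymp

/-- The space `ℂ^A` with coordinates indexed by `A` and its Euclidean norm. -/
abbrev Cn (A : Type*) := EuclideanSpace ℂ A

section Coordinates

variable {ι : Type*} [DecidableEq ι]

/-- The coordinates `z_A = (z_i)_{i ∈ A}` of `z`; this is the projection `ℂ^ι → ℂ^A`. -/
def coords (A : Finset ι) (z : Cn ι) : Cn A :=
  WithLp.toLp 2 fun i => z i.1

/-- The inclusion `ℂ^A → ℂ^ι` as a coordinate subspace (the other coordinates are `0`). -/
def extend (A : Finset ι) (w : Cn A) : Cn ι :=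
  WithLp.toLp 2 fun i => if h : i ∈ A then w ⟨i, h⟩ else 0

/-- A multi-index on `A`, viewed as a multi-index on `ι` that vanishes outside `A`. -/
def extendIndex (A : Finset ι) (α : A → ℕ) : ι → ℕ :=
  fun i => if h : i ∈ A then α ⟨i, h⟩ else 0

end Coordinates

section Derivatives

variable {ι : Type*} [Fintype ι] [DecidableEq ι]

/-- The complex partial derivative `∂f/∂z_i`. -/
def partialDeriv (i : ι) (f : Cn ι → ℂ) : Cn ι → ℂ :=
  fun z => fderiv ℂ f z (EuclideanSpace.single i 1)

/-- The iterated partial derivative `∂^α f/∂z^α`. (The order in which the partial derivatives are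
taken is irrelevant for holomorphic functions.) -/
def iteratedPartial (α : ι → ℕ) (f : Cn ι → ℂ) : Cn ι → ℂ :=
  (Finset.univ : Finset ι).toList.foldr (fun i g => (partialDeriv i)^[α i] g) f

/-- `α! = ∏ α_i!`. -/
def multiFactorial (α : ι → ℕ) : ℕ := ∏ i, (α i).factorial

/-- The pairs `(a, b)` of multi-indices with `|a| + |b| ≤ r`. -/
def indexPairs (ι : Type*) [Fintype ι] [DecidableEq ι] (r : ℕ) : Finset ((ι → ℕ) × (ι → ℕ)) :=
  ((Fintype.piFinset fun _ : ι => Finset.range (r + 1)) ×ˢ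
    (Fintype.piFinset fun _ : ι => Finset.range (r + 1))).filter
      fun p => ∑ i, p.1 i + ∑ i, p.2 i ≤ r

/-- `C^∞`-Whitney jets on a subset `K` of the real manifold underlying `ℂ^ι`. The component
`u γ δ` plays the role of `∂_z^γ ∂_{\bar z}^δ`. All components are continuous on `K`, and for all
`γ`, `δ` and `r` the Taylor remainder of order `r` of the component `u γ δ` is
`o(|y - x|^r)` as `|y - x| → 0`, uniformly on the compact subsets of `K`. -/
structure IsWhitneyJet (K : Set (Cn ι)) (u : (ι → ℕ) → (ι → ℕ) → Cn ι → ℂ) : Prop where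
  continuousOn : ∀ γ δ, ContinuousOn (u γ δ) K
  remainder : ∀ L ⊆ K, IsCompact L → ∀ (γ δ : ι → ℕ) (r : ℕ), ∀ η > (0 : ℝ), ∃ ρ > (0 : ℝ),
    ∀ x ∈ L, ∀ y ∈ L, ‖y - x‖ < ρ →
      ‖u γ δ y - ∑ p ∈ indexPairs ι r, u (γ + p.1) (δ + p.2) x *
          ((∏ i, (y i - x i) ^ p.1 i) * ∏ i, (starRingEnd ℂ (y i - x i)) ^ p.2 i) /
          ((multiFactorial p.1 : ℂ) * (multiFactorial p.2 : ℂ))‖ ≤ η * ‖y - x‖ ^ r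

/-- `u` is a Whitney extension to the closure of the open set `S` of a function `g` that is
holomorphic on `S`: a `C^∞`-Whitney jet on `closure S` that coincides on `S` with the jet of `g`
(the components with an antiholomorphic derivative of `g` are `0`). -/
structure IsWhitneyExtension (S : Set (Cn ι)) (g : Cn ι → ℂ)
    (u : (ι → ℕ) → (ι → ℕ) → Cn ι → ℂ) : Prop where
  isWhitneyJet : IsWhitneyJet (closure S) u
  eqOn_holomorphic : ∀ γ, Set.EqOn (u γ 0) (iteratedPartial γ g) S
  eqOn_antiholomorphic : ∀ γ δ, δ ≠ 0 → Set.EqOn (u γ δ) 0 S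

end Derivatives

section Family

variable {ι κ : Type*} [Fintype ι] [DecidableEq ι] [Fintype κ] [DecidableEq κ]

/-- The conditions on the index sets `I_j`: two of them are either strictly nested or disjoint
(in particular they are mutually distinct), and the union of the `I_k` strictly contained in `I_j`
is strictly contained in `I_j` (in particular `I_j` is not empty). -/
structure IsAdmissible (I : κ → Finset ι) : Prop where
  nested : ∀ j k, j ≠ k → I j ⊂ I k ∨ I k ⊂ I j ∨ Disjoint (I j) (I k)
  strict : ∀ j, (Finset.univ.filter fun k => I k ⊂ I j).biUnion I ⊂ I j

/-- `Î_j`, the set `I_j` minus the union of the `I_k` strictly contained in `I_j`. -/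
def hat (I : κ → Finset ι) (j : κ) : Finset ι :=
  I j \ (Finset.univ.filter fun k => I k ⊂ I j).biUnion I

/-- The indices of the remaining coordinates, which belong to no `I_j`. -/
def free (I : κ → Finset ι) : Finset ι :=
  (Finset.univ.biUnion I)ᶜ

/-- `I_J = ⋃_{j ∈ J} I_j`. -/
def union (I : κ → Finset ι) (J : Finset κ) : Finset ι := J.biUnion I

/-- The submanifold `Z_j = {z_i = 0 for i ∈ I_j}`. -/
def Z (I : κ → Finset ι) (j : κ) : Set (Cn ι) := {z | ∀ i ∈ I j, z i = 0}

/-- `Z_J = ⋂_{j ∈ J} Z_j = {z_i = 0 for i ∈ I_J}` as a space of its own, with the coordinates `z_i`,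
`i ∉ I_J`. It is embedded in `ℂ^ι` by `extend (union I J)ᶜ`. -/
abbrev ZSpace (I : κ → Finset ι) (J : Finset κ) := Cn ↥(union I J)ᶜ

/-- The canonical projection `π_J : ℂ^ι → Z_J`. -/
def proj (I : κ → Finset ι) (J : Finset κ) (z : Cn ι) : ZSpace I J := coords (union I J)ᶜ z

/-- The embedding `Z_J → ℂ^ι`. -/
def incl (I : κ → Finset ι) (J : Finset κ) (w : ZSpace I J) : Cn ι := extend (union I J)ᶜ w

/-- The exponents `w_j(N) = n_j - ∑ n_k`, where `k` runs over the indices such that `Z_k` strictly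
contains `Z_j` and no `Z_m` lies strictly in between. (`Z_j ⊊ Z_k` means `I_k ⊊ I_j`.) -/
def weight (I : κ → Finset ι) (N : κ → ℕ) (j : κ) : ℤ :=
  (N j : ℤ) -
    ∑ k ∈ Finset.univ.filter (fun k => I k ⊂ I j ∧ ∀ m, ¬ (I k ⊂ I m ∧ I m ⊂ I j)), (N k : ℤ)

/-- Families `f_{J,α}` of functions on `Z_J`, for `α ∈ ℤ_{≥0}^{I_J}`. Only nonempty `J` and the
values of `f_{J,α}` on `S_J` matter. -/
abbrev Family (I : κ → Finset ι) :=
  (J : Finset κ) → (↥(union I J) → ℕ) → ZSpace I J → ℂ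

/-- `A_J(N) = {α ∈ ℤ_{≥0}^{I_J} : |α|_{I_j} < n_j for all j ∈ J}`. (For nonempty `J` the last
condition forces all `α_i < ∑ n_j`, hence the box in this definition.) -/
def indexSet (I : κ → Finset ι) (J : Finset κ) (N : κ → ℕ) : Finset (↥(union I J) → ℕ) :=
  (Fintype.piFinset fun _ : ↥(union I J) => Finset.range (∑ j, N j)).filter
    fun α => ∀ j ∈ J, ∑ i ∈ Finset.univ.filter (fun i : ↥(union I J) => i.1 ∈ I j), α i < N j

/-- `T_J^{<N}(F; z) = ∑_{α ∈ A_J(N)} f_{J,α}(π_J z) z^α / α!`. -/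
def taylor (I : κ → Finset ι) (F : Family I) (J : Finset κ) (N : κ → ℕ) (z : Cn ι) : ℂ :=
  ∑ α ∈ indexSet I J N, F J α (proj I J z) * (∏ i, z i.1 ^ α i) / (multiFactorial α : ℂ)

/-- `App^{<N}(F; z) = ∑_{J ≠ ∅} (-1)^{#J + 1} T_J^{<N}(F; z)`. -/
def app (I : κ → Finset ι) (F : Family I) (N : κ → ℕ) (z : Cn ι) : ℂ :=
  ∑ J ∈ Finset.univ.filter (fun J : Finset κ => J.Nonempty),
    (-1) ^ (J.card + 1) * taylor I F J N z

/-- The data `(U, {G_j}, ε)` of a multi-cone, where `U` is the product of the balls `B_j` with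
radius `r_j` around the origin in `ℂ^{Î_j}` and of `W`. -/
structure ConeData (I : κ → Finset ι) where
  r : κ → ℝ
  W : Set (Cn ↥(free I))
  G : (j : κ) → Set (Cn ↥(hat I j))
  ε : ℝ

namespace ConeData

variable {I : κ → Finset ι}

/-- The requirements on the data of an open proper multi-cone: the balls are open balls of positive
radius, `W` is a nonempty open convex set, every `G_j` is a nonempty open convex cone which is
proper, that is, contains no pair `v`, `-v` (in particular `0 ∉ G_j`), and `ε > 0`. -/
structure IsProper (D : ConeData I) : Prop where
  r_pos : ∀ j, 0 < D.r j
  W_open : IsOpen D.W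
  W_convex : Convex ℝ D.W
  W_nonempty : D.W.Nonempty
  G_open : ∀ j, IsOpen (D.G j)
  G_convex : ∀ j, Convex ℝ (D.G j)
  G_nonempty : ∀ j, (D.G j).Nonempty
  G_cone : ∀ j, ∀ t : ℝ, 0 < t → ∀ v ∈ D.G j, t • v ∈ D.G j
  G_proper : ∀ j, ∀ v ∈ D.G j, -v ∉ D.G j
  ε_pos : 0 < D.ε

/-- The open set `U = B_1 × ⋯ × B_ℓ × W`. -/
def U (D : ConeData I) : Set (Cn ι) :=
  {z | (∀ j, coords (hat I j) z ∈ Metric.ball 0 (D.r j)) ∧ coords (free I) z ∈ D.W}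

/-- The multi-cone `S(U, {G_j}, ε)`. -/
def S (D : ConeData I) : Set (Cn ι) :=
  {z | z ∈ D.U ∧ ∀ j, coords (hat I j) z ∈ D.G j ∧
    ∀ k, I k ⊂ I j → ‖coords (hat I k) z‖ < D.ε * ‖coords (hat I j) z‖}

/-- `S_J`, the interior in `Z_J` of `closure S ∩ Z_J`. -/
def SJ (D : ConeData I) (J : Finset κ) : Set (ZSpace I J) :=
  interior {w | incl I J w ∈ closure D.S}

/-- `S(U', {G'_j}, ε')` is properly contained in `S(U, {G_j}, ε)`: `ε' < ε`, `U'` is relatively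
compact in `U`, and the closure of each cone `G'_j` is contained in `G_j` apart from the origin. -/
structure ProperlyContained (D' D : ConeData I) : Prop where
  ε_lt : D'.ε < D.ε
  U_compact : IsCompact (closure D'.U)
  U_subset : closure D'.U ⊆ D.U
  G_subset : ∀ j, closure (D'.G j) \ {0} ⊆ D.G j

/-- `F` is a total family of coefficients of multi-asymptotic expansion on `S`: all the `f_{J,α}`
with `J ≠ ∅` are holomorphic on `S_J` (holomorphic means complex analytic). -/
def IsCoefficientFamily (D : ConeData I) (F : Family I) : Prop :=
  ∀ J : Finset κ, J.Nonempty → ∀ α, AnalyticOnNhd ℂ (F J α) (D.SJ J)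

/-- The multi-asymptotic estimates: `f` is multi-asymptotically developable to `F` on `S`. -/
def DevelopableTo (D : ConeData I) (f : Cn ι → ℂ) (F : Family I) : Prop :=
  ∀ D' : ConeData I, D'.IsProper → D'.ProperlyContained D → ∀ N : κ → ℕ,
    ∃ C > (0 : ℝ), ∀ z ∈ D'.S,
      ‖f z - app I F N z‖ ≤ C * ∏ j, Metric.infDist z (Z I j) ^ weight I N j

/-- `f` is a holomorphic function on `S` that is multi-asymptotically developable along the union
of the `Z_j`. -/
def Developable (D : ConeData I) (f : Cn ι → ℂ) : Prop :=
  AnalyticOnNhd ℂ f D.S ∧ ∃ F : Family I, D.IsCoefficientFamily F ∧ D.DevelopableTo f F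

/-- `h` is the restriction to `S_J` of the Whitney extension of the function `g`, which is
holomorphic on `S`: for every multi-cone `S'` properly contained in `S`, `g|_{S'}` has a Whitney
extension to `closure S'`, and every such extension has `h` as its values on `S'_J`. Moreover the
sets `S'_J` cover `S_J`, so that `h` is determined on all of `S_J`. -/
structure IsWhitneyRestriction (D : ConeData I) (g : Cn ι → ℂ) (J : Finset κ)
    (h : ZSpace I J → ℂ) : Prop where
  exists_extension : ∀ D' : ConeData I, D'.IsProper → D'.ProperlyContained D →
    ∃ u, IsWhitneyExtension D'.S g u
  eqOn : ∀ D' : ConeData I, D'.IsProper → D'.ProperlyContained D →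
    ∀ u, IsWhitneyExtension D'.S g u → ∀ w ∈ D'.SJ J, u 0 0 (incl I J w) = h w
  cover : ∀ w ∈ D.SJ J, ∃ D' : ConeData I, D'.IsProper ∧ D'.ProperlyContained D ∧ w ∈ D'.SJ J

end ConeData

/-- The index set `J^* = {j : Z_J ⊄ Z_j} = {j : I_j ⊄ I_J}`. -/
abbrev StarIndex (I : κ → Finset ι) (J : Finset κ) := {j : κ // ¬ I j ⊆ union I J}

/-- The index sets `I_j^* = I_j \ I_J` (`j ∈ J^*`) of the submanifolds `Z_j ∩ Z_J` of `Z_J`. -/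
def starFamily (I : κ → Finset ι) (J : Finset κ) : StarIndex I J → Finset ↥(union I J)ᶜ :=
  fun j => (I j.1).subtype (· ∈ (union I J)ᶜ)

/-- The data `(U ∩ Z_J, {G_j}_{j ∈ J^*}, ε)` of `S_J`, as a multi-cone in `Z_J` for the family
`{Z_j ∩ Z_J}_{j ∈ J^*}`. For `j ∈ J^*` the index set `Î_j` does not meet `I_J`, and formed in `Z_J`
it is the same set of coordinates; likewise the free coordinates are the same. -/
def ConeData.star {I : κ → Finset ι} (D : ConeData I) (J : Finset κ) :
    ConeData (starFamily I J) where
  r j := D.r j.1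
  W := {v | coords (free I) (incl I J (extend (free (starFamily I J)) v)) ∈ D.W}
  G j := {v | coords (hat I j.1) (incl I J (extend (hat (starFamily I J) j) v)) ∈ D.G j.1}
  ε := D.ε

end Family

end MultiAsymp

end

/-! Everything rests on the fact that developability survives differentiation. Let `i` lie in the
set `hat I j`. Around a point `z` of `S'` the disc in the direction of `z_i`, with radius a small
multiple of the distance from `z` to `Z_j`, stays in a slightly larger multi-cone and changes every
distance to a `Z_m` by a factor of at most 2. Cauchy's inequality for `f - App` on this disc costs
one factor `1 / dist(z, Z_j)`. Raising `n_m` by one for all `m` with `i ∈ I m` raises exactly the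
weight `w_j`, by one (`weight_indicator`), and this pays for the loss. Hence `∂f/∂z_i` is
developable to the family differentiated term by term (`DevelopableTo.partialDeriv`).

For `N = 0` the approximant and all weights vanish, so the estimate says that `f` is bounded on
`S'`; by the above all its derivatives are bounded there. A properly contained multi-cone is
quasi-convex (`exists_path`): the norms of the components can be interpolated linearly along a
Lipschitz path. Taylor's formula along such paths gives the Whitney extension
(`exists_isWhitneyExtension`).

The boundary values come from an induction on `J` (`boundary_value`). Take for `N` the indicator of
`J`, and multiply the coordinates in `I_J` by `t → 0`. The right hand side is of order `t^s`, where
`s` is the sum of the weights over `I_j ⊆ I_J` and `s ≥ 1` (`one_le_sum_weight`). The approximant is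
the alternating sum of the `f_{K,0}` with `K ⊆ J`; for `K ≠ J` these tend to the boundary value of
`f` by induction, and inclusion-exclusion leaves `f_{J,0}` equal to that boundary value. Applied to
the derivatives of `f` this identifies all `f_{J,α}`, and uniqueness follows.

For the development of `f_{J,α}` it is enough to treat `α = 0`, by passing to a derivative. Let `t →
0` in the estimate for `f`, with exponents `N` that are zero outside `J^*`. Terms with an index
outside `J^*` drop out, the weights become those of the induced family on `Z_J`, and `f_{K,β}` tends
to `f_{J ∪ K,β}` because both are boundary values of the same derivative (`tendsto_coefficient`). -/

set_option linter.unusedSectionVars false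

noncomputable section

namespace MultiAsymp

open Filter Topology Set

/-! ### Coordinate projections, inclusions and partial scalings. -/

section CoordinateMaps

variable {ι : Type*} [DecidableEq ι]

@[simp]
theorem coords_apply (A : Finset ι) (z : Cn ι) (i : A) : coords A z i = z i.1 := rfl

theorem extend_apply (A : Finset ι) (w : Cn A) (i : ι) :
    extend A w i = if h : i ∈ A then w ⟨i, h⟩ else 0 := rfl

theorem extend_apply_mem {A : Finset ι} (w : Cn A) {i : ι} (h : i ∈ A) :
    extend A w i = w ⟨i, h⟩ := by
  simp [extend_apply, h]

theorem extend_apply_notMem {A : Finset ι} (w : Cn A) {i : ι} (h : i ∉ A) :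
    extend A w i = 0 := by
  simp [extend_apply, h]

theorem extendIndex_apply_mem {A : Finset ι} (a : A → ℕ) {i : ι} (h : i ∈ A) :
    extendIndex A a i = a ⟨i, h⟩ := by
  simp [extendIndex, h]

theorem extendIndex_apply_notMem {A : Finset ι} (a : A → ℕ) {i : ι} (h : i ∉ A) :
    extendIndex A a i = 0 := by
  simp [extendIndex, h]

@[simp]
theorem extendIndex_coe {A : Finset ι} (a : A → ℕ) (i : A) : extendIndex A a i.1 = a i := by
  simp [extendIndex]

@[simp]
theorem coords_extend (A : Finset ι) (w : Cn A) : coords A (extend A w) = w := by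
  ext i
  simp [extend_apply]

theorem coords_extend_of_disjoint {A B : Finset ι} (h : Disjoint A B) (w : Cn B) :
    coords A (extend B w) = 0 := by
  ext i
  simp [extend_apply, Finset.disjoint_left.1 h i.2]

theorem coords_eq_iff {A : Finset ι} {z w : Cn ι} :
    coords A z = coords A w ↔ ∀ i ∈ A, z i = w i := by
  constructor
  · intro h i hi
    exact congrArg (fun v : Cn A => v ⟨i, hi⟩) h
  · intro h
    ext i
    exact h i.1 i.2

theorem coords_add (A : Finset ι) (z w : Cn ι) : coords A (z + w) = coords A z + coords A w := rfl

theorem coords_sub (A : Finset ι) (z w : Cn ι) : coords A (z - w) = coords A z - coords A w := rfl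

theorem coords_smul (A : Finset ι) (c : ℂ) (z : Cn ι) : coords A (c • z) = c • coords A z := rfl

theorem coords_real_smul (A : Finset ι) (c : ℝ) (z : Cn ι) :
    coords A (c • z) = c • coords A z := rfl

variable [Fintype ι]

/-- The projection `coords A` as a continuous linear map. -/
def coordsL (A : Finset ι) : Cn ι →L[ℂ] Cn A :=
  LinearMap.toContinuousLinearMap
    { toFun := coords A
      map_add' := fun _ _ => rfl
      map_smul' := fun _ _ => rfl }

@[simp]
theorem coordsL_apply (A : Finset ι) (z : Cn ι) : coordsL A z = coords A z := rfl

/-- The inclusion `extend A` as a continuous linear map. -/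
def extendL (A : Finset ι) : Cn A →L[ℂ] Cn ι :=
  LinearMap.toContinuousLinearMap
    { toFun := extend A
      map_add' := fun v w => by
        ext i
        by_cases h : i ∈ A <;> simp [extend_apply, h]
      map_smul' := fun c w => by
        ext i
        by_cases h : i ∈ A <;> simp [extend_apply, h] }

@[simp]
theorem extendL_apply (A : Finset ι) (w : Cn A) : extendL A w = extend A w := rfl

theorem continuous_coords (A : Finset ι) : Continuous (coords A : Cn ι → Cn A) :=
  (coordsL A).continuous

theorem continuous_extend (A : Finset ι) : Continuous (extend A : Cn A → Cn ι) :=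
  (extendL A).continuous

theorem isOpenMap_coords (A : Finset ι) : IsOpenMap (coords A : Cn ι → Cn A) :=
  (coordsL A).isOpenMap fun w => ⟨extend A w, coords_extend A w⟩

theorem norm_apply_le (z : Cn ι) (i : ι) : ‖z i‖ ≤ ‖z‖ := PiLp.norm_apply_le z i

theorem norm_apply_le_coords {A : Finset ι} (z : Cn ι) {i : ι} (h : i ∈ A) :
    ‖z i‖ ≤ ‖coords A z‖ :=
  norm_apply_le (coords A z) ⟨i, h⟩

theorem norm_le_sum (z : Cn ι) : ‖z‖ ≤ ∑ i, ‖z i‖ := by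
  rw [EuclideanSpace.norm_eq]
  refine Real.sqrt_le_iff.2 ⟨Finset.sum_nonneg fun i _ => norm_nonneg _, ?_⟩
  exact Finset.sum_sq_le_sq_sum_of_nonneg fun i _ => norm_nonneg _

theorem norm_le_of_forall_apply_le {z : Cn ι} {c : ℝ} (h : ∀ i, ‖z i‖ ≤ c) :
    ‖z‖ ≤ Fintype.card ι * c := by
  refine (norm_le_sum z).trans ((Finset.sum_le_sum fun i _ => h i).trans ?_)
  simp

theorem norm_coords_sq (A : Finset ι) (z : Cn ι) : ‖coords A z‖ ^ 2 = ∑ i ∈ A, ‖z i‖ ^ 2 := by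
  rw [EuclideanSpace.norm_sq_eq]
  exact Finset.sum_coe_sort A fun i => ‖z i‖ ^ 2

theorem norm_coords_mono {A B : Finset ι} (h : A ⊆ B) (z : Cn ι) :
    ‖coords A z‖ ≤ ‖coords B z‖ := by
  refine le_of_sq_le_sq ?_ (norm_nonneg _)
  rw [norm_coords_sq, norm_coords_sq]
  exact Finset.sum_le_sum_of_subset_of_nonneg h fun i _ _ => sq_nonneg _

theorem norm_coords_le (A : Finset ι) (z : Cn ι) : ‖coords A z‖ ≤ ‖z‖ := by
  refine le_of_sq_le_sq ?_ (norm_nonneg _)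
  rw [norm_coords_sq, EuclideanSpace.norm_sq_eq]
  exact Finset.sum_le_sum_of_subset_of_nonneg (Finset.subset_univ A) fun i _ _ => sq_nonneg _

theorem norm_extend (A : Finset ι) (w : Cn A) : ‖extend A w‖ = ‖w‖ := by
  refine le_antisymm ?_ (by simpa using norm_coords_le A (extend A w))
  refine le_of_sq_le_sq ?_ (norm_nonneg _)
  have h1 : ‖w‖ ^ 2 = ∑ i ∈ A, ‖extend A w i‖ ^ 2 := by
    rw [← norm_coords_sq, coords_extend]
  rw [h1, EuclideanSpace.norm_sq_eq]
  refine (Finset.sum_subset (Finset.subset_univ A) fun i _ hi => ?_).ge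
  simp [extend_apply_notMem w hi]

theorem norm_coords_single_le (A : Finset ι) (i : ι) (c : ℂ) :
    ‖coords A (EuclideanSpace.single i c)‖ ≤ ‖c‖ :=
  (norm_coords_le A _).trans (by simp)

theorem coords_single_of_notMem {A : Finset ι} {i : ι} (h : i ∉ A) (c : ℂ) :
    coords A (EuclideanSpace.single i c) = 0 := by
  ext k
  have : k.1 ≠ i := fun hk => h (hk ▸ k.2)
  simp [this]

/-- Multiplication by `t` of the coordinates with indices in `A`. -/
def scale (A : Finset ι) (t : ℝ) (z : Cn ι) : Cn ι :=
  WithLp.toLp 2 fun i => if i ∈ A then (t : ℂ) * z i else z i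

theorem scale_apply (A : Finset ι) (t : ℝ) (z : Cn ι) (i : ι) :
    scale A t z i = if i ∈ A then (t : ℂ) * z i else z i := rfl

theorem coords_scale_of_subset {A B : Finset ι} (h : B ⊆ A) (t : ℝ) (z : Cn ι) :
    coords B (scale A t z) = t • coords B z := by
  ext i
  simp [scale_apply, h i.2]

theorem coords_scale_of_disjoint {A B : Finset ι} (h : Disjoint B A) (t : ℝ) (z : Cn ι) :
    coords B (scale A t z) = coords B z := by
  ext i
  simp [scale_apply, Finset.disjoint_left.1 h i.2]

theorem scale_zero_eq (A : Finset ι) (z : Cn ι) :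
    scale A 0 z = extend Aᶜ (coords Aᶜ z) := by
  ext i
  by_cases h : i ∈ A <;> simp [scale_apply, extend_apply, h]

theorem continuous_scale (A : Finset ι) (z : Cn ι) : Continuous fun t : ℝ => scale A t z := by
  refine (PiLp.continuous_toLp 2 _).comp (continuous_pi fun i => ?_)
  by_cases h : i ∈ A
  · simp only [h, if_true]
    fun_prop
  · simp only [h, if_false]
    fun_prop

/-- Shrinking the coordinates in `A` is the way in which points of `Z_J` are approached from inside
a multi-cone. -/
theorem tendsto_scale (A : Finset ι) (z : Cn ι) :
    Tendsto (fun t : ℝ => scale A t z) (𝓝[>] 0) (𝓝 (extend Aᶜ (coords Aᶜ z))) := by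
  rw [← scale_zero_eq]
  exact ((continuous_scale A z).tendsto 0).mono_left nhdsWithin_le_nhds

/-- The extension by zero of a multi-index has the same products. -/
theorem prod_extendIndex {M : Type*} [CommMonoid M] (A : Finset ι) (a : A → ℕ) (g : ι → ℕ → M)
    (hg : ∀ i, g i 0 = 1) : ∏ i, g i (extendIndex A a i) = ∏ i : A, g i.1 (a i) := by
  rw [← Finset.prod_subset (Finset.subset_univ A) fun i _ hi => by
    rw [extendIndex_apply_notMem a hi, hg], ← Finset.prod_coe_sort]
  simp

theorem multiFactorial_extendIndex (A : Finset ι) (a : A → ℕ) :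
    multiFactorial (extendIndex A a) = multiFactorial a :=
  prod_extendIndex A a (fun _ m => m.factorial) fun _ => Nat.factorial_zero

theorem multiFactorial_ne_zero (a : ι → ℕ) : (multiFactorial a : ℂ) ≠ 0 := by
  simp [multiFactorial, Finset.prod_ne_zero_iff, Nat.factorial_ne_zero]

end CoordinateMaps

/-! ### Combinatorics of nested index sets and of the weights. -/

section Admissible

variable {ι κ : Type*} [Fintype ι] [DecidableEq ι] [Fintype κ] [DecidableEq κ]
  {I : κ → Finset ι}

theorem mem_hat {j : κ} {i : ι} : i ∈ hat I j ↔ i ∈ I j ∧ ∀ k, I k ⊂ I j → i ∉ I k := by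
  simp [hat]

theorem hat_subset (j : κ) : hat I j ⊆ I j := Finset.sdiff_subset

theorem mem_union {J : Finset κ} {i : ι} : i ∈ union I J ↔ ∃ j ∈ J, i ∈ I j := by
  simp [union]

theorem subset_union {J : Finset κ} {j : κ} (hj : j ∈ J) : I j ⊆ union I J :=
  fun _ hi => mem_union.2 ⟨j, hj, hi⟩

theorem union_mono {J K : Finset κ} (h : J ⊆ K) : union I J ⊆ union I K :=
  Finset.biUnion_subset_biUnion_of_subset_left _ h

theorem mem_free {i : ι} : i ∈ free I ↔ ∀ j, i ∉ I j := by
  simp [free]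

theorem disjoint_free_union (J : Finset κ) : Disjoint (free I) (union I J) := by
  refine Finset.disjoint_left.2 fun i hi hi' => ?_
  obtain ⟨j, _, hj⟩ := mem_union.1 hi'
  exact mem_free.1 hi j hj

theorem disjoint_hat_free (j : κ) : Disjoint (hat I j) (free I) :=
  Finset.disjoint_left.2 fun _ hi hi' => mem_free.1 hi' j (hat_subset j hi)

/-- A set of least cardinality among the `I k ⊆ I j` that contain `i` has no smaller member of the
family containing `i`. -/
theorem exists_mem_hat {i : ι} {j : κ} (hi : i ∈ I j) : ∃ k, I k ⊆ I j ∧ i ∈ hat I k := by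
  obtain ⟨k, hk, hmin⟩ := Finset.exists_min_image
    (Finset.univ.filter fun k => I k ⊆ I j ∧ i ∈ I k) (fun k => (I k).card) ⟨j, by simp [hi]⟩
  simp only [Finset.mem_filter, Finset.mem_univ, true_and] at hk hmin
  refine ⟨k, hk.1, mem_hat.2 ⟨hk.2, fun m hm him => ?_⟩⟩
  exact absurd (Finset.card_lt_card hm) (not_lt.2 (hmin m ⟨hm.subset.trans hk.1, him⟩))

theorem mem_free_or_exists_mem_hat (I : κ → Finset ι) (i : ι) :
    i ∈ free I ∨ ∃ k, i ∈ hat I k := by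
  by_cases h : ∃ j, i ∈ I j
  · obtain ⟨j, hj⟩ := h
    obtain ⟨k, _, hk⟩ := exists_mem_hat hj
    exact Or.inr ⟨k, hk⟩
  · exact Or.inl (mem_free.2 fun j hj => h ⟨j, hj⟩)

namespace IsAdmissible

variable (hI : IsAdmissible I)

include hI

theorem injective : Function.Injective I := by
  intro j k h
  by_contra hne
  rcases hI.nested j k hne with h' | h' | h'
  · exact h'.ne h
  · exact h'.ne h.symm
  · have hj := hI.strict j
    -- Equal and disjoint sets are empty, but no `I j` is empty because it strictly contains
    -- something.
    rw [h, disjoint_self, Finset.bot_eq_empty] at h'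
    rw [h, h'] at hj
    exact absurd hj (Finset.not_ssubset_empty _)

theorem hat_nonempty (j : κ) : (hat I j).Nonempty := by
  rw [hat, Finset.sdiff_nonempty]
  exact (hI.strict j).not_subset

/-- Members of the family through a common point form a chain, and a point of `hat I j` lies in no
member strictly below `I j`. Thus one point of `hat I j` decides which members contain `I j`. -/
theorem subset_of_mem_hat {i : ι} {j m : κ} (hi : i ∈ hat I j) (hm : i ∈ I m) : I j ⊆ I m := by
  by_cases h : j = m
  · rw [h]
  rcases hI.nested j m h with h' | h' | h'
  · exact h'.subset
  · exact absurd hm ((mem_hat.1 hi).2 m h')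
  · exact absurd hm (Finset.disjoint_left.1 h' (hat_subset j hi))

theorem disjoint_hat {j k : κ} (h : j ≠ k) : Disjoint (hat I j) (hat I k) := by
  refine Finset.disjoint_left.2 fun i hj hk => h (hI.injective ?_)
  exact (hI.subset_of_mem_hat hj (hat_subset k hk)).antisymm
    (hI.subset_of_mem_hat hk (hat_subset j hj))

theorem disjoint_hat_union {J : Finset κ} {j : κ} (h : ¬ I j ⊆ union I J) :
    Disjoint (hat I j) (union I J) := by
  refine Finset.disjoint_left.2 fun i hi hi' => h ?_
  obtain ⟨k, hk, hik⟩ := mem_union.1 hi'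
  exact (hI.subset_of_mem_hat hi hik).trans (subset_union hk)

theorem exists_subset_of_subset_union {J : Finset κ} {j : κ} (h : I j ⊆ union I J) :
    ∃ k ∈ J, I j ⊆ I k := by
  obtain ⟨i, hi⟩ := hI.hat_nonempty j
  obtain ⟨k, hk, hik⟩ := mem_union.1 (h (hat_subset j hi))
  exact ⟨k, hk, hI.subset_of_mem_hat hi hik⟩

end IsAdmissible

/-- The indices `k` that are covered by `j` with respect to the strict inclusion `I_k ⊂ I_j`. -/
def children (I : κ → Finset ι) (j : κ) : Finset κ :=
  Finset.univ.filter fun k => I k ⊂ I j ∧ ∀ m, ¬ (I k ⊂ I m ∧ I m ⊂ I j)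

theorem mem_children {j k : κ} :
    k ∈ children I j ↔ I k ⊂ I j ∧ ∀ m, ¬ (I k ⊂ I m ∧ I m ⊂ I j) := by
  simp [children]

theorem weight_eq (N : κ → ℕ) (j : κ) :
    weight I N j = (N j : ℤ) - ∑ k ∈ children I j, (N k : ℤ) := rfl

theorem weight_add (M N : κ → ℕ) (j : κ) :
    weight I (M + N) j = weight I M j + weight I N j := by
  simp only [weight_eq, Pi.add_apply, Nat.cast_add, Finset.sum_add_distrib]
  ring

theorem weight_zero (j : κ) : weight I 0 j = 0 := by
  simp [weight_eq]

/-- The sizes of the sets `{i} ∩ I_j`. -/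
def indicator (I : κ → Finset ι) (i : ι) (j : κ) : ℕ := if i ∈ I j then 1 else 0

namespace IsAdmissible

variable (hI : IsAdmissible I)

include hI

/-- The sets above `I k` share a point and so form a chain: the inclusions make the family a forest.
-/
theorem parent_unique {j m k : κ} (hj : k ∈ children I j) (hm : k ∈ children I m) : j = m := by
  by_contra hne
  obtain ⟨i, hi⟩ := hI.hat_nonempty k
  have hij := (mem_children.1 hj).1.subset (hat_subset k hi)
  have him := (mem_children.1 hm).1.subset (hat_subset k hi)
  rcases hI.nested j m hne with h | h | h
  · exact (mem_children.1 hm).2 j ⟨(mem_children.1 hj).1, h⟩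
  · exact (mem_children.1 hj).2 m ⟨(mem_children.1 hm).1, h⟩
  · exact Finset.disjoint_left.1 h hij him

/-- If `i ∈ I j` is not in `hat I j`, then exactly one child of `j` contains `i` and its
contribution cancels the one of `j`. So a derivative in `z_i` costs a single power of a single
distance. -/
theorem weight_indicator (i : ι) (j : κ) :
    weight I (indicator I i) j = if i ∈ hat I j then 1 else 0 := by
  rw [weight_eq]
  by_cases hij : i ∈ I j
  swap
  · have h1 : i ∉ hat I j := fun h => hij (hat_subset j h)
    rw [Finset.sum_eq_zero]
    · simp [indicator, hij, h1]
    · intro k hk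
      have : i ∉ I k := fun h => hij ((mem_children.1 hk).1.subset h)
      simp [indicator, this]
  by_cases hi : i ∈ hat I j
  · rw [Finset.sum_eq_zero]
    · simp [indicator, hij, hi]
    · intro k hk
      have : i ∉ I k := (mem_hat.1 hi).2 k (mem_children.1 hk).1
      simp [indicator, this]
  · have hex : ∃ k, I k ⊂ I j ∧ i ∈ I k := by
      by_contra hcon
      exact hi (mem_hat.2 ⟨hij, fun k hk hik => hcon ⟨k, hk, hik⟩⟩)
    -- The child through `i` is the largest member strictly below `I j` that contains `i`.
    obtain ⟨k, hk, hmax⟩ := Finset.exists_max_image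
      (Finset.univ.filter fun k => I k ⊂ I j ∧ i ∈ I k) (fun k => (I k).card)
      (hex.imp fun k hk => by simpa using hk)
    simp only [Finset.mem_filter, Finset.mem_univ, true_and] at hk hmax
    have hkc : k ∈ children I j := by
      refine mem_children.2 ⟨hk.1, fun m hm => ?_⟩
      exact absurd (Finset.card_lt_card hm.1) (not_lt.2 (hmax m ⟨hm.2, hm.1.subset hk.2⟩))
    rw [Finset.sum_eq_single_of_mem k hkc]
    · simp [indicator, hij, hi, hk.2]
    · intro m hm hne
      have : i ∉ I m := by
        intro him
        rcases hI.nested m k hne with h | h | h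
        · exact (mem_children.1 hm).2 k ⟨h, hk.1⟩
        · exact (mem_children.1 hkc).2 m ⟨h, (mem_children.1 hm).1⟩
        · exact Finset.disjoint_left.1 h him hk.2
      simp [indicator, this]

/-- The weights of the indicator function of a nonempty set `J` have a positive sum over the
indices `j` with `I_j ⊆ I_J`. -/
theorem one_le_sum_weight {J : Finset κ} (hJ : J.Nonempty) :
    1 ≤ ∑ j ∈ Finset.univ.filter (fun j => I j ⊆ union I J),
      weight I (fun j => if j ∈ J then 1 else 0) j := by
  set T := Finset.univ.filter (fun j => I j ⊆ union I J) with hT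
  set n : κ → ℕ := fun j => if j ∈ J then 1 else 0 with hn
  have hJT : J ⊆ T := fun j hj => by simpa [hT] using subset_union hj
  -- A largest member of `J` is a child of no index in `T`, so its exponent 1 is never subtracted.
  obtain ⟨r, hr, hmax⟩ := Finset.exists_max_image J (fun k => (I k).card) hJ
  have hTmax : ∀ j ∈ T, r ∉ children I j := by
    intro j hj hrj
    obtain ⟨k, hk, hjk⟩ := hI.exists_subset_of_subset_union (J := J) (by simpa [hT] using hj)
    have h1 := Finset.card_lt_card ((mem_children.1 hrj).1.trans_subset hjk)
    exact absurd h1 (not_lt.2 (hmax k hk))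
  have hdisj : (T : Set κ).PairwiseDisjoint (children I) := by
    intro j _ m _ hjm
    refine Finset.disjoint_left.2 fun k hk hk' => hjm (hI.parent_unique hk hk')
  have hsub : T.biUnion (children I) ⊆ T.erase r := by
    intro k hk
    obtain ⟨j, hj, hkj⟩ := Finset.mem_biUnion.1 hk
    refine Finset.mem_erase.2 ⟨fun h => hTmax j hj (h ▸ hkj), ?_⟩
    simp only [hT, Finset.mem_filter, Finset.mem_univ, true_and] at hj ⊢
    exact (mem_children.1 hkj).1.subset.trans hj
  -- Since parents are unique, every other exponent is subtracted at most once, hence is compensated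
  -- by its own term in the sum over `T`.
  have h1 : ∑ j ∈ T, ∑ k ∈ children I j, (n k : ℤ) ≤ ∑ k ∈ T.erase r, (n k : ℤ) := by
    rw [← Finset.sum_biUnion hdisj]
    exact Finset.sum_le_sum_of_subset_of_nonneg hsub fun k _ _ => Int.natCast_nonneg _
  have h2 : ∑ k ∈ T, (n k : ℤ) = (n r : ℤ) + ∑ k ∈ T.erase r, (n k : ℤ) :=
    (Finset.add_sum_erase T (fun k => (n k : ℤ)) (hJT hr)).symm
  have h3 : (n r : ℤ) = 1 := by simp [hn, hr]
  simp only [weight_eq, Finset.sum_sub_distrib]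
  linarith

end IsAdmissible

/-- The Euclidean distance to the coordinate subspace `Z_j`. -/
theorem infDist_Z (j : κ) (z : Cn ι) : Metric.infDist z (Z I j) = ‖coords (I j) z‖ := by
  have hmem : z - extend (I j) (coords (I j) z) ∈ Z I j := fun i hi => by
    simp [extend_apply_mem _ hi]
  refine le_antisymm ?_ ?_
  · refine (Metric.infDist_le_dist_of_mem hmem).trans_eq ?_
    rw [dist_eq_norm, sub_sub_cancel, norm_extend]
  · refine (Metric.le_infDist ⟨_, hmem⟩).2 fun y hy => ?_
    have h : coords (I j) z = coords (I j) (z - y) := by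
      refine coords_eq_iff.2 fun i hi => ?_
      simp [hy i hi]
    rw [h, dist_eq_norm]
    exact norm_coords_le _ _

end Admissible

/-! ### Partial derivatives of holomorphic functions and of polynomials. -/

section PartialDerivatives

variable {ι : Type*} [Fintype ι] [DecidableEq ι] {S : Set (Cn ι)} {f g : Cn ι → ℂ}

theorem analyticOnNhd_partialDeriv (hf : AnalyticOnNhd ℂ f S) (i : ι) :
    AnalyticOnNhd ℂ (partialDeriv i f) S := fun z hz =>
  ((ContinuousLinearMap.apply ℂ ℂ (EuclideanSpace.single i (1 : ℂ))).analyticAt _).comp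
    (hf.fderiv z hz)

theorem partialDeriv_congr (hS : IsOpen S) (h : EqOn f g S) (i : ι) :
    EqOn (partialDeriv i f) (partialDeriv i g) S := fun z hz => by
  have : f =ᶠ[𝓝 z] g := h.eventuallyEq_of_mem (hS.mem_nhds hz)
  simp only [partialDeriv, this.fderiv_eq]

theorem hasDerivAt_partialDeriv {z : Cn ι} (hf : DifferentiableAt ℂ f z) (i : ι) :
    HasDerivAt (fun ζ : ℂ => f (z + ζ • EuclideanSpace.single i 1)) (partialDeriv i f z) 0 := by
  have h1 : HasDerivAt (fun ζ : ℂ => z + ζ • EuclideanSpace.single i (1 : ℂ))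
      (EuclideanSpace.single i 1) 0 := by
    simpa using ((hasDerivAt_id (0 : ℂ)).smul_const
      (EuclideanSpace.single i (1 : ℂ) : Cn ι)).const_add z
  have h2 : HasFDerivAt f (fderiv ℂ f z) (z + (0 : ℂ) • EuclideanSpace.single i (1 : ℂ)) := by
    simpa using hf.hasFDerivAt
  exact h2.comp_hasDerivAt 0 h1

theorem partialDeriv_eq {z : Cn ι} {a : ℂ} (hf : DifferentiableAt ℂ f z) {i : ι}
    (h : HasDerivAt (fun ζ : ℂ => f (z + ζ • EuclideanSpace.single i 1)) a 0) :
    partialDeriv i f z = a :=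
  (hasDerivAt_partialDeriv hf i).unique h

theorem fderiv_apply_eq_sum (f : Cn ι → ℂ) (z v : Cn ι) :
    fderiv ℂ f z v = ∑ i, v i * partialDeriv i f z := by
  have hv : v = ∑ i, v i • EuclideanSpace.single i (1 : ℂ) := by
    ext k
    simp [Finset.sum_apply, Pi.single_apply]
  conv_lhs => rw [hv]
  simp [map_sum, partialDeriv]

theorem norm_fderiv_le (f : Cn ι → ℂ) (z : Cn ι) :
    ‖fderiv ℂ f z‖ ≤ ∑ i, ‖partialDeriv i f z‖ := by
  refine ContinuousLinearMap.opNorm_le_bound _ (Finset.sum_nonneg fun i _ => norm_nonneg _) ?_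
  intro v
  rw [fderiv_apply_eq_sum, Finset.sum_mul]
  refine (norm_sum_le _ _).trans (Finset.sum_le_sum fun i _ => ?_)
  rw [norm_mul, mul_comm]
  exact mul_le_mul_of_nonneg_left (norm_apply_le v i) (norm_nonneg _)

theorem partialDeriv_comm (hf : AnalyticOnNhd ℂ f S) (i j : ι) :
    EqOn (partialDeriv i (partialDeriv j f)) (partialDeriv j (partialDeriv i f)) S := by
  intro z hz
  have hd : DifferentiableAt ℂ (fderiv ℂ f) z := (hf.fderiv z hz).differentiableAt
  have key : ∀ a b : ι, partialDeriv a (partialDeriv b f) z =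
      fderiv ℂ (fderiv ℂ f) z (EuclideanSpace.single a 1) (EuclideanSpace.single b 1) := by
    intro a b
    have h : HasFDerivAt (partialDeriv b f)
        ((ContinuousLinearMap.apply ℂ ℂ (EuclideanSpace.single b (1 : ℂ))).comp
          (fderiv ℂ (fderiv ℂ f) z)) z :=
      (ContinuousLinearMap.apply ℂ ℂ (EuclideanSpace.single b (1 : ℂ))).hasFDerivAt.comp z
        hd.hasFDerivAt
    rw [partialDeriv, h.fderiv]
    rfl
  rw [key, key]
  have hs : IsSymmSndFDerivAt ℂ f z :=
    ((hf z hz).contDiffAt (n := 2)).isSymmSndFDerivAt (by simp)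
  exact hs _ _

/-- The partial derivatives `∂_i^{γ_i}` for the `i` in a list. -/
def foldPartial (l : List ι) (γ : ι → ℕ) (f : Cn ι → ℂ) : Cn ι → ℂ :=
  l.foldr (fun i g => (partialDeriv i)^[γ i] g) f

theorem analyticOnNhd_iterate_partialDeriv (hf : AnalyticOnNhd ℂ f S) (i : ι) (m : ℕ) :
    AnalyticOnNhd ℂ ((partialDeriv i)^[m] f) S := by
  induction m with
  | zero => exact hf
  | succ m ih =>
    rw [Function.iterate_succ_apply']
    exact analyticOnNhd_partialDeriv ih i

theorem analyticOnNhd_foldPartial (hf : AnalyticOnNhd ℂ f S) (l : List ι) (γ : ι → ℕ) :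
    AnalyticOnNhd ℂ (foldPartial l γ f) S := by
  induction l with
  | nil => exact hf
  | cons i l ih => exact analyticOnNhd_iterate_partialDeriv ih i _

theorem analyticOnNhd_iteratedPartial (hf : AnalyticOnNhd ℂ f S) (γ : ι → ℕ) :
    AnalyticOnNhd ℂ (iteratedPartial γ f) S :=
  analyticOnNhd_foldPartial hf _ γ

theorem iterate_partialDeriv_congr (hS : IsOpen S) (h : EqOn f g S) (i : ι) (m : ℕ) :
    EqOn ((partialDeriv i)^[m] f) ((partialDeriv i)^[m] g) S := by
  induction m with
  | zero => exact h
  | succ m ih =>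
    rw [Function.iterate_succ_apply', Function.iterate_succ_apply']
    exact partialDeriv_congr hS ih i

theorem partialDeriv_iterate_comm (hS : IsOpen S) (hf : AnalyticOnNhd ℂ f S) (i j : ι) (m : ℕ) :
    EqOn (partialDeriv i ((partialDeriv j)^[m] f)) ((partialDeriv j)^[m] (partialDeriv i f)) S := by
  induction m with
  | zero => exact fun _ _ => rfl
  | succ m ih =>
    rw [Function.iterate_succ_apply', Function.iterate_succ_apply']
    exact (partialDeriv_comm (analyticOnNhd_iterate_partialDeriv hf j m) i j).trans
      (partialDeriv_congr hS ih j)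

theorem foldPartial_congr_index (l : List ι) {γ δ : ι → ℕ} (h : ∀ i ∈ l, γ i = δ i)
    (f : Cn ι → ℂ) : foldPartial l γ f = foldPartial l δ f := by
  induction l with
  | nil => rfl
  | cons i l ih =>
    have h1 := ih fun k hk => h k (List.mem_cons_of_mem i hk)
    simp only [foldPartial, List.foldr_cons] at h1 ⊢
    rw [h1, h i List.mem_cons_self]

/-- The additional derivative commutes with the others and can be moved to the place of `i` in the
list. Without repetitions in the list the exponent of `i` is used only once. -/
theorem partialDeriv_foldPartial (hS : IsOpen S) (hf : AnalyticOnNhd ℂ f S) (γ : ι → ℕ) (i : ι)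
    {l : List ι} (hl : l.Nodup) (hi : i ∈ l) :
    EqOn (partialDeriv i (foldPartial l γ f)) (foldPartial l (γ + Pi.single i 1) f) S := by
  induction l with
  | nil => simp at hi
  | cons k l ih =>
    rw [List.nodup_cons] at hl
    by_cases hik : i = k
    · subst hik
      have h1 : foldPartial l (γ + Pi.single i 1) f = foldPartial l γ f :=
        foldPartial_congr_index l (fun m hm => by
          have : m ≠ i := fun h => hl.1 (h ▸ hm)
          simp [this]) f
      have h2 : foldPartial (i :: l) (γ + Pi.single i 1) f =
          partialDeriv i (foldPartial (i :: l) γ f) := by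
        change (partialDeriv i)^[(γ + Pi.single i 1 : ι → ℕ) i] (foldPartial l (γ + Pi.single i 1) f) =
          partialDeriv i ((partialDeriv i)^[γ i] (foldPartial l γ f))
        rw [h1, ← Function.iterate_succ_apply' (partialDeriv i)]
        simp
      rw [h2]
      exact fun _ _ => rfl
    · have hil : i ∈ l := by simpa [hik] using hi
      have h1 := (partialDeriv_iterate_comm hS (analyticOnNhd_foldPartial hf l γ) i k (γ k)).trans
        (iterate_partialDeriv_congr hS (ih hl.2 hil) k (γ k))
      have h2 : (γ + Pi.single i 1 : ι → ℕ) k = γ k := by simp [Ne.symm hik]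
      change EqOn (partialDeriv i ((partialDeriv k)^[γ k] (foldPartial l γ f)))
        ((partialDeriv k)^[(γ + Pi.single i 1 : ι → ℕ) k] (foldPartial l (γ + Pi.single i 1) f)) S
      rwa [h2]

theorem partialDeriv_iteratedPartial (hS : IsOpen S) (hf : AnalyticOnNhd ℂ f S) (γ : ι → ℕ)
    (i : ι) : EqOn (partialDeriv i (iteratedPartial γ f))
      (iteratedPartial (γ + Pi.single i 1) f) S :=
  partialDeriv_foldPartial hS hf γ i (Finset.nodup_toList _) (by simp)

theorem foldPartial_zero (l : List ι) (f : Cn ι → ℂ) : foldPartial l 0 f = f := by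
  induction l with
  | nil => rfl
  | cons i l ih => exact ih

theorem iteratedPartial_zero (f : Cn ι → ℂ) : iteratedPartial 0 f = f :=
  foldPartial_zero _ f

/-- The polynomial `∑_{a ∈ s} c_a z^a / a!`. -/
def poly (s : Finset (ι → ℕ)) (c : (ι → ℕ) → ℂ) (z : Cn ι) : ℂ :=
  ∑ a ∈ s, c a * (∏ i, z i ^ a i) / (multiFactorial a : ℂ)

/-- For `a i = 0` the truncated exponent `a i - 1` is harmless because of the factor `a i`. -/
theorem hasDerivAt_monomial (a : ι → ℕ) (z : Cn ι) (i : ι) :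
    HasDerivAt (fun ζ : ℂ => ∏ k, (z + ζ • EuclideanSpace.single i 1 : Cn ι) k ^ a k)
      (a i * z i ^ (a i - 1) * ∏ k ∈ Finset.univ.erase i, z k ^ a k) 0 := by
  have h1 : (fun ζ : ℂ => ∏ k, (z + ζ • EuclideanSpace.single i 1 : Cn ι) k ^ a k) =
      fun ζ : ℂ => (z i + ζ) ^ a i * ∏ k ∈ Finset.univ.erase i, z k ^ a k := by
    funext ζ
    rw [← Finset.mul_prod_erase Finset.univ _ (Finset.mem_univ i)]
    congr 1
    · simp
    · refine Finset.prod_congr rfl fun k hk => ?_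
      have : k ≠ i := Finset.ne_of_mem_erase hk
      simp [this]
  rw [h1]
  have h2 : HasDerivAt (fun ζ : ℂ => (z i + ζ) ^ a i) (a i * (z i + 0) ^ (a i - 1) * 1) 0 :=
    ((hasDerivAt_id (0 : ℂ)).const_add (z i)).pow (a i)
  simpa using h2.mul_const (∏ k ∈ Finset.univ.erase i, z k ^ a k)

theorem multiFactorial_add_single (a : ι → ℕ) (i : ι) :
    multiFactorial (a + Pi.single i 1) = (a i + 1) * multiFactorial a := by
  rw [multiFactorial, multiFactorial, ← Finset.mul_prod_erase Finset.univ _ (Finset.mem_univ i),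
    ← Finset.mul_prod_erase Finset.univ (fun k => (a k).factorial) (Finset.mem_univ i),
    ← mul_assoc]
  congr 1
  · simp [Nat.factorial_succ]
  · refine Finset.prod_congr rfl fun k hk => ?_
    simp [Finset.ne_of_mem_erase hk]

/-- With the normalization by `a!` differentiation is a pure shift of the coefficients. The free
choice of `t` serves the truncations of the expansion and ordinary Taylor polynomials alike. -/
theorem hasDerivAt_poly {s t : Finset (ι → ℕ)} {i : ι} (hst : ∀ a, a ∈ t ↔ a + Pi.single i 1 ∈ s)
    (c : (ι → ℕ) → ℂ) (z : Cn ι) :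
    HasDerivAt (fun ζ : ℂ => poly s c (z + ζ • EuclideanSpace.single i 1))
      (poly t (fun a => c (a + Pi.single i 1)) z) 0 := by
  have h1 : HasDerivAt (fun ζ : ℂ => poly s c (z + ζ • EuclideanSpace.single i 1))
      (∑ a ∈ s, c a * (a i * z i ^ (a i - 1) * ∏ k ∈ Finset.univ.erase i, z k ^ a k) /
        (multiFactorial a : ℂ)) 0 :=
    HasDerivAt.fun_sum fun a _ => ((hasDerivAt_monomial a z i).const_mul (c a)).div_const _
  convert h1 using 1
  refine Finset.sum_of_injOn (fun a => a + Pi.single i 1) (fun a _ b _ h => add_right_cancel h)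
    (fun a ha => (hst a).1 ha) ?_ ?_
  -- Indices that are not shifts have `a i = 0`, and the derivatives of their monomials vanish.
  · intro a ha hna
    have hai : a i = 0 := by
      by_contra h
      have hle : Pi.single i 1 ≤ a := by
        intro k
        by_cases hk : k = i
        · subst hk
          simpa using Nat.one_le_iff_ne_zero.2 h
        · simp [hk]
      refine hna ⟨a - Pi.single i 1, ?_, tsub_add_cancel_of_le hle⟩
      exact Finset.mem_coe.2 ((hst _).2 (by rwa [tsub_add_cancel_of_le hle]))
    simp [hai]
  · intro a _
    have h2 : ∏ k ∈ Finset.univ.erase i, z k ^ (a + Pi.single i 1 : ι → ℕ) k =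
        ∏ k ∈ Finset.univ.erase i, z k ^ a k := by
      refine Finset.prod_congr rfl fun k hk => ?_
      simp [Finset.ne_of_mem_erase hk]
    have h3 : ∏ k, z k ^ a k = z i ^ a i * ∏ k ∈ Finset.univ.erase i, z k ^ a k :=
      (Finset.mul_prod_erase Finset.univ (fun k => z k ^ a k) (Finset.mem_univ i)).symm
    have h4 := multiFactorial_ne_zero a
    have h5 : ((a i : ℂ) + 1) ≠ 0 := Nat.cast_add_one_ne_zero _
    rw [h2]
    simp only [h3, multiFactorial_add_single, Pi.add_apply, Pi.single_eq_same,
      Nat.add_sub_cancel]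
    push_cast
    field_simp

theorem differentiable_poly (s : Finset (ι → ℕ)) (c : (ι → ℕ) → ℂ) :
    Differentiable ℂ (poly s c) := by
  unfold poly
  fun_prop

end PartialDerivatives

/-! ### Convex cones: margins, positive functionals, intermediate cones. -/

section Cones

variable {V : Type*} [NormedAddCommGroup V] [NormedSpace ℝ V] [FiniteDimensional ℝ V]

/-- Invariance under multiplication by positive reals. -/
def IsCone (C : Set V) : Prop := ∀ t : ℝ, 0 < t → ∀ v ∈ C, t • v ∈ C

theorem IsCone.isCone_closure {C : Set V} (hC : IsCone C) : IsCone (closure C) := fun t ht _ hv =>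
  map_mem_closure (continuous_const_smul t) hv fun w hw => hC t ht w hw

theorem IsCone.mem_of_smul_mem {C : Set V} (hC : IsCone C) {t : ℝ} (ht : 0 < t) {v : V}
    (h : t • v ∈ C) : v ∈ C := by
  simpa [smul_smul, inv_mul_cancel₀ ht.ne'] using hC t⁻¹ (inv_pos.2 ht) _ h

theorem isCompact_closure_inter_sphere (C : Set V) :
    IsCompact (closure C ∩ Metric.sphere 0 1) :=
  haveI := FiniteDimensional.proper ℝ V
  (isCompact_sphere 0 1).inter_left isClosed_closure

theorem IsCone.normalize_mem {C : Set V} (hC : IsCone C) {u : V} (hu : u ∈ C) (h0 : u ≠ 0) :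
    ‖u‖⁻¹ • u ∈ C ∩ Metric.sphere 0 1 := by
  have hu' : 0 < ‖u‖ := norm_pos_iff.2 h0
  refine ⟨hC _ (inv_pos.2 hu') u hu, ?_⟩
  simp [norm_smul, hu'.ne']

/-- Compactness of the unit vectors in `closure C` gives a uniform margin, which homogeneity carries
to all lengths. -/
theorem IsCone.exists_margin {C G : Set V} (hC : IsCone C) (hG : IsCone G) (hGo : IsOpen G)
    (h : closure C \ {0} ⊆ G) :
    ∃ δ > 0, ∀ u ∈ closure C, u ≠ 0 → ∀ v, ‖v - u‖ ≤ δ * ‖u‖ → v ∈ G := by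
  have hK : closure C ∩ Metric.sphere 0 1 ⊆ G := fun u hu => h ⟨hu.1, by
    rintro rfl
    simpa using hu.2⟩
  obtain ⟨δ, hδ, hδG⟩ := (isCompact_closure_inter_sphere C).exists_cthickening_subset_open hGo hK
  refine ⟨δ, hδ, fun u hu h0 v hv => ?_⟩
  have hu' : 0 < ‖u‖ := norm_pos_iff.2 h0
  refine hG.mem_of_smul_mem (inv_pos.2 hu') (hδG ?_)
  refine Metric.mem_cthickening_of_dist_le _ _ _ _ (hC.isCone_closure.normalize_mem hu h0) ?_
  rw [dist_eq_norm, ← smul_sub, norm_smul, norm_inv, norm_norm, inv_mul_le_iff₀ hu', mul_comm]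
  exact hv

/-- Hahn-Banach separates `0` from `G`; the lower bound is the minimum of the functional over the
unit vectors of `closure C`. -/
theorem IsCone.exists_functional {C G : Set V} (hC : IsCone C) (hGo : IsOpen G)
    (hGc : Convex ℝ G) (h0 : (0 : V) ∉ G) (h : closure C \ {0} ⊆ G) :
    ∃ φ : V →L[ℝ] ℝ, (∀ v ∈ G, 0 < φ v) ∧ ∃ c > 0, ∀ u ∈ closure C, c * ‖u‖ ≤ φ u := by
  obtain ⟨φ, hφ⟩ := geometric_hahn_banach_point_open hGc hGo h0
  have hpos : ∀ v ∈ G, 0 < φ v := fun v hv => by simpa using hφ v hv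
  have hK : ∀ u ∈ closure C ∩ Metric.sphere 0 1, 0 < φ u := fun u hu => hpos u (h ⟨hu.1, by
    rintro rfl
    simpa using hu.2⟩)
  obtain ⟨c, hc, hcK⟩ := (isCompact_closure_inter_sphere C).exists_forall_le'
    φ.continuous.continuousOn hK
  refine ⟨φ, hpos, c, hc, fun u hu => ?_⟩
  rcases eq_or_ne u 0 with rfl | hne
  · simp
  have hu' : 0 < ‖u‖ := norm_pos_iff.2 hne
  have := hcK _ (hC.isCone_closure.normalize_mem hu hne)
  rwa [map_smul, smul_eq_mul, le_inv_mul_iff₀ hu', mul_comm] at this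

/-- The properties required of the cones `G_j`. -/
structure IsProperCone (G : Set V) : Prop where
  isOpen : IsOpen G
  convex : Convex ℝ G
  nonempty : G.Nonempty
  isCone : IsCone G
  proper : ∀ v ∈ G, -v ∉ G

theorem IsProperCone.zero_notMem {G : Set V} (hG : IsProperCone G) : (0 : V) ∉ G := fun h =>
  hG.proper 0 h (by simpa using h)

theorem IsProperCone.ne_zero {G : Set V} (hG : IsProperCone G) {v : V} (hv : v ∈ G) : v ≠ 0 :=
  fun h => hG.zero_notMem (h ▸ hv)

/-- Between a convex cone `C` and a proper open convex cone `G` that contains `closure C \ {0}`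
there is a further proper open convex cone. -/
theorem IsProperCone.exists_between {C G : Set V} (hG : IsProperCone G) (hC : IsCone C)
    (hCc : Convex ℝ C) (hCn : C.Nonempty) (hCG : C ⊆ G) (h : closure C \ {0} ⊆ G) :
    ∃ E : Set V, IsProperCone E ∧ closure C \ {0} ⊆ E ∧ closure E \ {0} ⊆ G := by
  obtain ⟨η, hη, hmargin⟩ := hC.exists_margin hG.isCone hG.isOpen h
  obtain ⟨φ, hφ, c, hc, hcφ⟩ := hC.exists_functional hG.isOpen hG.convex hG.zero_notMem h
  -- The bound by `η / 2` keeps the new cone within the margin of `G`, the bound by `1 / 2` keeps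
  -- `0` out of it.
  obtain ⟨δ, hδ, hδη, hδ1⟩ : ∃ δ > 0, δ * ‖φ‖ ≤ η / 2 ∧ δ * ‖φ‖ ≤ 1 / 2 := by
    have hp : 0 < ‖φ‖ + 1 := by positivity
    refine ⟨min (η / 2) (1 / 2) / (‖φ‖ + 1), by positivity, ?_, ?_⟩
    all_goals
      rw [div_mul_eq_mul_div, div_le_iff₀ hp]
      nlinarith [min_le_left (η / 2) (1 / 2), min_le_right (η / 2) (1 / 2), norm_nonneg φ,
        show 0 < min (η / 2) (1 / 2) by positivity]
  have hφle : ∀ u, δ * φ u ≤ δ * ‖φ‖ * ‖u‖ := fun u => by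
    rw [mul_assoc]
    exact mul_le_mul_of_nonneg_left ((le_abs_self _).trans (φ.le_opNorm u)) hδ.le
  -- The radii of the balls are linear in the centre `u`; this makes the union `E` a convex cone.
  set E : Set V := {v | ∃ u ∈ C, ‖v - u‖ < δ * φ u} with hE
  have hCE : C ⊆ E := fun u hu => ⟨u, hu, by simpa using mul_pos hδ (hφ u (hCG hu))⟩
  have hEo : IsOpen E := by
    have : E = ⋃ u ∈ C, Metric.ball u (δ * φ u) := by
      ext v
      simp [hE, dist_eq_norm]
    rw [this]
    exact isOpen_biUnion fun u _ => Metric.isOpen_ball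
  have hEC : IsCone E := by
    rintro t ht v ⟨u, hu, huv⟩
    refine ⟨t • u, hC t ht u hu, ?_⟩
    rw [← smul_sub, norm_smul, Real.norm_of_nonneg ht.le, map_smul, smul_eq_mul]
    nlinarith
  have hEG' : closure E \ {0} ⊆ G := by
    rintro v ⟨hv, hv0 : v ≠ 0⟩
    have hvpos : 0 < ‖v‖ := norm_pos_iff.2 hv0
    -- The precision `1 / 4` gives `‖v‖ ≤ 2‖u‖`, and then `η / 8` bounds `‖v - w‖` by `η‖u‖ / 4`;
    -- together with `‖w - u‖ ≤ η‖u‖ / 2` the margin is respected.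
    obtain ⟨w, ⟨u, hu, hwu⟩, hvw⟩ := Metric.mem_closure_iff.1 hv
      (‖v‖ * min (η / 8) (1 / 4)) (by positivity)
    rw [dist_eq_norm] at hvw
    have h1 : ‖w - u‖ ≤ δ * ‖φ‖ * ‖u‖ := hwu.le.trans (hφle u)
    have hu0 : u ≠ 0 := hG.ne_zero (hCG hu)
    refine hmargin u (subset_closure hu) hu0 v ?_
    have h2 : ‖v - u‖ ≤ ‖v - w‖ + ‖w - u‖ := norm_sub_le_norm_sub_add_norm_sub v w u
    have h3 : ‖v‖ ≤ ‖v - u‖ + ‖u‖ := by simpa using norm_add_le (v - u) u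
    have h4 : ‖v‖ * min (η / 8) (1 / 4) ≤ ‖v‖ * (η / 8) :=
      mul_le_mul_of_nonneg_left (min_le_left _ _) hvpos.le
    have h5 : ‖v‖ * min (η / 8) (1 / 4) ≤ ‖v‖ * (1 / 4) :=
      mul_le_mul_of_nonneg_left (min_le_right _ _) hvpos.le
    have h6 : ‖w - u‖ ≤ 1 / 2 * ‖u‖ :=
      h1.trans (mul_le_mul_of_nonneg_right hδ1 (norm_nonneg u))
    have h7 : ‖w - u‖ ≤ η / 2 * ‖u‖ :=
      h1.trans (mul_le_mul_of_nonneg_right hδη (norm_nonneg u))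
    have h8 : ‖v‖ ≤ 2 * ‖u‖ := by linarith
    have h9 : ‖v‖ * (η / 8) ≤ 2 * ‖u‖ * (η / 8) := mul_le_mul_of_nonneg_right h8 (by positivity)
    have h10 : 0 < η * ‖u‖ := mul_pos hη (norm_pos_iff.2 hu0)
    linarith
  have hE0 : (0 : V) ∉ E := by
    rintro ⟨u, hu, h0u⟩
    have h1 : 0 < ‖u‖ := norm_pos_iff.2 (hG.ne_zero (hCG hu))
    have h2 := mul_le_mul_of_nonneg_right hδ1 h1.le
    rw [zero_sub, norm_neg] at h0u
    linarith [hφle u]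
  have hEG : E ⊆ G := fun v hv => hEG' ⟨subset_closure hv, fun h => hE0 (h ▸ hv)⟩
  refine ⟨E, ⟨hEo, ?_, hCn.mono hCE, hEC, fun v hv hv' => hG.proper v (hEG hv) (hEG hv')⟩, ?_,
    hEG'⟩
  · rintro v ⟨u, hu, hvu⟩ v' ⟨u', hu', hvu'⟩ a b ha hb hab
    refine ⟨a • u + b • u', hCc hu hu' ha hb hab, ?_⟩
    have h1 : a • v + b • v' - (a • u + b • u') = a • (v - u) + b • (v' - u') := by
      simp only [smul_sub]
      abel
    rw [h1]
    refine (norm_add_le _ _).trans_lt ?_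
    rw [norm_smul, norm_smul, Real.norm_of_nonneg ha, Real.norm_of_nonneg hb, map_add, map_smul,
      map_smul, smul_eq_mul, smul_eq_mul]
    -- One strictly weighted strict inequality suffices, so only `a = 0` needs separate treatment.
    rcases eq_or_lt_of_le ha with rfl | ha'
    · have : b = 1 := by linarith
      subst this
      simpa using hvu'
    · nlinarith [mul_le_mul_of_nonneg_left hvu'.le hb, mul_lt_mul_of_pos_left hvu ha']
  · rintro v ⟨hv, hv0 : v ≠ 0⟩
    have hvpos : 0 < ‖v‖ := norm_pos_iff.2 hv0
    -- This choice ensures `s ≤ δ c (1 - s)`, so that `‖v - u‖ < s‖v‖ ≤ δ c ‖u‖ ≤ δ φ(u)`.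
    set s : ℝ := δ * c / (2 * (1 + δ * c)) with hs
    have hdc : 0 < δ * c := mul_pos hδ hc
    have hspos : 0 < s := by positivity
    obtain ⟨u, hu, hvu⟩ := Metric.mem_closure_iff.1 hv (s * ‖v‖) (by positivity)
    rw [dist_eq_norm] at hvu
    refine ⟨u, hu, hvu.trans_le ?_⟩
    have h1 : ‖v‖ ≤ ‖v - u‖ + ‖u‖ := by simpa using norm_add_le (v - u) u
    have h2 := mul_le_mul_of_nonneg_left (hcφ u (subset_closure hu)) hδ.le
    have h3 : s * (2 * (1 + δ * c)) = δ * c := by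
      rw [hs]
      field_simp
    have h4 : (1 - s) * ‖v‖ ≤ ‖u‖ := by linarith
    have h5 : δ * c * ((1 - s) * ‖v‖) ≤ δ * c * ‖u‖ := mul_le_mul_of_nonneg_left h4 hdc.le
    have h6 : s ≤ δ * c * (1 - s) := by nlinarith
    nlinarith

/-- This is `exists_between` for the open ray through `x`. -/
theorem IsProperCone.exists_subcone {G : Set V} (hG : IsProperCone G) {x : V} (hx : x ∈ G) :
    ∃ E : Set V, IsProperCone E ∧ x ∈ E ∧ closure E \ {0} ⊆ G := by
  set C : Set V := {v | ∃ t : ℝ, 0 < t ∧ v = t • x} with hCdef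
  have hx0 : 0 < ‖x‖ := norm_pos_iff.2 (hG.ne_zero hx)
  have hxC : x ∈ C := ⟨1, one_pos, by simp⟩
  -- The closed ray written as a solution set of a continuous equation; it contains the closure of
  -- the open ray.
  have hclosed : IsClosed {v : V | v = (‖v‖ / ‖x‖) • x} :=
    isClosed_eq continuous_id ((continuous_norm.div_const _).smul continuous_const)
  have hsub : closure C ⊆ {v : V | v = (‖v‖ / ‖x‖) • x} := by
    refine closure_minimal ?_ hclosed
    rintro v ⟨t, ht, rfl⟩
    simp [norm_smul, abs_of_pos ht, hx0.ne']
  obtain ⟨E, hE, hCE, hEG⟩ := hG.exists_between (C := C)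
    (by
      rintro s hs v ⟨t, ht, rfl⟩
      exact ⟨s * t, mul_pos hs ht, by rw [smul_smul]⟩)
    (by
      rintro v ⟨t, ht, rfl⟩ v' ⟨t', ht', rfl⟩ a b ha hb hab
      refine ⟨a * t + b * t', ?_, by rw [smul_smul, smul_smul, add_smul]⟩
      rcases eq_or_lt_of_le ha with rfl | ha'
      · have : b = 1 := by linarith
        subst this
        simpa using ht'
      · have := mul_pos ha' ht
        have := mul_nonneg hb ht'.le
        linarith)
    ⟨x, hxC⟩
    (by
      rintro v ⟨t, ht, rfl⟩
      exact hG.isCone t ht x hx)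
    (by
      rintro v ⟨hv, hv0 : v ≠ 0⟩
      have h1 : v = (‖v‖ / ‖x‖) • x := hsub hv
      rw [h1]
      exact hG.isCone _ (div_pos (norm_pos_iff.2 hv0) hx0) x hx)
  exact ⟨E, hE, hCE ⟨subset_closure hxC, hG.ne_zero hx⟩, hEG⟩

end Cones

/-! ### Proper multi-cones and proper containment. -/

section ProperMultiCones

variable {ι κ : Type*} [Fintype ι] [DecidableEq ι] [Fintype κ] [DecidableEq κ]
  {I : κ → Finset ι} {D D' : ConeData I}

namespace ConeData

theorem IsProper.isProperCone (hD : D.IsProper) (j : κ) : IsProperCone (D.G j) :=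
  ⟨hD.G_open j, hD.G_convex j, hD.G_nonempty j, hD.G_cone j, hD.G_proper j⟩

theorem mem_S {z : Cn ι} : z ∈ D.S ↔
    (∀ j, ‖coords (hat I j) z‖ < D.r j) ∧ coords (free I) z ∈ D.W ∧
      (∀ j, coords (hat I j) z ∈ D.G j) ∧
      ∀ j k, I k ⊂ I j → ‖coords (hat I k) z‖ < D.ε * ‖coords (hat I j) z‖ := by
  simp only [S, U, mem_ofPred_eq, mem_ball_zero_iff]
  constructor
  · rintro ⟨⟨h1, h2⟩, h3⟩
    exact ⟨h1, h2, fun j => (h3 j).1, fun j => (h3 j).2⟩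
  · rintro ⟨h1, h2, h3, h4⟩
    exact ⟨⟨h1, h2⟩, fun j => ⟨h3 j, h4 j⟩⟩

theorem IsProper.isOpen_S (hD : D.IsProper) : IsOpen D.S := by
  have h : D.S = (⋂ j, {z | ‖coords (hat I j) z‖ < D.r j}) ∩ {z | coords (free I) z ∈ D.W} ∩
      (⋂ j, {z | coords (hat I j) z ∈ D.G j}) ∩
      ⋂ j, ⋂ k, ⋂ _ : I k ⊂ I j, {z | ‖coords (hat I k) z‖ < D.ε * ‖coords (hat I j) z‖} := by
    ext z
    rw [mem_S]
    simp only [mem_inter_iff, mem_iInter, mem_ofPred_eq]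
    tauto
  rw [h]
  have hn : ∀ j, Continuous fun z : Cn ι => ‖coords (hat I j) z‖ := fun j =>
    (continuous_coords _).norm
  refine (((isOpen_iInter_of_finite fun j => isOpen_lt (hn j) continuous_const).inter
    (hD.W_open.preimage (continuous_coords _))).inter
    (isOpen_iInter_of_finite fun j => (hD.G_open j).preimage (continuous_coords _))).inter ?_
  exact isOpen_iInter_of_finite fun j => isOpen_iInter_of_finite fun k =>
    isOpen_iInter_of_finite fun _ => isOpen_lt (hn k) (continuous_const.mul (hn j))

theorem closure_U_subset : closure D.U ⊆
    {z | (∀ j, ‖coords (hat I j) z‖ ≤ D.r j) ∧ coords (free I) z ∈ closure D.W} := by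
  have h : {z : Cn ι | (∀ j, ‖coords (hat I j) z‖ ≤ D.r j) ∧ coords (free I) z ∈ closure D.W} =
      (⋂ j, {z | ‖coords (hat I j) z‖ ≤ D.r j}) ∩ coords (free I) ⁻¹' closure D.W := by
    ext z
    simp
  rw [h]
  refine closure_minimal ?_ ((isClosed_iInter fun j =>
    isClosed_le (continuous_coords _).norm continuous_const).inter
      (isClosed_closure.preimage (continuous_coords _)))
  rintro z ⟨hz1, hz2⟩
  exact ⟨mem_iInter.2 fun j => (mem_ball_zero_iff.1 (hz1 j)).le, subset_closure hz2⟩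

/-- `U` is a product, so its relative compactness can be tested on the radii and on `W`. -/
theorem properlyContained_of (hε : D'.ε < D.ε) (hr : ∀ j, D'.r j < D.r j)
    (hWc : IsCompact (closure D'.W)) (hW : closure D'.W ⊆ D.W)
    (hG : ∀ j, closure (D'.G j) \ {0} ⊆ D.G j) : D'.ProperlyContained D where
  ε_lt := hε
  U_compact := by
    obtain ⟨M, hM⟩ := hWc.isBounded.exists_norm_le
    set R : ℝ := ∑ j, |D'.r j| + |M| with hR
    refine Metric.isCompact_of_isClosed_isBounded isClosed_closure ?_
    refine isBounded_iff_forall_norm_le.2 ⟨Fintype.card ι * R, fun z hz => ?_⟩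
    obtain ⟨h1, h2⟩ := closure_U_subset hz
    refine norm_le_of_forall_apply_le fun i => ?_
    rcases mem_free_or_exists_mem_hat I i with hi | ⟨k, hi⟩
    · have h3 := (norm_apply_le_coords z hi).trans (hM _ h2)
      have h4 : 0 ≤ ∑ j, |D'.r j| := Finset.sum_nonneg fun j _ => abs_nonneg _
      linarith [le_abs_self M]
    · have h3 := (norm_apply_le_coords z hi).trans (h1 k)
      have h4 : |D'.r k| ≤ ∑ j, |D'.r j| :=
        Finset.single_le_sum (f := fun j => |D'.r j|) (fun j _ => abs_nonneg _)
          (Finset.mem_univ k)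
      linarith [le_abs_self (D'.r k), abs_nonneg M]
  U_subset := by
    intro z hz
    obtain ⟨h1, h2⟩ := closure_U_subset hz
    exact ⟨fun j => mem_ball_zero_iff.2 ((h1 j).trans_lt (hr j)), hW h2⟩
  G_subset := hG

variable (hI : IsAdmissible I) (hD' : D'.IsProper) (h : D'.ProperlyContained D)

include hD' in
theorem IsProper.extend_free_mem_U {v : Cn ↥(free I)} (hv : v ∈ D'.W) :
    extend (free I) v ∈ D'.U := by
  refine ⟨fun j => ?_, by simpa using hv⟩
  rw [coords_extend_of_disjoint (disjoint_hat_free j)]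
  exact Metric.mem_ball_self (hD'.r_pos j)

include hD' in
theorem IsProper.extend_free_mem_closure_U {v : Cn ↥(free I)} (hv : v ∈ closure D'.W) :
    extend (free I) v ∈ closure D'.U :=
  map_mem_closure (continuous_extend _) hv fun _ hw => hD'.extend_free_mem_U hw

include hD' h in
theorem ProperlyContained.closure_W_subset : closure D'.W ⊆ D.W := fun v hv => by
  simpa using (h.U_subset (hD'.extend_free_mem_closure_U hv)).2

include hD' h in
theorem ProperlyContained.isCompact_closure_W : IsCompact (closure D'.W) := by
  refine (h.U_compact.image (continuous_coords (free I))).of_isClosed_subset isClosed_closure ?_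
  exact fun v hv => ⟨_, hD'.extend_free_mem_closure_U hv, coords_extend _ _⟩

-- Proper containment speaks only of the closure of `U'`. This closure contains a point whose
-- component in `hat I j` has norm exactly the radius of `D'`, since `hat I j` is not empty.
include hI hD' h in
theorem ProperlyContained.r_lt (j : κ) : D'.r j < D.r j := by
  obtain ⟨i, hi⟩ := hI.hat_nonempty j
  obtain ⟨w, hw⟩ := hD'.W_nonempty
  have hr := hD'.r_pos j
  -- The path stays in `U'` for `t < 1` and reaches the sphere bounding the `j`-th ball at `t = 1`.
  set p : ℝ → Cn ι := fun t => extend (free I) w +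
    t • extend (hat I j) (EuclideanSpace.single ⟨i, hi⟩ (D'.r j : ℂ)) with hp
  have hpU : ∀ t ∈ Ioo (0 : ℝ) 1, p t ∈ D'.U := by
    intro t ht
    refine ⟨fun k => ?_, ?_⟩
    · simp only [hp]
      rw [coords_add, coords_real_smul, coords_extend_of_disjoint (disjoint_hat_free k), zero_add,
        mem_ball_zero_iff, norm_smul, Real.norm_of_nonneg ht.1.le]
      by_cases hjk : k = j
      · subst hjk
        rw [coords_extend]
        simp only [PiLp.norm_single, Complex.norm_real, Real.norm_of_nonneg hr.le]
        nlinarith [ht.2]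
      · rw [coords_extend_of_disjoint (hI.disjoint_hat hjk)]
        simpa using hD'.r_pos k
    · simp only [hp]
      rw [coords_add, coords_real_smul, coords_extend,
        coords_extend_of_disjoint (disjoint_hat_free j).symm]
      simpa using hw
  have hcont : Continuous p := by
    simp only [hp]
    fun_prop
  have h1 : p 1 ∈ closure D'.U := by
    have h1c : (1 : ℝ) ∈ closure (Ioo (0 : ℝ) 1) := by
      rw [closure_Ioo (by norm_num)]
      exact ⟨zero_le_one, le_rfl⟩
    exact map_mem_closure hcont h1c hpU
  have h2 := mem_ball_zero_iff.1 ((h.U_subset h1).1 j)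
  simp only [hp] at h2
  rw [coords_add, coords_real_smul, coords_extend_of_disjoint (disjoint_hat_free j),
    coords_extend] at h2
  simpa [abs_of_pos hr] using h2

include hD' h in
theorem ProperlyContained.G_subset' (j : κ) : D'.G j ⊆ D.G j := fun _ hv =>
  h.G_subset j ⟨subset_closure hv, (hD'.isProperCone j).ne_zero hv⟩

include hI hD' h in
theorem ProperlyContained.S_subset : D'.S ⊆ D.S := by
  intro z hz
  rw [mem_S] at hz ⊢
  refine ⟨fun j => (hz.1 j).trans (h.r_lt hI hD' j),
    h.closure_W_subset hD' (subset_closure hz.2.1), fun j => h.G_subset' hD' j (hz.2.2.1 j),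
    fun j k hjk => (hz.2.2.2 j k hjk).trans_le ?_⟩
  exact mul_le_mul_of_nonneg_right h.ε_lt.le (norm_nonneg _)

include hI hD' h in
/-- Between two properly contained multi-cones there is a further one. -/
theorem ProperlyContained.exists_between (hD : D.IsProper) :
    ∃ E : ConeData I, E.IsProper ∧ D'.ProperlyContained E ∧ E.ProperlyContained D := by
  have hG : ∀ j, ∃ E : Set (Cn ↥(hat I j)), IsProperCone E ∧ closure (D'.G j) \ {0} ⊆ E ∧
      closure E \ {0} ⊆ D.G j := fun j =>
    (hD.isProperCone j).exists_between (hD'.G_cone j) (hD'.G_convex j) (hD'.G_nonempty j)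
      (h.G_subset' hD' j) (h.G_subset j)
  choose G hG1 hG2 hG3 using hG
  have hWc := h.isCompact_closure_W hD'
  obtain ⟨δ, hδ, hδW⟩ := hWc.exists_cthickening_subset_open hD.W_open (h.closure_W_subset hD')
  have hcl : closure (Metric.thickening δ D'.W) ⊆ Metric.cthickening δ (closure D'.W) := by
    rw [Metric.cthickening_closure]
    exact Metric.closure_thickening_subset_cthickening δ _
  have hr := h.r_lt hI hD'
  have hε := h.ε_lt
  have hε0 := hD'.ε_pos
  -- Radii and `ε` are taken halfway; a thickening of the convex set `W'` is again convex.
  refine ⟨⟨fun j => (D'.r j + D.r j) / 2, Metric.thickening δ D'.W, G, (D'.ε + D.ε) / 2⟩,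
    ⟨fun j => ?_, Metric.isOpen_thickening, hD'.W_convex.thickening δ,
      hD'.W_nonempty.mono (Metric.self_subset_thickening hδ _), fun j => (hG1 j).isOpen,
      fun j => (hG1 j).convex, fun j => (hG1 j).nonempty, fun j => (hG1 j).isCone,
      fun j => (hG1 j).proper, ?_⟩,
    properlyContained_of ?_ (fun j => ?_) hWc ?_ hG2,
    properlyContained_of ?_ (fun j => ?_) ?_ (hcl.trans hδW) hG3⟩
  · have := hr j
    have := hD'.r_pos j
    change 0 < (D'.r j + D.r j) / 2
    linarith
  · change 0 < (D'.ε + D.ε) / 2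
    linarith
  · change D'.ε < (D'.ε + D.ε) / 2
    linarith
  · have := hr j
    change D'.r j < (D'.r j + D.r j) / 2
    linarith
  · exact Metric.closure_subset_thickening hδ _
  · change (D'.ε + D.ε) / 2 < D.ε
    linarith
  · have := hr j
    change (D'.r j + D.r j) / 2 < D.r j
    linarith
  · exact (hWc.cthickening (r := δ)).of_isClosed_subset isClosed_closure hcl

end ConeData

end ProperMultiCones

/-! ### Scaling, projection to `Z_J`, and discs in multi-cones. -/

section GeometryOfMultiCones

variable {ι κ : Type*} [Fintype ι] [DecidableEq ι] [Fintype κ] [DecidableEq κ]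
  {I : κ → Finset ι} {D D' : ConeData I}

theorem incl_proj (J : Finset κ) (z : Cn ι) : incl I J (proj I J z) = scale (union I J) 0 z :=
  (scale_zero_eq _ z).symm

theorem proj_incl (J : Finset κ) (w : ZSpace I J) : proj I J (incl I J w) = w :=
  coords_extend _ w

theorem proj_scale {J K : Finset κ} (h : K ⊆ J) (t : ℝ) (z : Cn ι) :
    proj I J (scale (union I K) t z) = proj I J z := by
  refine coords_scale_of_disjoint ?_ t z
  refine Finset.disjoint_left.2 fun i hi hi' => ?_
  exact Finset.mem_compl.1 hi (union_mono h hi')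

theorem tendsto_scale_union (J : Finset κ) (z : Cn ι) :
    Tendsto (fun t : ℝ => scale (union I J) t z) (𝓝[>] 0) (𝓝 (incl I J (proj I J z))) :=
  tendsto_scale _ z

theorem hat_subset_union {J : Finset κ} {j : κ} (h : I j ⊆ union I J) : hat I j ⊆ union I J :=
  (hat_subset j).trans h

theorem eventually_mul_lt (a : ℝ) {b : ℝ} (hb : 0 < b) : ∀ᶠ s : ℝ in 𝓝[>] 0, s * a < b := by
  have h : Tendsto (fun s : ℝ => s * a) (𝓝 0) (𝓝 (0 * a)) := (continuous_mul_const a).tendsto 0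
  rw [zero_mul] at h
  exact (h.eventually_lt_const hb).filter_mono nhdsWithin_le_nhds

namespace ConeData

variable (hI : IsAdmissible I)

include hI

/-- If `I k ⊂ I j ⊆ I_J`, both sides of the condition on the norms shrink by `t`. If `I j` is not
contained in `I_J`, only the smaller side can shrink. Cones are invariant anyway. -/
theorem IsProper.scale_mem_S (hD : D.IsProper) (J : Finset κ) {z : Cn ι} (hz : z ∈ D.S) {t : ℝ}
    (ht : t ∈ Ioc (0 : ℝ) 1) : scale (union I J) t z ∈ D.S := by
  have key : ∀ k, (I k ⊆ union I J ∧ coords (hat I k) (scale (union I J) t z) =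
      t • coords (hat I k) z) ∨ (¬ I k ⊆ union I J ∧
      coords (hat I k) (scale (union I J) t z) = coords (hat I k) z) := by
    intro k
    by_cases h : I k ⊆ union I J
    · exact Or.inl ⟨h, coords_scale_of_subset (hat_subset_union h) t z⟩
    · exact Or.inr ⟨h, coords_scale_of_disjoint (hI.disjoint_hat_union h) t z⟩
  have hnorm : ∀ k, ‖t • coords (hat I k) z‖ = t * ‖coords (hat I k) z‖ := fun k => by
    rw [norm_smul, Real.norm_of_nonneg ht.1.le]
  have hle : ∀ k, t * ‖coords (hat I k) z‖ ≤ ‖coords (hat I k) z‖ := fun k =>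
    mul_le_of_le_one_left (norm_nonneg _) ht.2
  rw [mem_S] at hz ⊢
  refine ⟨fun k => ?_, ?_, fun k => ?_, fun j k hkj => ?_⟩
  · rcases key k with ⟨_, h⟩ | ⟨_, h⟩
    · rw [h, hnorm]
      exact (hle k).trans_lt (hz.1 k)
    · rw [h]
      exact hz.1 k
  · rw [coords_scale_of_disjoint (disjoint_free_union J)]
    exact hz.2.1
  · rcases key k with ⟨_, h⟩ | ⟨_, h⟩
    · rw [h]
      exact hD.G_cone k t ht.1 _ (hz.2.2.1 k)
    · rw [h]
      exact hz.2.2.1 k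
  · have h1 := hz.2.2.2 j k hkj
    rcases key j with ⟨hj, h⟩ | ⟨hj, h⟩
    · rw [h, hnorm, coords_scale_of_subset (hat_subset_union (hkj.subset.trans hj)), hnorm]
      nlinarith [ht.1]
    · rw [h]
      rcases key k with ⟨_, h'⟩ | ⟨_, h'⟩
      · rw [h', hnorm]
        exact (hle k).trans_lt h1
      · rwa [h']

theorem IsProper.eventually_scale_mem_S (hD : D.IsProper) (J : Finset κ) {z : Cn ι}
    (hz : z ∈ D.S) : ∀ᶠ t : ℝ in 𝓝[>] 0, scale (union I J) t z ∈ D.S := by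
  filter_upwards [Ioc_mem_nhdsGT one_pos] with t ht using hD.scale_mem_S hI J hz ht

theorem IsProper.incl_proj_mem_closure (hD : D.IsProper) (J : Finset κ) {z : Cn ι}
    (hz : z ∈ D.S) : incl I J (proj I J z) ∈ closure D.S :=
  mem_closure_of_tendsto (tendsto_scale_union J z) (hD.eventually_scale_mem_S hI J hz)

/-- A point of `Z_J` that satisfies the conditions on the components outside `I_J` lifts to `S`. -/
theorem IsProper.exists_lift (hD : D.IsProper) (J : Finset κ) (w : Cn ι)
    (hr : ∀ k, ¬ I k ⊆ union I J → ‖coords (hat I k) w‖ < D.r k)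
    (hG : ∀ k, ¬ I k ⊆ union I J → coords (hat I k) w ∈ D.G k)
    (hε : ∀ j k, I k ⊂ I j → ¬ I k ⊆ union I J →
      ‖coords (hat I k) w‖ < D.ε * ‖coords (hat I j) w‖)
    (hW : coords (free I) w ∈ D.W) : ∃ z ∈ D.S, proj I J z = proj I J w := by
  choose g hg using hD.G_nonempty
  have hg0 : ∀ k, 0 < ‖g k‖ := fun k => norm_pos_iff.2 ((hD.isProperCone k).ne_zero (hg k))
  -- The missing components get the sizes `M ^ (I k).card`. As `ε M > 1` and cardinality increases
  -- strictly along inclusions, these satisfy all conditions among themselves.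
  set M : ℝ := 1 + 2 / D.ε with hM
  have hεpos := hD.ε_pos
  have hM0 : 0 < M := by positivity
  have hM1 : 1 ≤ M := by
    have : 0 ≤ 2 / D.ε := by positivity
    linarith
  have hMε : 1 < D.ε * M := by
    have : D.ε * M = D.ε + 2 := by
      rw [hM]
      field_simp
    linarith
  set v : (k : κ) → Cn ↥(hat I k) := fun k => (M ^ (I k).card / ‖g k‖) • g k with hv
  have hvn : ∀ k, ‖v k‖ = M ^ (I k).card := fun k => by
    simp only [hv]
    rw [norm_smul, Real.norm_of_nonneg (by positivity), div_mul_cancel₀ _ (hg0 k).ne']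
  have hvG : ∀ k, v k ∈ D.G k := fun k =>
    hD.G_cone k _ (div_pos (pow_pos hM0 _) (hg0 k)) _ (hg k)
  have hvlt : ∀ j k, I k ⊂ I j → ‖v k‖ < D.ε * ‖v j‖ := by
    intro j k hkj
    rw [hvn, hvn]
    have h1 : M ^ ((I k).card + 1) ≤ M ^ (I j).card :=
      pow_le_pow_right₀ hM1 (Finset.card_lt_card hkj)
    have h2 : 0 < M ^ (I k).card := pow_pos hM0 _
    rw [pow_succ] at h1
    nlinarith
  -- A common small factor `s` then fits them into the balls and below the given components of `w`.
  have hevent : ∀ᶠ s : ℝ in 𝓝[>] 0, (∀ k, s * ‖v k‖ < D.r k) ∧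
      ∀ j k, ¬ I j ⊆ union I J → s * ‖v k‖ < D.ε * ‖coords (hat I j) w‖ := by
    refine (eventually_all.2 fun k => eventually_mul_lt _ (hD.r_pos k)).and ?_
    refine eventually_all.2 fun j => eventually_all.2 fun k => ?_
    by_cases hj : I j ⊆ union I J
    · simp [hj]
    · have h0 := norm_pos_iff.2 ((hD.isProperCone j).ne_zero (hG j hj))
      filter_upwards [eventually_mul_lt ‖v k‖ (mul_pos hεpos h0)] with s hs _ using hs
  obtain ⟨s, ⟨hs1, hs2⟩, hs0 : 0 < s⟩ := (hevent.and self_mem_nhdsWithin).exists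
  set z : Cn ι := WithLp.toLp 2 fun i => if i ∈ union I J then
    ((s • ∑ k, extend (hat I k) (v k) : Cn ι)) i else w i with hz
  have hz1 : ∀ k, I k ⊆ union I J → coords (hat I k) z = s • v k := by
    intro k hk
    have h1 : coords (hat I k) z = coords (hat I k) (s • ∑ k, extend (hat I k) (v k)) :=
      coords_eq_iff.2 fun i hi => by simp [hz, hk (hat_subset k hi)]
    rw [h1, coords_real_smul, ← coordsL_apply, map_sum, Finset.sum_eq_single k]
    · simp
    · intro m _ hmk
      rw [coordsL_apply, coords_extend_of_disjoint (hI.disjoint_hat hmk.symm)]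
    · simp
  have hz2 : ∀ k, ¬ I k ⊆ union I J → coords (hat I k) z = coords (hat I k) w := by
    intro k hk
    refine coords_eq_iff.2 fun i hi => ?_
    simp [hz, Finset.disjoint_left.1 (hI.disjoint_hat_union hk) hi]
  have hn1 : ∀ k, I k ⊆ union I J → ‖coords (hat I k) z‖ = s * ‖v k‖ := fun k hk => by
    rw [hz1 k hk, norm_smul, Real.norm_of_nonneg hs0.le]
  refine ⟨z, mem_S.2 ⟨fun k => ?_, ?_, fun k => ?_, fun j k hkj => ?_⟩, ?_⟩
  · by_cases hk : I k ⊆ union I J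
    · rw [hn1 k hk]
      exact hs1 k
    · rw [hz2 k hk]
      exact hr k hk
  · have : coords (free I) z = coords (free I) w := by
      refine coords_eq_iff.2 fun i hi => ?_
      simp [hz, Finset.disjoint_left.1 (disjoint_free_union J) hi]
    rwa [this]
  · by_cases hk : I k ⊆ union I J
    · rw [hz1 k hk]
      exact hD.G_cone k s hs0 _ (hvG k)
    · rw [hz2 k hk]
      exact hG k hk
  · by_cases hj : I j ⊆ union I J
    · rw [hn1 j hj, hn1 k (hkj.subset.trans hj)]
      nlinarith [hvlt j k hkj]
    · rw [hz2 j hj]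
      by_cases hk : I k ⊆ union I J
      · rw [hn1 k hk]
        exact hs2 j k hj
      · rw [hz2 k hk]
        exact hε j k hkj hk
  · refine coords_eq_iff.2 fun i hi => ?_
    simp [hz, Finset.mem_compl.1 hi]

omit hI in
theorem closure_S_subset {z : Cn ι} (hz : z ∈ closure D.S) :
    (∀ j, ‖coords (hat I j) z‖ ≤ D.r j) ∧ coords (free I) z ∈ closure D.W ∧
      (∀ j, coords (hat I j) z ∈ closure (D.G j)) ∧
      ∀ j k, I k ⊂ I j → ‖coords (hat I k) z‖ ≤ D.ε * ‖coords (hat I j) z‖ := by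
  have hc := fun j => continuous_coords (ι := ι) (hat I j)
  refine ⟨fun j => ?_, ?_, fun j => ?_, fun j k hkj => ?_⟩
  · exact closure_minimal (fun x hx => ((mem_S.1 hx).1 j).le)
      (isClosed_le (hc j).norm continuous_const) hz
  · exact map_mem_closure (continuous_coords _) hz fun x hx => (mem_S.1 hx).2.1
  · exact map_mem_closure (hc j) hz fun x hx => (mem_S.1 hx).2.2.1 j
  · exact closure_minimal (fun x hx => ((mem_S.1 hx).2.2.2 j k hkj).le)
      (isClosed_le (hc k).norm (continuous_const.mul (hc j).norm)) hz

/-- `S_J` is the image of `S` under the projection to `Z_J`. -/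
theorem IsProper.SJ_eq (hD : D.IsProper) (J : Finset κ) : D.SJ J = proj I J '' D.S := by
  apply subset_antisymm
  · intro w hw
    have hsub : D.SJ J ⊆ {w | incl I J w ∈ closure D.S} := interior_subset
    -- Coordinates outside `I_J` define open maps on `Z_J`. At an interior point a condition coming
    -- from the closure of `S` therefore holds in the interior.
    have hopen : ∀ (A : Finset ι) (hA : Disjoint A (union I J)),
        IsOpenMap fun w : ZSpace I J => coords A (incl I J w) := by
      intro A hA
      refine ((coordsL A).comp (extendL (union I J)ᶜ)).isOpenMap fun v => ?_
      refine ⟨proj I J (extend A v), ?_⟩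
      ext i
      have hi : i.1 ∈ (union I J)ᶜ := Finset.mem_compl.2 (Finset.disjoint_left.1 hA i.2)
      simp only [ContinuousLinearMap.comp_apply, coordsL_apply, extendL_apply, coords_apply]
      rw [extend_apply_mem _ hi]
      simp [proj, extend_apply_mem]
    have hint : ∀ (A : Finset ι) (hA : Disjoint A (union I J)) (T : Set (Cn A)),
        (∀ w : ZSpace I J, incl I J w ∈ closure D.S → coords A (incl I J w) ∈ T) →
        coords A (incl I J w) ∈ interior T := by
      intro A hA T hT
      refine interior_maximal ?_ ((hopen A hA) _ isOpen_interior) ⟨w, hw, rfl⟩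
      rintro _ ⟨w', hw', rfl⟩
      exact hT w' (hsub hw')
    have hcone : ∀ k, ¬ I k ⊆ union I J → coords (hat I k) (incl I J w) ∈ D.G k := by
      intro k hk
      have h1 := hint _ (hI.disjoint_hat_union hk) (closure (D.G k)) fun w' hw' =>
        (closure_S_subset hw').2.2.1 k
      -- An open convex set is the interior of its closure.
      rwa [(hD.G_convex k).interior_closure_eq_interior_of_nonempty_interior
        (by rw [(hD.G_open k).interior_eq]; exact hD.G_nonempty k),
        (hD.G_open k).interior_eq] at h1
    suffices hl : ∃ z ∈ D.S, proj I J z = proj I J (incl I J w) by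
      obtain ⟨z, hz, hzw⟩ := hl
      exact ⟨z, hz, hzw.trans (proj_incl J w)⟩
    refine hD.exists_lift hI J (incl I J w) (fun k hk => ?_) hcone (fun j k hkj hk => ?_) ?_
    · have h1 := hint _ (hI.disjoint_hat_union hk) (Metric.closedBall 0 (D.r k)) fun w' hw' =>
        mem_closedBall_zero_iff.2 ((closure_S_subset hw').1 k)
      rw [interior_closedBall _ (hD.r_pos k).ne'] at h1
      exact mem_ball_zero_iff.1 h1
    · have hdk := hI.disjoint_hat_union hk
      have hj : ¬ I j ⊆ union I J := fun h => hk (hkj.subset.trans h)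
      have hw0 := norm_pos_iff.2 ((hD.isProperCone k).ne_zero (hcone k hk))
      have hjk : j ≠ k := fun h => by
        subst h
        exact hkj.ne rfl
      -- Enlarging the `k`-th component by a factor `1 + s` stays in `S_J` and leaves the `j`-th one
      -- fixed. The weak inequality at the new point is the strict one at `w`.
      set b : Cn ι := extend (hat I k) (coords (hat I k) (incl I J w)) with hb
      have hev : ∀ᶠ s : ℝ in 𝓝[>] 0, w + s • proj I J b ∈ D.SJ J := by
        have hc : Continuous fun s : ℝ => w + s • proj I J b := by fun_prop
        have h0 : w + (0 : ℝ) • proj I J b ∈ D.SJ J := by simpa using hw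
        exact (hc.continuousAt.eventually_mem (isOpen_interior.mem_nhds h0)).filter_mono
          nhdsWithin_le_nhds
      obtain ⟨s, hs, hs0 : 0 < s⟩ := (hev.and self_mem_nhdsWithin).exists
      have h1 := (closure_S_subset (hsub hs)).2.2.2 j k hkj
      have hincl : incl I J (w + s • proj I J b) = incl I J w + s • b := by
        ext i
        by_cases hi : i ∈ (union I J)ᶜ
        · simp [incl, extend_apply_mem _ hi, proj]
        · have hbi : b i = 0 := by
            rw [hb, extend_apply_notMem]
            exact fun h => Finset.disjoint_left.1 hdk h (by simpa using hi)
          simp [incl, extend_apply_notMem _ hi, hbi]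
      rw [hincl, coords_add, coords_add, coords_real_smul, coords_real_smul, hb, coords_extend,
        coords_extend_of_disjoint (hI.disjoint_hat hjk), smul_zero, add_zero] at h1
      have h2 : coords (hat I k) (incl I J w) + s • coords (hat I k) (incl I J w) =
          (1 + s) • coords (hat I k) (incl I J w) := by rw [add_smul, one_smul]
      rw [h2, norm_smul, Real.norm_of_nonneg (by positivity)] at h1
      nlinarith
    · have h1 := hint _ (disjoint_free_union J) (closure D.W) fun w' hw' =>
        (closure_S_subset hw').2.1
      rwa [hD.W_convex.interior_closure_eq_interior_of_nonempty_interior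
        (by rw [hD.W_open.interior_eq]; exact hD.W_nonempty), hD.W_open.interior_eq] at h1
  · refine interior_maximal ?_ (isOpenMap_coords _ _ hD.isOpen_S)
    rintro _ ⟨z, hz, rfl⟩
    exact hD.incl_proj_mem_closure hI J hz

theorem IsProper.proj_mem_SJ (hD : D.IsProper) (J : Finset κ) {z : Cn ι} (hz : z ∈ D.S) :
    proj I J z ∈ D.SJ J := by
  rw [hD.SJ_eq hI]
  exact ⟨z, hz, rfl⟩

/-- The multi-cones properly contained in `S` cover `S`. -/
theorem IsProper.exists_properlyContained_mem (hD : D.IsProper) {z : Cn ι} (hz : z ∈ D.S) :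
    ∃ D' : ConeData I, D'.IsProper ∧ D'.ProperlyContained D ∧ z ∈ D'.S := by
  have hz' := mem_S.1 hz
  have hG : ∀ j, ∃ E : Set (Cn ↥(hat I j)), IsProperCone E ∧ coords (hat I j) z ∈ E ∧
      closure E \ {0} ⊆ D.G j := fun j => (hD.isProperCone j).exists_subcone (hz'.2.2.1 j)
  choose G hG1 hG2 hG3 using hG
  obtain ⟨δ, hδ, hδW⟩ := Metric.nhds_basis_closedBall.mem_iff.1 (hD.W_open.mem_nhds hz'.2.1)
  have hev : ∀ᶠ e : ℝ in 𝓝[<] D.ε, 0 < e ∧ ∀ j k, I k ⊂ I j →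
      ‖coords (hat I k) z‖ < e * ‖coords (hat I j) z‖ := by
    refine Filter.Eventually.filter_mono nhdsWithin_le_nhds
      ((eventually_gt_nhds hD.ε_pos).and ?_)
    refine eventually_all.2 fun j => eventually_all.2 fun k => ?_
    by_cases hkj : I k ⊂ I j
    · have h1 : Tendsto (fun e : ℝ => e * ‖coords (hat I j) z‖) (𝓝 D.ε)
          (𝓝 (D.ε * ‖coords (hat I j) z‖)) := (continuous_mul_const _).tendsto _
      filter_upwards [h1.eventually_const_lt (hz'.2.2.2 j k hkj)] with e he _ using he
    · simp [hkj]
  obtain ⟨e, ⟨he0, he⟩, heε : e < D.ε⟩ := (hev.and self_mem_nhdsWithin).exists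
  have hr : ∀ j, ∃ r, ‖coords (hat I j) z‖ < r ∧ r < D.r j := fun j => exists_between (hz'.1 j)
  choose r hr1 hr2 using hr
  have hball : closure (Metric.ball (coords (free I) z) δ) ⊆ Metric.closedBall _ δ :=
    Metric.closure_ball_subset_closedBall
  refine ⟨⟨r, Metric.ball (coords (free I) z) δ, G, e⟩,
    ⟨fun j => (norm_nonneg _).trans_lt (hr1 j), Metric.isOpen_ball, convex_ball _ _,
      ⟨_, Metric.mem_ball_self hδ⟩, fun j => (hG1 j).isOpen,
      fun j => (hG1 j).convex, fun j => (hG1 j).nonempty, fun j => (hG1 j).isCone,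
      fun j => (hG1 j).proper, he0⟩,
    properlyContained_of heε hr2 ?_ (hball.trans hδW) hG3,
    mem_S.2 ⟨hr1, Metric.mem_ball_self hδ, hG2, he⟩⟩
  exact (isCompact_closedBall _ _).of_isClosed_subset isClosed_closure hball

theorem IsProper.exists_properlyContained_mem_SJ (hD : D.IsProper) {J : Finset κ}
    {w : ZSpace I J} (hw : w ∈ D.SJ J) :
    ∃ D' : ConeData I, D'.IsProper ∧ D'.ProperlyContained D ∧ w ∈ D'.SJ J := by
  rw [hD.SJ_eq hI] at hw
  obtain ⟨z, hz, rfl⟩ := hw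
  obtain ⟨D', h1, h2, h3⟩ := hD.exists_properlyContained_mem hI hz
  exact ⟨D', h1, h2, h1.proj_mem_SJ hI J h3⟩

/-- On `S` the distance to `Z_j` is comparable with the norm of the component in `Î_j`. -/
theorem IsProper.exists_norm_coords_le (hD : D.IsProper) :
    ∃ A > 0, ∀ z ∈ D.S, ∀ j, ‖coords (I j) z‖ ≤ A * ‖coords (hat I j) z‖ := by
  have hε := hD.ε_pos
  refine ⟨(Fintype.card ι + 1) * (1 + D.ε), by positivity, fun z hz j => ?_⟩
  have hz' := mem_S.1 hz
  have hn := norm_nonneg (coords (hat I j) z)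
  have h1 : ‖coords (I j) z‖ ≤
      Fintype.card ↥(I j) * ((1 + D.ε) * ‖coords (hat I j) z‖) := by
    refine norm_le_of_forall_apply_le fun i => ?_
    -- Each coordinate of `I j` belongs to some `hat I k` with `I k ⊆ I j`, whose component is at
    -- most `ε` times that of `hat I j` unless `k = j`.
    obtain ⟨k, hk, hik⟩ := exists_mem_hat i.2
    have h2 : ‖coords (I j) z i‖ ≤ ‖coords (hat I k) z‖ := norm_apply_le_coords z hik
    rcases hk.eq_or_ssubset with h | h
    · rw [hI.injective h] at h2
      nlinarith
    · have h3 := hz'.2.2.2 j k h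
      nlinarith
  refine h1.trans ?_
  rw [mul_assoc]
  refine mul_le_mul_of_nonneg_right ?_ (by positivity)
  have h4 : Fintype.card ↥(I j) ≤ Fintype.card ι := Fintype.card_subtype_le _
  have : (Fintype.card ↥(I j) : ℝ) ≤ Fintype.card ι := by exact_mod_cast h4
  linarith

/-- Discs around the points of `S'` with radii proportional to the size of the components are
contained in `S`. -/
theorem ProperlyContained.exists_disc_subset (hD : D.IsProper) (hD' : D'.IsProper)
    (h : D'.ProperlyContained D) :
    ∃ c > 0, ∀ z ∈ D'.S, ∀ (i : ι) (ζ : ℂ), (∀ j, i ∈ hat I j → ‖ζ‖ ≤ c * ‖coords (hat I j) z‖) →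
      (i ∈ free I → ‖ζ‖ ≤ c) → z + ζ • EuclideanSpace.single i 1 ∈ D.S := by
  have hm : ∀ j, ∃ δ > 0, ∀ u ∈ closure (D'.G j), u ≠ 0 → ∀ v, ‖v - u‖ ≤ δ * ‖u‖ → v ∈ D.G j :=
    fun j => IsCone.exists_margin (hD'.G_cone j) (hD.G_cone j) (hD.G_open j) (h.G_subset j)
  choose δ hδ hδG using hm
  obtain ⟨η, hη, hηW⟩ := (h.isCompact_closure_W hD').exists_cthickening_subset_open hD.W_open
    (h.closure_W_subset hD')
  have hr := h.r_lt hI hD'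
  have hε := h.ε_lt
  have hε0 := hD'.ε_pos
  -- The first three conditions keep the disc in the cones, in `W` and in the balls. The last two
  -- preserve the comparison of norms when the smaller component grows by `1 + c` or the larger one
  -- shrinks by `1 - c`.
  have hev : ∀ᶠ c : ℝ in 𝓝[>] 0, (∀ j, c * 1 < δ j) ∧ c * 1 < η ∧ (∀ j, c * D'.r j < D.r j - D'.r j)
      ∧ c * D'.ε < D.ε - D'.ε ∧ c * D.ε < D.ε - D'.ε := by
    refine (eventually_all.2 fun j => eventually_mul_lt _ (hδ j)).and
      ((eventually_mul_lt _ hη).and ((eventually_all.2 fun j => eventually_mul_lt _ ?_).and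
      ((eventually_mul_lt _ ?_).and (eventually_mul_lt _ ?_))))
    · linarith [hr j]
    · linarith
    · linarith
  obtain ⟨c, ⟨hcδ, hcη, hcr, hcε, hcε'⟩, hc : 0 < c⟩ := (hev.and self_mem_nhdsWithin).exists
  refine ⟨c, hc, fun z hz i ζ hζ hζ' => ?_⟩
  have hzS := mem_S.1 (h.S_subset hI hD' hz)
  have hz' := mem_S.1 hz
  have hsame : ∀ A : Finset ι, i ∉ A →
      coords A (z + ζ • EuclideanSpace.single i 1) = coords A z := fun A hA => by
    rw [coords_add, coords_smul, coords_single_of_notMem hA, smul_zero, add_zero]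
  have hdiff : ∀ A : Finset ι, ‖coords A (z + ζ • EuclideanSpace.single i 1) - coords A z‖ ≤ ‖ζ‖ := by
    intro A
    rw [coords_add, add_sub_cancel_left, coords_smul, norm_smul]
    have := norm_coords_single_le A i (1 : ℂ)
    rw [norm_one] at this
    exact mul_le_of_le_one_right (norm_nonneg _) this
  rcases mem_free_or_exists_mem_hat I i with hi | ⟨j, hi⟩
  · have hh : ∀ k, i ∉ hat I k := fun k hk => mem_free.1 hi k (hat_subset k hk)
    refine mem_S.2 ⟨fun k => ?_, ?_, fun k => ?_, fun k m hmk => ?_⟩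
    · rw [hsame _ (hh k)]
      exact hzS.1 k
    · refine hηW (Metric.mem_cthickening_of_dist_le _ (coords (free I) z) _ _
        (subset_closure hz'.2.1) ?_)
      rw [dist_eq_norm]
      linarith [hdiff (free I), hζ' hi]
    · rw [hsame _ (hh k)]
      exact hzS.2.2.1 k
    · rw [hsame _ (hh k), hsame _ (hh m)]
      exact hzS.2.2.2 k m hmk
  · have hh : ∀ k, k ≠ j → i ∉ hat I k := fun k hk hik =>
      Finset.disjoint_left.1 (hI.disjoint_hat hk) hik hi
    have hζj := hζ j hi
    set p := coords (hat I j) (z + ζ • EuclideanSpace.single i 1) with hp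
    set q := coords (hat I j) z with hq
    have hq0 : 0 < ‖q‖ := norm_pos_iff.2 ((hD'.isProperCone j).ne_zero (hz'.2.2.1 j))
    have hpq : ‖p - q‖ ≤ c * ‖q‖ := (hdiff _).trans hζj
    have h1 : ‖p‖ ≤ (1 + c) * ‖q‖ := by
      have : ‖p‖ ≤ ‖p - q‖ + ‖q‖ := by simpa using norm_add_le (p - q) q
      linarith
    have h2 : (1 - c) * ‖q‖ ≤ ‖p‖ := by
      have : ‖q‖ ≤ ‖p‖ + ‖p - q‖ := by
        rw [norm_sub_rev]
        simpa using norm_add_le p (q - p)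
      linarith
    refine mem_S.2 ⟨fun k => ?_, ?_, fun k => ?_, fun k m hmk => ?_⟩
    · by_cases hk : k = j
      · subst hk
        have h3 := hz'.1 k
        have h4 := hcr k
        nlinarith
      · rw [hsame _ (hh k hk)]
        exact hzS.1 k
    · rw [hsame _ (Finset.disjoint_left.1 (disjoint_hat_free j) hi)]
      exact hzS.2.1
    · by_cases hk : k = j
      · subst hk
        refine hδG k q (subset_closure (hz'.2.2.1 k)) (norm_pos_iff.1 hq0) p (hpq.trans ?_)
        have := hcδ k
        nlinarith
      · rw [hsame _ (hh k hk)]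
        exact hzS.2.2.1 k
    · have h3 := hz'.2.2.2 k m hmk
      by_cases hk : k = j
      · subst hk
        have hmk' : m ≠ k := fun h => by
          subst h
          exact hmk.ne rfl
        rw [hsame _ (hh m hmk')]
        nlinarith
      · rw [hsame _ (hh k hk)]
        by_cases hm : m = j
        · subst hm
          have h5 := norm_nonneg (coords (hat I k) z)
          nlinarith
        · rw [hsame _ (hh m hm)]
          exact hzS.2.2.2 k m hmk

end ConeData

end GeometryOfMultiCones

/-! ### Cauchy estimates: derivatives of developable functions are developable. -/

section DerivativesOfExpansions

variable {ι κ : Type*} [Fintype ι] [DecidableEq ι] [Fintype κ] [DecidableEq κ]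
  {I : κ → Finset ι} {D D' : ConeData I}

theorem mem_indexSet {J : Finset κ} {N : κ → ℕ} {α : ↥(union I J) → ℕ} :
    α ∈ indexSet I J N ↔
      ∀ j ∈ J, ∑ i ∈ Finset.univ.filter (fun i : ↥(union I J) => i.1 ∈ I j), α i < N j := by
  simp only [indexSet, Finset.mem_filter, Fintype.mem_piFinset, Finset.mem_range,
    and_iff_right_iff_imp]
  intro h i
  obtain ⟨j, hj, hij⟩ := mem_union.1 i.2
  refine lt_of_le_of_lt ?_ ((h j hj).trans_le
    (Finset.single_le_sum (fun k _ => Nat.zero_le (N k)) (Finset.mem_univ j)))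
  exact Finset.single_le_sum (f := α) (fun k _ => Nat.zero_le _) (by simpa using hij)

theorem taylor_eq_poly (F : Family I) (J : Finset κ) (N : κ → ℕ) (z : Cn ι) :
    taylor I F J N z =
      poly (indexSet I J N) (fun α => F J α (proj I J z)) (coords (union I J) z) := rfl

/-- The family of the coefficients of the derivative `∂f/∂z_i`. -/
def famDeriv (i : ι) (F : Family I) : Family I := fun J β =>
  if h : i ∈ union I J then F J (β + Pi.single ⟨i, h⟩ 1)
  else partialDeriv ⟨i, Finset.mem_compl.2 h⟩ (F J β)

theorem famDeriv_of_mem {i : ι} {J : Finset κ} (h : i ∈ union I J) (F : Family I)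
    (β : ↥(union I J) → ℕ) : famDeriv i F J β = F J (β + Pi.single ⟨i, h⟩ 1) := by
  simp [famDeriv, h]

theorem famDeriv_of_notMem {i : ι} {J : Finset κ} (h : i ∉ union I J) (F : Family I)
    (β : ↥(union I J) → ℕ) :
    famDeriv i F J β = partialDeriv ⟨i, Finset.mem_compl.2 h⟩ (F J β) := by
  simp [famDeriv, h]

theorem coords_single_of_mem {A : Finset ι} {i : ι} (h : i ∈ A) :
    coords A (EuclideanSpace.single i 1) = EuclideanSpace.single (⟨i, h⟩ : A) 1 := by
  ext k
  by_cases hk : k = ⟨i, h⟩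
  · subst hk
    simp
  · have : k.1 ≠ i := fun h' => hk (Subtype.ext h')
    simp [this, hk]

/-- If `i ∈ I_J` the monomials are differentiated, otherwise the coefficients. In the first case the
degree in `I_j` drops by one exactly for `i ∈ I_j`, which matches the increase of the truncation by
`indicator I i`. -/
theorem hasDerivAt_taylor {J : Finset κ} {F : Family I}
    (hF : ∀ α, AnalyticOnNhd ℂ (F J α) (D.SJ J)) (i : ι) (M : κ → ℕ) {z : Cn ι}
    (hz : proj I J z ∈ D.SJ J) :
    HasDerivAt (fun ζ : ℂ => taylor I F J (M + indicator I i)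
      (z + ζ • EuclideanSpace.single i 1)) (taylor I (famDeriv i F) J M z) 0 := by
  by_cases hi : i ∈ union I J
  · have h1 : ∀ ζ : ℂ, proj I J (z + ζ • EuclideanSpace.single i 1) = proj I J z := fun ζ => by
      rw [proj, coords_add, coords_smul, coords_single_of_notMem (by simpa using hi), smul_zero,
        add_zero, proj]
    have h2 : ∀ ζ : ℂ, coords (union I J) (z + ζ • EuclideanSpace.single i 1) =
        coords (union I J) z + ζ • EuclideanSpace.single ⟨i, hi⟩ 1 := fun ζ => by
      rw [coords_add, coords_smul, coords_single_of_mem hi]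
    simp only [taylor_eq_poly, h1, h2, famDeriv_of_mem hi]
    refine hasDerivAt_poly (fun a => ?_) (fun α => F J α (proj I J z)) _
    simp only [mem_indexSet]
    refine forall₂_congr fun j _ => ?_
    simp only [Pi.add_apply, Finset.sum_add_distrib, indicator]
    have h3 : ∑ k ∈ Finset.univ.filter (fun k : ↥(union I J) => k.1 ∈ I j),
        (Pi.single (⟨i, hi⟩ : ↥(union I J)) 1 : ↥(union I J) → ℕ) k =
        if i ∈ I j then 1 else 0 := by
      simp
    rw [h3]
    omega
  · have h2 : ∀ ζ : ℂ, coords (union I J) (z + ζ • EuclideanSpace.single i 1) =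
        coords (union I J) z := fun ζ => by
      rw [coords_add, coords_smul, coords_single_of_notMem hi, smul_zero, add_zero]
    have h1 : ∀ ζ : ℂ, proj I J (z + ζ • EuclideanSpace.single i 1) =
        proj I J z + ζ • EuclideanSpace.single ⟨i, Finset.mem_compl.2 hi⟩ 1 := fun ζ => by
      rw [proj, coords_add, coords_smul, coords_single_of_mem (Finset.mem_compl.2 hi), proj]
    have h3 : indexSet I J (M + indicator I i) = indexSet I J M := by
      ext a
      simp only [mem_indexSet]
      refine forall₂_congr fun j hj => ?_
      have : i ∉ I j := fun h => hi (subset_union hj h)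
      simp [indicator, this]
    simp only [taylor_eq_poly, h1, h2, h3, famDeriv_of_notMem hi, poly]
    refine HasDerivAt.fun_sum fun a _ => HasDerivAt.div_const (HasDerivAt.mul_const ?_ _) _
    exact hasDerivAt_partialDeriv (hF a _ hz).differentiableAt _

theorem differentiableAt_taylor {J : Finset κ} {F : Family I}
    (hF : ∀ α, AnalyticOnNhd ℂ (F J α) (D.SJ J)) (N : κ → ℕ) {z : Cn ι}
    (hz : proj I J z ∈ D.SJ J) : DifferentiableAt ℂ (taylor I F J N) z := by
  unfold taylor
  refine DifferentiableAt.fun_sum fun a _ => ?_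
  have h1 : DifferentiableAt ℂ (fun z => F J a (proj I J z)) z :=
    DifferentiableAt.comp z (hF a _ hz).differentiableAt
      (coordsL (union I J)ᶜ).differentiableAt
  have h2 : DifferentiableAt ℂ (fun z : Cn ι => ∏ i : ↥(union I J), z i.1 ^ a i) z := by
    fun_prop
  simp only [div_eq_mul_inv]
  exact (h1.fun_mul h2).mul_const _

/-- Weights may be negative, so distances must be controlled from both sides. -/
theorem zpow_le_of_le_of_le {a b : ℝ} (ha : 0 < a) (h1 : a / 2 ≤ b) (h2 : b ≤ 2 * a) (w : ℤ) :
    b ^ w ≤ 2 ^ w.natAbs * a ^ w := by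
  have hb : 0 < b := by linarith
  obtain ⟨m, rfl | rfl⟩ := w.eq_nat_or_neg
  · simp only [zpow_natCast, Int.natAbs_natCast]
    rw [← mul_pow]
    exact pow_le_pow_left₀ hb.le h2 m
  · simp only [zpow_neg, zpow_natCast, Int.natAbs_neg, Int.natAbs_natCast]
    rw [← inv_pow, ← inv_pow, ← mul_pow]
    refine pow_le_pow_left₀ (inv_nonneg.2 hb.le) ?_ m
    rw [inv_le_comm₀ hb (by positivity), mul_inv, inv_inv]
    linarith

namespace ConeData

theorem IsCoefficientFamily.famDeriv {F : Family I} (hF : D.IsCoefficientFamily F) (i : ι) :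
    D.IsCoefficientFamily (famDeriv i F) := by
  intro J hJ β
  by_cases hi : i ∈ union I J
  · rw [famDeriv_of_mem hi]
    exact hF J hJ _
  · rw [famDeriv_of_notMem hi]
    exact analyticOnNhd_partialDeriv (hF J hJ β) _

variable (hI : IsAdmissible I)

theorem IsProper.norm_coords_hat_pos (hD : D.IsProper) {z : Cn ι} (hz : z ∈ D.S) (j : κ) :
    0 < ‖coords (hat I j) z‖ :=
  norm_pos_iff.2 ((hD.isProperCone j).ne_zero ((mem_S.1 hz).2.2.1 j))

theorem IsProper.norm_coords_pos (hD : D.IsProper) {z : Cn ι} (hz : z ∈ D.S) (j : κ) :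
    0 < ‖coords (I j) z‖ :=
  (hD.norm_coords_hat_pos hz j).trans_le (norm_coords_mono (hat_subset j) z)

include hI

/-- Discs in the direction of the `i`-th coordinate that are adapted to the Cauchy estimates. -/
theorem ProperlyContained.exists_adapted_disc (hD : D.IsProper) (hD' : D'.IsProper)
    (h : D'.ProperlyContained D) (i : ι) (M : κ → ℕ) :
    ∃ B > 0, ∀ z ∈ D'.S, ∃ ρ > 0, (∀ ζ : ℂ, ‖ζ‖ ≤ ρ → z + ζ • EuclideanSpace.single i 1 ∈ D.S ∧
        ∀ m, ‖coords (I m) z‖ / 2 ≤ ‖coords (I m) (z + ζ • EuclideanSpace.single i 1)‖ ∧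
          ‖coords (I m) (z + ζ • EuclideanSpace.single i 1)‖ ≤ 2 * ‖coords (I m) z‖) ∧
      ∏ m, ‖coords (I m) z‖ ^ weight I (M + indicator I i) m ≤
        B * ρ * ∏ m, ‖coords (I m) z‖ ^ weight I M m := by
  obtain ⟨c, hc, hdisc⟩ := h.exists_disc_subset hI hD hD'
  obtain ⟨A, hA, hAle⟩ := hD'.exists_norm_coords_le hI
  have hsame : ∀ (z : Cn ι) (ζ : ℂ) (m : κ), i ∉ I m →
      coords (I m) (z + ζ • EuclideanSpace.single i 1) = coords (I m) z := fun z ζ m hm => by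
    rw [coords_add, coords_smul, coords_single_of_notMem hm, smul_zero, add_zero]
  have hw : ∀ z ∈ D'.S, ∏ m, ‖coords (I m) z‖ ^ weight I (M + indicator I i) m =
      (∏ m, ‖coords (I m) z‖ ^ weight I M m) *
        ∏ m, ‖coords (I m) z‖ ^ (if i ∈ hat I m then (1 : ℤ) else 0) := by
    intro z hz
    rw [← Finset.prod_mul_distrib]
    refine Finset.prod_congr rfl fun m _ => ?_
    rw [weight_add, hI.weight_indicator, zpow_add₀ (hD'.norm_coords_pos hz m).ne']
  rcases mem_free_or_exists_mem_hat I i with hi | ⟨j, hi⟩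
  -- In a free direction the radius is constant and no weight changes.
  · refine ⟨c⁻¹, inv_pos.2 hc, fun z hz => ⟨c, hc, fun ζ hζ => ⟨?_, fun m => ?_⟩, ?_⟩⟩
    · exact hdisc z hz i ζ (fun j hj => absurd (hat_subset j hj) (mem_free.1 hi j)) fun _ => hζ
    · rw [hsame z ζ m (mem_free.1 hi m)]
      have := norm_nonneg (coords (I m) z)
      constructor <;> linarith
    · rw [hw z hz, inv_mul_cancel₀ hc.ne', one_mul, Finset.prod_eq_one (s := Finset.univ)
        (f := fun m => ‖coords (I m) z‖ ^ (if i ∈ hat I m then (1 : ℤ) else 0)), mul_one]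
      intro m _
      have : i ∉ hat I m := fun h => mem_free.1 hi m (hat_subset m h)
      simp [this]
  · have hj : ∀ m, i ∈ hat I m ↔ m = j := by
      intro m
      constructor
      · intro hm
        by_contra hne
        exact Finset.disjoint_left.1 (hI.disjoint_hat hne) hm hi
      · rintro rfl
        exact hi
    -- The bound `c / A` keeps the disc in `S`, since the distance to `Z_j` is at most `A` times the
    -- norm of the `j`-th component; `1 / 2` keeps all distances comparable.
    set c' : ℝ := min (c / A) (1 / 2) with hc'
    have hc'0 : 0 < c' := by positivity
    refine ⟨c'⁻¹, inv_pos.2 hc'0, fun z hz => ?_⟩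
    have hpos := hD'.norm_coords_pos hz
    refine ⟨c' * ‖coords (I j) z‖, mul_pos hc'0 (hpos j), fun ζ hζ => ⟨?_, fun m => ?_⟩, ?_⟩
    · refine hdisc z hz i ζ (fun m hm => ?_) fun hf =>
        absurd hf (Finset.disjoint_left.1 (disjoint_hat_free j) hi)
      rw [(hj m).1 hm]
      refine hζ.trans ?_
      have h1 : c' * ‖coords (I j) z‖ ≤ c / A * (A * ‖coords (hat I j) z‖) :=
        mul_le_mul (min_le_left _ _) (hAle z hz j) (norm_nonneg _) (by positivity)
      refine h1.trans_eq ?_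
      field_simp
    · by_cases him : i ∈ I m
      · have h1 : ‖coords (I j) z‖ ≤ ‖coords (I m) z‖ :=
          norm_coords_mono (hI.subset_of_mem_hat hi him) z
        have h2 : ‖ζ‖ ≤ 1 / 2 * ‖coords (I m) z‖ :=
          hζ.trans (mul_le_mul (min_le_right _ _) h1 (norm_nonneg _) (by norm_num))
        have h3 : ‖ζ • coords (I m) (EuclideanSpace.single i (1 : ℂ))‖ ≤ ‖ζ‖ := by
          rw [norm_smul]
          have := norm_coords_single_le (I m) i (1 : ℂ)
          rw [norm_one] at this
          exact mul_le_of_le_one_right (norm_nonneg _) this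
        rw [coords_add, coords_smul]
        have h4 := norm_add_le (coords (I m) z)
          (ζ • coords (I m) (EuclideanSpace.single i (1 : ℂ)))
        have h5 := norm_sub_le (coords (I m) z + ζ • coords (I m) (EuclideanSpace.single i (1 : ℂ)))
          (ζ • coords (I m) (EuclideanSpace.single i (1 : ℂ)))
        rw [add_sub_cancel_right] at h5
        have h6 := hpos m
        constructor <;> linarith
      · rw [hsame z ζ m him]
        have := hpos m
        constructor <;> linarith
    · rw [hw z hz, Finset.prod_eq_single_of_mem (s := Finset.univ) (f := fun m =>
        ‖coords (I m) z‖ ^ (if i ∈ hat I m then (1 : ℤ) else 0)) j (Finset.mem_univ j)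
        (fun m _ hm => by simp [hj, hm])]
      simp only [hi, if_true, zpow_one]
      rw [inv_mul_cancel_left₀ hc'0.ne', mul_comm]

theorem hasDerivAt_app (hD : D.IsProper) {F : Family I} (hF : D.IsCoefficientFamily F) (i : ι)
    (M : κ → ℕ) {z : Cn ι} (hz : z ∈ D.S) :
    HasDerivAt (fun ζ : ℂ => app I F (M + indicator I i) (z + ζ • EuclideanSpace.single i 1))
      (app I (famDeriv i F) M z) 0 := by
  unfold app
  refine HasDerivAt.fun_sum fun J hJ => HasDerivAt.const_mul _ ?_
  have hJ' : J.Nonempty := by simpa using hJ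
  exact hasDerivAt_taylor (hF J hJ') i M (hD.proj_mem_SJ hI J hz)

theorem differentiableAt_app (hD : D.IsProper) {F : Family I} (hF : D.IsCoefficientFamily F)
    (N : κ → ℕ) {z : Cn ι} (hz : z ∈ D.S) : DifferentiableAt ℂ (app I F N) z := by
  unfold app
  refine DifferentiableAt.fun_sum fun J hJ => DifferentiableAt.const_mul ?_ _
  have hJ' : J.Nonempty := by simpa using hJ
  exact differentiableAt_taylor (hF J hJ') N (hD.proj_mem_SJ hI J hz)

/-- The derivatives of a multi-asymptotically developable function are multi-asymptotically
developable. -/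
theorem DevelopableTo.partialDeriv (hD : D.IsProper) {f : Cn ι → ℂ}
    (hf : AnalyticOnNhd ℂ f D.S) {F : Family I} (hF : D.IsCoefficientFamily F)
    (hfF : D.DevelopableTo f F) (i : ι) :
    D.DevelopableTo (partialDeriv i f) (famDeriv i F) := by
  intro D' hD' h M
  -- The estimate for `f` is used on an intermediate multi-cone, which has room for discs around the
  -- points of `S'`.
  obtain ⟨E, hE, hD'E, hED⟩ := h.exists_between hI hD' hD
  have hES := hED.S_subset hI hE
  obtain ⟨C, hC, hbound⟩ := hfF E hE hED (M + indicator I i)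
  obtain ⟨B, hB, hdisc⟩ := hD'E.exists_adapted_disc hI hE hD' i M
  set w := weight I (M + indicator I i) with hw
  set P : ℝ := ∏ m, (2 : ℝ) ^ (w m).natAbs with hP
  have hP0 : 0 < P := Finset.prod_pos fun m _ => by positivity
  refine ⟨C * P * B, by positivity, fun z hz => ?_⟩
  obtain ⟨ρ, hρ, hball, hρB⟩ := hdisc z hz
  have hzD : z ∈ D.S := h.S_subset hI hD' hz
  set g : ℂ → ℂ := fun ζ => f (z + ζ • EuclideanSpace.single i 1) -
    app I F (M + indicator I i) (z + ζ • EuclideanSpace.single i 1) with hg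
  have hder : HasDerivAt g
      (MultiAsymp.partialDeriv i f z - app I (MultiAsymp.famDeriv i F) M z) 0 :=
    (hasDerivAt_partialDeriv (hf z hzD).differentiableAt i).sub (hasDerivAt_app hI hD hF i M hzD)
  have hdiff : DifferentiableOn ℂ g (Metric.closedBall 0 ρ) := by
    intro ζ hζ
    have h1 := hES (hball ζ (mem_closedBall_zero_iff.1 hζ)).1
    have h2 : DifferentiableAt ℂ (fun ζ : ℂ => z + ζ • EuclideanSpace.single i (1 : ℂ)) ζ := by
      fun_prop
    have h3 : DifferentiableAt ℂ f (z + ζ • EuclideanSpace.single i (1 : ℂ)) :=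
      (hf _ h1).differentiableAt
    have h4 := differentiableAt_app hI hD hF (M + indicator I i) h1
    exact ((h3.comp ζ h2).sub (h4.comp ζ h2)).differentiableWithinAt
  set Q : ℝ := ∏ m, ‖coords (I m) z‖ ^ w m with hQ
  have hsphere : ∀ ζ ∈ Metric.sphere (0 : ℂ) ρ, ‖g ζ‖ ≤ C * (P * Q) := by
    intro ζ hζ
    obtain ⟨h1, h2⟩ := hball ζ (mem_sphere_zero_iff_norm.1 hζ).le
    refine (hbound _ h1).trans (mul_le_mul_of_nonneg_left ?_ hC.le)
    rw [hP, hQ, ← Finset.prod_mul_distrib]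
    refine Finset.prod_le_prod (fun m _ => zpow_nonneg Metric.infDist_nonneg _) fun m _ => ?_
    rw [infDist_Z]
    exact zpow_le_of_le_of_le (hD'.norm_coords_pos hz m) (h2 m).1 (h2 m).2 _
  have hcauchy := Complex.norm_deriv_le_of_forall_mem_sphere_norm_le hρ
    (hdiff.diffContOnCl_ball subset_rfl) hsphere
  rw [hder.deriv] at hcauchy
  refine hcauchy.trans ?_
  rw [div_le_iff₀ hρ]
  simp only [infDist_Z]
  -- The factor `1 / ρ` of Cauchy's inequality is absorbed by the additional weight.
  calc C * (P * Q) = C * P * Q := by ring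
    _ ≤ C * P * (B * ρ * ∏ m, ‖coords (I m) z‖ ^ weight I M m) :=
        mul_le_mul_of_nonneg_left hρB (by positivity)
    _ = _ := by ring

end ConeData

/-- `F` is a total family of coefficients to which the holomorphic function `f` is
multi-asymptotically developable. -/
structure IsExpansion (D : ConeData I) (f : Cn ι → ℂ) (F : Family I) : Prop where
  analytic : AnalyticOnNhd ℂ f D.S
  coefficients : D.IsCoefficientFamily F
  developable : D.DevelopableTo f F

/-- The operation on families that corresponds to `foldPartial`. -/
def foldFam (l : List ι) (γ : ι → ℕ) (F : Family I) : Family I :=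
  l.foldr (fun i G => (famDeriv i)^[γ i] G) F

/-- The family of the coefficients of `∂^γ f`. -/
def iteratedFam (γ : ι → ℕ) (F : Family I) : Family I :=
  foldFam (Finset.univ : Finset ι).toList γ F

namespace IsExpansion

variable {f : Cn ι → ℂ} {F : Family I} (hI : IsAdmissible I) (hD : D.IsProper)

include hI hD

theorem partialDeriv (h : IsExpansion D f F) (i : ι) :
    IsExpansion D (partialDeriv i f) (famDeriv i F) :=
  ⟨analyticOnNhd_partialDeriv h.analytic i, h.coefficients.famDeriv i,
    h.developable.partialDeriv hI hD h.analytic h.coefficients i⟩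

theorem iterate (h : IsExpansion D f F) (i : ι) (m : ℕ) :
    IsExpansion D ((MultiAsymp.partialDeriv i)^[m] f) ((famDeriv i)^[m] F) := by
  induction m with
  | zero => exact h
  | succ m ih =>
    rw [Function.iterate_succ_apply', Function.iterate_succ_apply']
    exact ih.partialDeriv hI hD i

theorem foldPartial (h : IsExpansion D f F) (l : List ι) (γ : ι → ℕ) :
    IsExpansion D (foldPartial l γ f) (foldFam l γ F) := by
  induction l with
  | nil => exact h
  | cons i l ih => exact ih.iterate hI hD i (γ i)

theorem iteratedPartial (h : IsExpansion D f F) (γ : ι → ℕ) :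
    IsExpansion D (iteratedPartial γ f) (iteratedFam γ F) :=
  h.foldPartial hI hD _ γ

end IsExpansion

theorem iterate_famDeriv_apply {i : ι} {J : Finset κ} (h : i ∈ union I J) (F : Family I) (m : ℕ)
    (β : ↥(union I J) → ℕ) :
    (famDeriv i)^[m] F J β = F J (β + Pi.single ⟨i, h⟩ m) := by
  induction m generalizing β with
  | zero => simp
  | succ m ih =>
    rw [Function.iterate_succ_apply', famDeriv_of_mem h, ih, add_assoc, ← Pi.single_add,
      add_comm 1 m]

/-- For derivatives in directions of `I_J` only the shifts in `famDeriv` occur, so no coefficient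
function is differentiated. -/
theorem foldFam_apply {J : Finset κ} (F : Family I) {l : List ι} (hl : l.Nodup) {γ : ι → ℕ}
    (hγ : ∀ i ∈ l, i ∉ union I J → γ i = 0) (β : ↥(union I J) → ℕ) :
    foldFam l γ F J β = F J (β + fun i => if i.1 ∈ l then γ i.1 else 0) := by
  induction l generalizing β with
  | nil =>
    change F J β = _
    congr 1
  | cons i l ih =>
    rw [List.nodup_cons] at hl
    have ih' := ih hl.2 fun k hk => hγ k (List.mem_cons_of_mem i hk)
    change (famDeriv i)^[γ i] (foldFam l γ F) J β = _
    by_cases hi : i ∈ union I J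
    · rw [iterate_famDeriv_apply hi, ih', add_assoc]
      congr 2
      funext k
      by_cases hk : k = ⟨i, hi⟩
      · subst hk
        simp [hl.1]
      · have : k.1 ≠ i := fun h => hk (Subtype.ext h)
        simp [hk, this]
    · have h0 := hγ i List.mem_cons_self hi
      rw [h0]
      refine (ih' β).trans ?_
      congr 2
      funext k
      have : k.1 ≠ i := fun h => hi (h ▸ k.2)
      simp [this]

theorem iteratedFam_apply {J : Finset κ} (F : Family I) {γ : ι → ℕ}
    (hγ : ∀ i, i ∉ union I J → γ i = 0) (β : ↥(union I J) → ℕ) :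
    iteratedFam γ F J β = F J (β + fun i => γ i.1) := by
  refine (foldFam_apply F (Finset.nodup_toList _) (fun i _ => hγ i) β).trans ?_
  simp

end DerivativesOfExpansions

/-! ### Polar paths in a cone and a mean value inequality. -/

section Paths

variable {V : Type*} [NormedAddCommGroup V] [NormedSpace ℝ V]

/-- The path from `x` to `y` whose norm is the linear interpolation of the norms of `x` and `y` and
whose direction is that of the segment from `x` to `y`. -/
def polarPath (x y : V) (t : ℝ) : V :=
  (((1 - t) * ‖x‖ + t * ‖y‖) / ‖(1 - t) • x + t • y‖) • ((1 - t) • x + t • y)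

theorem norm_normalize_sub_le {a b : V} (ha : a ≠ 0) (hb : b ≠ 0) :
    ‖‖a‖⁻¹ • a - ‖b‖⁻¹ • b‖ ≤ 2 * ‖a - b‖ / ‖b‖ := by
  have ha' : 0 < ‖a‖ := norm_pos_iff.2 ha
  have hb' : 0 < ‖b‖ := norm_pos_iff.2 hb
  have h1 : ‖a‖⁻¹ • a - ‖b‖⁻¹ • b = ‖b‖⁻¹ • (a - b) + (‖a‖⁻¹ - ‖b‖⁻¹) • a := by
    rw [smul_sub, sub_smul]
    abel
  have h2 : ‖(‖a‖⁻¹ - ‖b‖⁻¹) • a‖ ≤ ‖a - b‖ / ‖b‖ := by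
    rw [norm_smul, Real.norm_eq_abs]
    have h3 : |‖a‖⁻¹ - ‖b‖⁻¹| * ‖a‖ = |‖b‖ - ‖a‖| / ‖b‖ := by
      rw [inv_sub_inv ha'.ne' hb'.ne', abs_div, abs_of_pos (mul_pos ha' hb')]
      field_simp
    rw [h3, norm_sub_rev]
    exact div_le_div_of_nonneg_right (abs_norm_sub_norm_le b a) hb'.le
  rw [h1]
  refine (norm_add_le _ _).trans ?_
  rw [norm_smul, norm_inv, norm_norm]
  calc ‖b‖⁻¹ * ‖a - b‖ + ‖(‖a‖⁻¹ - ‖b‖⁻¹) • a‖ ≤ ‖b‖⁻¹ * ‖a - b‖ + ‖a - b‖ / ‖b‖ :=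
        add_le_add_right h2 _
    _ = 2 * ‖a - b‖ / ‖b‖ := by
        field_simp
        ring

section

variable {C : Set V} {c : ℝ} {x y : V} (hc : 0 < c)
  (hCc : ∀ x ∈ C, ∀ y ∈ C, ∀ t ∈ Icc (0 : ℝ) 1,
    c * ((1 - t) * ‖x‖ + t * ‖y‖) ≤ ‖(1 - t) • x + t • y‖) (h0 : (0 : V) ∉ C)
  (hx : x ∈ C) (hy : y ∈ C)

theorem polarPath_zero : polarPath x y 0 = x := by
  by_cases h : x = 0
  · simp [polarPath, h]
  · simp [polarPath, norm_ne_zero_iff.2 h]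

theorem polarPath_one : polarPath x y 1 = y := by
  by_cases h : y = 0
  · simp [polarPath, h]
  · simp [polarPath, norm_ne_zero_iff.2 h]

include h0 hx hy in
theorem interpolated_norm_pos {t : ℝ} (ht : t ∈ Icc (0 : ℝ) 1) :
    0 < (1 - t) * ‖x‖ + t * ‖y‖ := by
  have hx' : 0 < ‖x‖ := norm_pos_iff.2 fun h => h0 (h ▸ hx)
  have hy' : 0 < ‖y‖ := norm_pos_iff.2 fun h => h0 (h ▸ hy)
  have h1 : 0 ≤ 1 - t := by linarith [ht.2]
  rcases eq_or_lt_of_le ht.1 with h | h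
  · simpa [← h] using hx'
  · nlinarith [mul_nonneg h1 hx'.le, mul_pos h hy']

include hc hCc h0 hx hy

theorem norm_segment_pos {t : ℝ} (ht : t ∈ Icc (0 : ℝ) 1) : 0 < ‖(1 - t) • x + t • y‖ :=
  (mul_pos hc (interpolated_norm_pos h0 hx hy ht)).trans_le (hCc x hx y hy t ht)

/-- The hypothesis on the segment excludes cancellation, so that the normalization never divides by
zero. -/
theorem norm_polarPath {t : ℝ} (ht : t ∈ Icc (0 : ℝ) 1) :
    ‖polarPath x y t‖ = (1 - t) * ‖x‖ + t * ‖y‖ := by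
  have h1 := norm_segment_pos hc hCc h0 hx hy ht
  have h2 := interpolated_norm_pos h0 hx hy ht
  rw [polarPath, norm_smul, Real.norm_of_nonneg (by positivity), div_mul_cancel₀ _ h1.ne']

theorem polarPath_mem (hC : IsCone C) (hconv : Convex ℝ C) {t : ℝ} (ht : t ∈ Icc (0 : ℝ) 1) :
    polarPath x y t ∈ C := by
  have h1 := norm_segment_pos hc hCc h0 hx hy ht
  have h2 := interpolated_norm_pos h0 hx hy ht
  exact hC _ (div_pos h2 h1) _ (hconv hx hy (by linarith [ht.2]) ht.1 (by ring))

/-- The path is a radius times a direction. The radius varies at most as fast as the segment; the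
direction varies by at most twice the displacement divided by the norm on the segment, and that norm
is at least `c` times the radius. -/
theorem norm_polarPath_sub_le {s t : ℝ} (hs : s ∈ Icc (0 : ℝ) 1) (ht : t ∈ Icc (0 : ℝ) 1) :
    ‖polarPath x y t - polarPath x y s‖ ≤ (1 + 2 / c) * (‖y - x‖ * |t - s|) := by
  set p : ℝ → V := fun t => (1 - t) • x + t • y with hp
  set ρ : ℝ → ℝ := fun t => (1 - t) * ‖x‖ + t * ‖y‖ with hρ
  have hp0 : ∀ t ∈ Icc (0 : ℝ) 1, 0 < ‖p t‖ := fun t ht =>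
    norm_segment_pos hc hCc h0 hx hy ht
  have hpath : ∀ t, polarPath x y t = ρ t • (‖p t‖⁻¹ • p t) := fun t => by
    rw [smul_smul, ← div_eq_mul_inv]
    rfl
  have h1 : polarPath x y t - polarPath x y s =
      (ρ t - ρ s) • (‖p t‖⁻¹ • p t) + ρ s • (‖p t‖⁻¹ • p t - ‖p s‖⁻¹ • p s) := by
    rw [hpath, hpath, sub_smul, smul_sub]
    abel
  have h2 : ‖p t - p s‖ = ‖y - x‖ * |t - s| := by
    have : p t - p s = (t - s) • (y - x) := by
      simp only [hp, sub_smul, smul_sub, one_smul]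
      abel
    rw [this, norm_smul, Real.norm_eq_abs, mul_comm]
  have h3 : |ρ t - ρ s| ≤ ‖y - x‖ * |t - s| := by
    have : ρ t - ρ s = (t - s) * (‖y‖ - ‖x‖) := by
      simp only [hρ]
      ring
    rw [this, abs_mul, mul_comm]
    exact mul_le_mul_of_nonneg_right (abs_norm_sub_norm_le y x) (abs_nonneg _)
  have h4 : ‖‖p t‖⁻¹ • p t‖ = 1 := by
    rw [norm_smul, norm_inv, norm_norm, inv_mul_cancel₀ (hp0 t ht).ne']
  have h5 := norm_normalize_sub_le (norm_pos_iff.1 (hp0 t ht)) (norm_pos_iff.1 (hp0 s hs))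
  have hρs : 0 < ρ s := interpolated_norm_pos h0 hx hy hs
  have h6 : ρ s / ‖p s‖ ≤ 1 / c := by
    rw [div_le_div_iff₀ (hp0 s hs) hc, one_mul, mul_comm]
    exact hCc x hx y hy s hs
  rw [h1]
  refine (norm_add_le _ _).trans ?_
  rw [norm_smul (ρ t - ρ s), norm_smul (ρ s), h4, mul_one, Real.norm_eq_abs,
    Real.norm_of_nonneg hρs.le]
  have h7 : ρ s * ‖‖p t‖⁻¹ • p t - ‖p s‖⁻¹ • p s‖ ≤ 1 / c * (2 * (‖y - x‖ * |t - s|)) := by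
    refine (mul_le_mul_of_nonneg_left h5 hρs.le).trans ?_
    rw [h2]
    calc ρ s * (2 * (‖y - x‖ * |t - s|) / ‖p s‖)
        = ρ s / ‖p s‖ * (2 * (‖y - x‖ * |t - s|)) := by ring
      _ ≤ _ := mul_le_mul_of_nonneg_right h6 (by positivity)
  calc _ ≤ ‖y - x‖ * |t - s| + 1 / c * (2 * (‖y - x‖ * |t - s|)) := add_le_add h3 h7
    _ = _ := by ring

end

/-- A mean value inequality along Lipschitz paths. -/
theorem norm_sub_le_of_path {E : Type*} [NormedAddCommGroup E] [NormedSpace ℂ E] {g : E → ℂ}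
    {φ : ℝ → E} {L M : ℝ} (hL : 0 ≤ L) (hφ : ∀ s ∈ Icc (0 : ℝ) 1, ∀ t ∈ Icc (0 : ℝ) 1,
      ‖φ t - φ s‖ ≤ L * |t - s|) (hg : ∀ t ∈ Icc (0 : ℝ) 1, DifferentiableAt ℂ g (φ t))
    (hM : ∀ t ∈ Icc (0 : ℝ) 1, ‖fderiv ℂ g (φ t)‖ ≤ M) {t : ℝ} (ht : t ∈ Icc (0 : ℝ) 1) :
    ‖g (φ t) - g (φ 0)‖ ≤ M * L := by
  have hM0 : 0 ≤ M := (norm_nonneg _).trans (hM t ht)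
  have hcont : ContinuousOn φ (Icc 0 1) := by
    refine LipschitzOnWith.continuousOn (K := ⟨L, hL⟩) ?_
    refine LipschitzOnWith.of_dist_le_mul fun s hs t ht => ?_
    rw [dist_eq_norm, Real.dist_eq]
    exact hφ t ht s hs
  have hcontg : ContinuousOn (fun t => g (φ t) - g (φ 0)) (Icc 0 1) := by
    refine ContinuousOn.sub (fun t ht => ?_) continuousOn_const
    exact (hg t ht).continuousAt.comp_continuousWithinAt (hcont t ht)
  have key : ∀ s ∈ Icc (0 : ℝ) 1, ‖g (φ s) - g (φ 0)‖ ≤ M * L * s := by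
    -- The path is only Lipschitz and need not be differentiable; an upper bound for the right
    -- slopes of the norm is enough.
    refine image_le_of_liminf_slope_right_le_deriv_boundary (B' := fun _ => M * L)
      hcontg.norm (by simp) (by fun_prop)
      (fun x _ => by simpa using ((hasDerivAt_id x).const_mul (M * L)).hasDerivWithinAt) ?_
    intro s hs r hr
    have hsI : s ∈ Icc (0 : ℝ) 1 := ⟨hs.1, hs.2.le⟩
    -- The slack `η` absorbs the error of the linear approximation of `g`.
    obtain ⟨η, hη, hηr⟩ : ∃ η > 0, (M + η) * L < r := by
      refine ⟨(r - M * L) / (2 * (L + 1)), by have := sub_pos.2 hr; positivity, ?_⟩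
      have h1 : (r - M * L) / (2 * (L + 1)) * (2 * (L + 1)) = r - M * L := by field_simp
      have h2 : 0 < (r - M * L) / (2 * (L + 1)) := by
        have := sub_pos.2 hr
        positivity
      nlinarith
    have hlit := (hg s hsI).hasFDerivAt.isLittleO.def hη
    have htend : Tendsto φ (𝓝[>] s) (𝓝 (φ s)) :=
      (hcont s hsI).mono_left (nhdsWithin_le_of_mem (Icc_mem_nhdsGT_of_mem hs))
    refine Eventually.frequently ?_
    filter_upwards [htend.eventually hlit, Icc_mem_nhdsGT_of_mem hs, self_mem_nhdsWithin]
      with z hz hzI hzs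
    have hzs' : 0 < z - s := sub_pos.2 hzs
    rw [slope_def_field, div_lt_iff₀ hzs']
    have h1 : ‖g (φ z) - g (φ 0)‖ - ‖g (φ s) - g (φ 0)‖ ≤ ‖g (φ z) - g (φ s)‖ := by
      have := norm_sub_norm_le (g (φ z) - g (φ 0)) (g (φ s) - g (φ 0))
      rwa [sub_sub_sub_cancel_right] at this
    have h2 : ‖fderiv ℂ g (φ s) (φ z - φ s)‖ ≤ M * ‖φ z - φ s‖ :=
      ((fderiv ℂ g (φ s)).le_opNorm _).trans
        (mul_le_mul_of_nonneg_right (hM s hsI) (norm_nonneg _))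
    have h3 : ‖g (φ z) - g (φ s)‖ ≤ (M + η) * ‖φ z - φ s‖ := by
      have := norm_add_le (g (φ z) - g (φ s) - fderiv ℂ g (φ s) (φ z - φ s))
        (fderiv ℂ g (φ s) (φ z - φ s))
      rw [sub_add_cancel] at this
      linarith
    have h4 : ‖φ z - φ s‖ ≤ L * (z - s) := by
      have := hφ s hsI z hzI
      rwa [abs_of_pos hzs'] at this
    have h5 : (M + η) * ‖φ z - φ s‖ ≤ (M + η) * (L * (z - s)) :=
      mul_le_mul_of_nonneg_left h4 (by positivity)
    nlinarith
  refine (key t ht).trans ?_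
  have : 0 ≤ M * L := mul_nonneg hM0 hL
  nlinarith [ht.2]

end Paths

/-! ### Quasi-convexity of properly contained multi-cones. -/

section PathsInMultiCones

variable {ι κ : Type*} [Fintype ι] [DecidableEq ι] [Fintype κ] [DecidableEq κ]
  {I : κ → Finset ι} {D D' : ConeData I}

theorem ext_hat {z w : Cn ι} (h : ∀ k, coords (hat I k) z = coords (hat I k) w)
    (h' : coords (free I) z = coords (free I) w) : z = w := by
  ext i
  rcases mem_free_or_exists_mem_hat I i with hi | ⟨k, hi⟩
  · exact coords_eq_iff.1 h' i hi
  · exact coords_eq_iff.1 (h k) i hi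

/-- The point with prescribed components in the factors `ℂ^{Î_k}` and `ℂ^d`. -/
def assemble (I : κ → Finset ι) (v : (k : κ) → Cn ↥(hat I k)) (w : Cn ↥(free I)) : Cn ι :=
  extend (free I) w + ∑ k, extend (hat I k) (v k)

theorem coords_free_assemble (v : (k : κ) → Cn ↥(hat I k)) (w : Cn ↥(free I)) :
    coords (free I) (assemble I v w) = w := by
  rw [assemble, coords_add, coords_extend, ← coordsL_apply, map_sum, Finset.sum_eq_zero, add_zero]
  intro k _
  rw [coordsL_apply, coords_extend_of_disjoint (disjoint_hat_free k).symm]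

theorem coords_hat_assemble (hI : IsAdmissible I) (v : (k : κ) → Cn ↥(hat I k))
    (w : Cn ↥(free I)) (m : κ) : coords (hat I m) (assemble I v w) = v m := by
  rw [assemble, coords_add, coords_extend_of_disjoint (disjoint_hat_free m), zero_add,
    ← coordsL_apply, map_sum, Finset.sum_eq_single m]
  · simp
  · intro k _ hkm
    rw [coordsL_apply, coords_extend_of_disjoint (hI.disjoint_hat hkm.symm)]
  · simp

theorem norm_assemble_sub_le (v v' : (k : κ) → Cn ↥(hat I k)) (w w' : Cn ↥(free I)) :
    ‖assemble I v w - assemble I v' w'‖ ≤ ‖w - w'‖ + ∑ k, ‖v k - v' k‖ := by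
  have h : assemble I v w - assemble I v' w' =
      extend (free I) (w - w') + ∑ k, extend (hat I k) (v k - v' k) := by
    simp only [assemble, ← extendL_apply, map_sub, Finset.sum_sub_distrib]
    abel
  rw [h]
  refine (norm_add_le _ _).trans (add_le_add (norm_extend _ _).le ?_)
  exact (norm_sum_le _ _).trans_eq (Finset.sum_congr rfl fun k _ => norm_extend _ _)

/-- A multi-cone that is properly contained in another one is quasi-convex. -/
theorem ConeData.ProperlyContained.exists_path (hI : IsAdmissible I) (hD : D.IsProper)
    (hD' : D'.IsProper) (h : D'.ProperlyContained D) :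
    ∃ L > 0, ∀ x ∈ D'.S, ∀ y ∈ D'.S, ∃ φ : ℝ → Cn ι, φ 0 = x ∧ φ 1 = y ∧
      (∀ t ∈ Icc (0 : ℝ) 1, φ t ∈ D'.S) ∧
      ∀ s ∈ Icc (0 : ℝ) 1, ∀ t ∈ Icc (0 : ℝ) 1, ‖φ t - φ s‖ ≤ L * ‖y - x‖ * |t - s| := by
  have hc : ∀ k, ∃ c > 0, ∀ x ∈ D'.G k, ∀ y ∈ D'.G k, ∀ t ∈ Icc (0 : ℝ) 1,
      c * ((1 - t) * ‖x‖ + t * ‖y‖) ≤ ‖(1 - t) • x + t • y‖ := by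
    intro k
    -- A functional comparable with the norm on the smaller cone is additive, which bounds the norm
    -- of a convex combination from below.
    obtain ⟨φ, -, c, hc, hφ⟩ := IsCone.exists_functional (C := D'.G k) (hD'.G_cone k)
      (hD.G_open k) (hD.G_convex k) (hD.isProperCone k).zero_notMem (h.G_subset k)
    have hp : 0 < ‖φ‖ + 1 := by positivity
    refine ⟨c / (‖φ‖ + 1), by positivity, fun x hx y hy t ht => ?_⟩
    have h1 := hφ x (subset_closure hx)
    have h2 := hφ y (subset_closure hy)
    have h3 : φ ((1 - t) • x + t • y) ≤ (‖φ‖ + 1) * ‖(1 - t) • x + t • y‖ :=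
      ((le_abs_self _).trans (φ.le_opNorm _)).trans
        (mul_le_mul_of_nonneg_right (by linarith) (norm_nonneg _))
    rw [map_add, map_smul, map_smul, smul_eq_mul, smul_eq_mul] at h3
    rw [div_mul_eq_mul_div, div_le_iff₀ hp, mul_comm ‖_‖]
    have h4 : 0 ≤ 1 - t := by linarith [ht.2]
    nlinarith [mul_le_mul_of_nonneg_left h1 h4, mul_le_mul_of_nonneg_left h2 ht.1]
  choose c hc hcG using hc
  have h0 : ∀ k, (0 : Cn ↥(hat I k)) ∉ D'.G k := fun k => (hD'.isProperCone k).zero_notMem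
  refine ⟨1 + ∑ k, (1 + 2 / c k), ?_, fun x hx y hy => ?_⟩
  · have : 0 ≤ ∑ k, (1 + 2 / c k) := Finset.sum_nonneg fun k _ => by
      have := hc k
      positivity
    linarith
  have hx' := mem_S.1 hx
  have hy' := mem_S.1 hy
  -- Along polar paths the norms are interpolated linearly, so the conditions on the norms, being
  -- linear in them, persist. On a straight segment they could fail.
  set v : ℝ → (k : κ) → Cn ↥(hat I k) := fun t k =>
    polarPath (coords (hat I k) x) (coords (hat I k) y) t with hv
  set w : ℝ → Cn ↥(free I) := fun t => (1 - t) • coords (free I) x + t • coords (free I) y with hw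
  refine ⟨fun t => assemble I (v t) (w t), ?_, ?_, fun t ht => ?_, fun s hs t ht => ?_⟩
  · refine ext_hat (I := I) (fun k => ?_) ?_
    · rw [coords_hat_assemble hI]
      exact polarPath_zero
    · rw [coords_free_assemble]
      simp [hw]
  · refine ext_hat (I := I) (fun k => ?_) ?_
    · rw [coords_hat_assemble hI]
      exact polarPath_one
    · rw [coords_free_assemble]
      simp [hw]
  · have hn : ∀ k, ‖v t k‖ = (1 - t) * ‖coords (hat I k) x‖ + t * ‖coords (hat I k) y‖ :=
      fun k => norm_polarPath (hc k) (hcG k) (h0 k) (hx'.2.2.1 k) (hy'.2.2.1 k) ht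
    have ht0 := ht.1
    have ht1 : 0 ≤ 1 - t := by linarith [ht.2]
    have hlt : ∀ a b a' b' : ℝ, a < a' → b < b' → (1 - t) * a + t * b < (1 - t) * a' + t * b' := by
      intro a b a' b' ha hb
      rcases eq_or_lt_of_le ht0 with h | h
      · simpa [← h] using ha
      · nlinarith [mul_le_mul_of_nonneg_left ha.le ht1, mul_lt_mul_of_pos_left hb h]
    refine mem_S.2 ⟨fun k => ?_, ?_, fun k => ?_, fun j k hkj => ?_⟩
    · rw [coords_hat_assemble hI, hn]
      have := hlt _ _ _ _ (hx'.1 k) (hy'.1 k)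
      linarith
    · rw [coords_free_assemble]
      exact hD'.W_convex hx'.2.1 hy'.2.1 ht1 ht0 (by ring)
    · rw [coords_hat_assemble hI]
      exact polarPath_mem (hc k) (hcG k) (h0 k) (hx'.2.2.1 k) (hy'.2.2.1 k) (hD'.G_cone k)
        (hD'.G_convex k) ht
    · rw [coords_hat_assemble hI, coords_hat_assemble hI, hn, hn]
      have := hlt _ _ _ _ (hx'.2.2.2 j k hkj) (hy'.2.2.2 j k hkj)
      linarith
  · refine (norm_assemble_sub_le _ _ _ _).trans ?_
    have hn : ∀ A : Finset ι, ‖coords A y - coords A x‖ ≤ ‖y - x‖ := fun A => by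
      rw [← coords_sub]
      exact norm_coords_le A _
    have h1 : ‖w t - w s‖ ≤ ‖y - x‖ * |t - s| := by
      have : w t - w s = (t - s) • (coords (free I) y - coords (free I) x) := by
        simp only [hw, sub_smul, smul_sub, one_smul]
        abel
      rw [this, norm_smul, Real.norm_eq_abs, mul_comm]
      exact mul_le_mul_of_nonneg_right (hn _) (abs_nonneg _)
    have h2 : ∀ k, ‖v t k - v s k‖ ≤ (1 + 2 / c k) * (‖y - x‖ * |t - s|) := by
      intro k
      refine (norm_polarPath_sub_le (hc k) (hcG k) (h0 k) (hx'.2.2.1 k) (hy'.2.2.1 k) hs ht).trans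
        ?_
      have := hc k
      exact mul_le_mul_of_nonneg_left (mul_le_mul_of_nonneg_right (hn _) (abs_nonneg _))
        (by positivity)
    have h3 := Finset.sum_le_sum fun k (_ : k ∈ Finset.univ) => h2 k
    rw [← Finset.sum_mul] at h3
    calc _ ≤ ‖y - x‖ * |t - s| + (∑ k, (1 + 2 / c k)) * (‖y - x‖ * |t - s|) := add_le_add h1 h3
      _ = _ := by ring

end PathsInMultiCones

/-! ### Taylor estimates on quasi-convex sets and Whitney extension. -/

section TaylorRemainders

variable {ι : Type*} [Fintype ι] [DecidableEq ι]

/-- The multi-indices of degree at most `r`. -/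
def degLE (ι : Type*) [Fintype ι] [DecidableEq ι] (r : ℕ) : Finset (ι → ℕ) :=
  (Fintype.piFinset fun _ : ι => Finset.range (r + 1)).filter fun a => ∑ i, a i ≤ r

theorem mem_degLE {r : ℕ} {a : ι → ℕ} : a ∈ degLE ι r ↔ ∑ i, a i ≤ r := by
  simp only [degLE, Finset.mem_filter, Fintype.mem_piFinset, Finset.mem_range,
    and_iff_right_iff_imp]
  intro h i
  exact Nat.lt_succ_of_le ((Finset.single_le_sum (f := a) (fun k _ => Nat.zero_le _)
    (Finset.mem_univ i)).trans h)

theorem mem_indexPairs {r : ℕ} {p : (ι → ℕ) × (ι → ℕ)} :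
    p ∈ indexPairs ι r ↔ ∑ i, p.1 i + ∑ i, p.2 i ≤ r := by
  simp only [indexPairs, Finset.mem_filter, Finset.mem_product, Fintype.mem_piFinset,
    Finset.mem_range, and_iff_right_iff_imp]
  intro h
  have key : ∀ (a : ι → ℕ) (i : ι), a i ≤ ∑ k, a k := fun a i =>
    Finset.single_le_sum (f := a) (fun k _ => Nat.zero_le _) (Finset.mem_univ i)
  exact ⟨fun i => by have := key p.1 i; omega, fun i => by have := key p.2 i; omega⟩

theorem mem_degLE_add_single {r : ℕ} {a : ι → ℕ} {i : ι} :
    a ∈ degLE ι r ↔ a + Pi.single i 1 ∈ degLE ι (r + 1) := by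
  simp [mem_degLE, Finset.sum_add_distrib]

theorem poly_apply_zero {s : Finset (ι → ℕ)} (hs : 0 ∈ s) (c : (ι → ℕ) → ℂ) :
    poly s c 0 = c 0 := by
  rw [poly, Finset.sum_eq_single_of_mem 0 hs]
  · simp [multiFactorial]
  · intro a _ ha
    obtain ⟨i, hi⟩ : ∃ i, a i ≠ 0 := by
      by_contra h
      push Not at h
      exact ha (funext h)
    rw [Finset.prod_eq_zero (Finset.mem_univ i) (by simp [hi])]
    simp

/-- The remainder of order `r` in the Taylor expansion of `∂^γ f` at `x`. -/
def taylorRemainder (f : Cn ι → ℂ) (r : ℕ) (γ : ι → ℕ) (x z : Cn ι) : ℂ :=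
  iteratedPartial γ f z - poly (degLE ι r) (fun a => iteratedPartial (γ + a) f x) (z - x)

variable {f : Cn ι → ℂ} {S : Set (Cn ι)}

theorem taylorRemainder_self (r : ℕ) (γ : ι → ℕ) (x : Cn ι) : taylorRemainder f r γ x x = 0 := by
  rw [taylorRemainder, sub_self, poly_apply_zero (by simp [mem_degLE]), add_zero, sub_self]

theorem differentiableAt_taylorRemainder (hf : AnalyticOnNhd ℂ f S) (r : ℕ) (γ : ι → ℕ)
    (x : Cn ι) {z : Cn ι} (hz : z ∈ S) : DifferentiableAt ℂ (taylorRemainder f r γ x) z := by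
  have h1 : DifferentiableAt ℂ (iteratedPartial γ f) z :=
    (analyticOnNhd_iteratedPartial hf γ z hz).differentiableAt
  have h2 : DifferentiableAt ℂ
      (fun z => poly (degLE ι r) (fun a => iteratedPartial (γ + a) f x) (z - x)) z :=
    (differentiable_poly (degLE ι r) (fun a => iteratedPartial (γ + a) f x)).differentiableAt.comp
      z (differentiableAt_id.sub_const x)
  exact h1.sub h2

/-- Differentiation turns a remainder into a remainder of one order less for the next derivative.
The set `t` is left free so that order zero, where no Taylor polynomial remains and `t` is empty, is
included. -/
theorem partialDeriv_taylorRemainder_aux (hS : IsOpen S) (hf : AnalyticOnNhd ℂ f S) {r : ℕ}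
    {i : ι} {t : Finset (ι → ℕ)} (ht : ∀ a, a ∈ t ↔ a + Pi.single i 1 ∈ degLE ι r) (γ : ι → ℕ)
    (x : Cn ι) {z : Cn ι} (hz : z ∈ S) :
    partialDeriv i (taylorRemainder f r γ x) z = iteratedPartial (γ + Pi.single i 1) f z -
      poly t (fun a => iteratedPartial (γ + Pi.single i 1 + a) f x) (z - x) := by
  refine partialDeriv_eq (differentiableAt_taylorRemainder hf r γ x hz) ?_
  have h1 := hasDerivAt_partialDeriv (analyticOnNhd_iteratedPartial hf γ z hz).differentiableAt i
  rw [partialDeriv_iteratedPartial hS hf γ i hz] at h1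
  have h2 := hasDerivAt_poly ht (fun a => iteratedPartial (γ + a) f x) (z - x)
  have h3 : ∀ a : ι → ℕ, γ + (a + Pi.single i 1) = γ + Pi.single i 1 + a := fun a => by
    rw [add_comm a, ← add_assoc]
  simp only [h3] at h2
  have h4 : ∀ ζ : ℂ, z + ζ • EuclideanSpace.single i (1 : ℂ) - x =
      z - x + ζ • EuclideanSpace.single i (1 : ℂ) := fun ζ => by abel
  simp only [taylorRemainder, h4]
  exact h1.sub h2

theorem partialDeriv_taylorRemainder_succ (hS : IsOpen S) (hf : AnalyticOnNhd ℂ f S) (r : ℕ)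
    (i : ι) (γ : ι → ℕ) (x : Cn ι) {z : Cn ι} (hz : z ∈ S) :
    partialDeriv i (taylorRemainder f (r + 1) γ x) z =
      taylorRemainder f r (γ + Pi.single i 1) x z :=
  partialDeriv_taylorRemainder_aux hS hf (fun _ => mem_degLE_add_single) γ x hz

theorem partialDeriv_taylorRemainder_zero (hS : IsOpen S) (hf : AnalyticOnNhd ℂ f S)
    (i : ι) (γ : ι → ℕ) (x : Cn ι) {z : Cn ι} (hz : z ∈ S) :
    partialDeriv i (taylorRemainder f 0 γ x) z = iteratedPartial (γ + Pi.single i 1) f z := by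
  rw [partialDeriv_taylorRemainder_aux hS hf (t := ∅) (fun a => ?_) γ x hz]
  · simp [poly]
  · simp only [Finset.notMem_empty, mem_degLE, false_iff, not_le, Pi.add_apply,
      Finset.sum_add_distrib, Finset.sum_pi_single', Finset.mem_univ, if_true]
    omega

/-- Quasi-convexity with constant `L`. -/
def IsQuasiConvex (L : ℝ) (S : Set (Cn ι)) : Prop :=
  ∀ x ∈ S, ∀ y ∈ S, ∃ φ : ℝ → Cn ι, φ 0 = x ∧ φ 1 = y ∧ (∀ t ∈ Icc (0 : ℝ) 1, φ t ∈ S) ∧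
    ∀ s ∈ Icc (0 : ℝ) 1, ∀ t ∈ Icc (0 : ℝ) 1, ‖φ t - φ s‖ ≤ L * ‖y - x‖ * |t - s|

/-- Taylor's estimate for a function with bounded derivatives on a quasi-convex open set. -/
theorem exists_norm_taylorRemainder_le {L : ℝ} (hL : 0 < L) (hS : IsOpen S)
    (hquasi : IsQuasiConvex L S) (hf : AnalyticOnNhd ℂ f S)
    (hbdd : ∀ γ, ∃ M, ∀ z ∈ S, ‖iteratedPartial γ f z‖ ≤ M) (r : ℕ) (γ : ι → ℕ) :
    ∃ K ≥ 0, ∀ x ∈ S, ∀ y ∈ S, ‖taylorRemainder f r γ x y‖ ≤ K * ‖y - x‖ ^ (r + 1) := by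
  choose φ hφ0 hφ1 hφS hφL using hquasi
  choose M hM using hbdd
  -- The induction bounds the remainder on the whole path chosen for `x` and `y`, always by powers
  -- of `‖y - x‖`. Thus the same path serves every order.
  suffices H : ∀ r γ, ∃ K ≥ 0, ∀ x (hx : x ∈ S) y (hy : y ∈ S), ∀ t ∈ Icc (0 : ℝ) 1,
      ‖taylorRemainder f r γ x (φ x hx y hy t)‖ ≤ K * ‖y - x‖ ^ (r + 1) by
    obtain ⟨K, hK, h⟩ := H r γ
    refine ⟨K, hK, fun x hx y hy => ?_⟩
    have := h x hx y hy 1 ⟨zero_le_one, le_rfl⟩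
    rwa [hφ1] at this
  -- One integration along the path: the remainder vanishes at `x` and the length of the path is at
  -- most `L * ‖y - x‖`.
  have step : ∀ r γ (x) (hx : x ∈ S) (y) (hy : y ∈ S) (B : ℝ),
      (∀ t ∈ Icc (0 : ℝ) 1,
        ∑ i, ‖partialDeriv i (taylorRemainder f r γ x) (φ x hx y hy t)‖ ≤ B) →
      ∀ t ∈ Icc (0 : ℝ) 1, ‖taylorRemainder f r γ x (φ x hx y hy t)‖ ≤ B * (L * ‖y - x‖) := by
    intro r γ x hx y hy B hB t ht
    have h1 := norm_sub_le_of_path (g := taylorRemainder f r γ x) (φ := φ x hx y hy)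
      (L := L * ‖y - x‖) (M := B) (by positivity) (hφL x hx y hy)
      (fun t ht => differentiableAt_taylorRemainder hf r γ x (hφS x hx y hy t ht))
      (fun t ht => (norm_fderiv_le _ _).trans (hB t ht)) ht
    rwa [hφ0, taylorRemainder_self, sub_zero] at h1
  intro r
  induction r with
  | zero =>
    intro γ
    refine ⟨(∑ i, |M (γ + Pi.single i 1)|) * L, by positivity, fun x hx y hy t ht => ?_⟩
    refine (step 0 γ x hx y hy (∑ i, |M (γ + Pi.single i 1)|) (fun t ht => ?_) t ht).trans_eq
      (by ring)
    refine Finset.sum_le_sum fun i _ => ?_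
    rw [partialDeriv_taylorRemainder_zero hS hf i γ x (hφS x hx y hy t ht)]
    exact (hM _ _ (hφS x hx y hy t ht)).trans (le_abs_self _)
  | succ r ih =>
    intro γ
    choose K hK hKle using ih
    refine ⟨(∑ i, K (γ + Pi.single i 1)) * L,
      mul_nonneg (Finset.sum_nonneg fun i _ => hK _) hL.le, fun x hx y hy t ht => ?_⟩
    refine (step (r + 1) γ x hx y hy ((∑ i, K (γ + Pi.single i 1)) * ‖y - x‖ ^ (r + 1))
      (fun t ht => ?_) t ht).trans_eq (by ring)
    rw [Finset.sum_mul]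
    refine Finset.sum_le_sum fun i _ => ?_
    rw [partialDeriv_taylorRemainder_succ hS hf r i γ x (hφS x hx y hy t ht)]
    exact hKle _ x hx y hy t ht

/-- The Taylor polynomial of a jet without antiholomorphic components. -/
theorem sum_indexPairs_eq (u : (ι → ℕ) → (ι → ℕ) → ℂ) (hu : ∀ γ δ, δ ≠ 0 → u γ δ = 0)
    (γ : ι → ℕ) (r : ℕ) (w : Cn ι) :
    ∑ p ∈ indexPairs ι r, u (γ + p.1) (0 + p.2) *
        ((∏ i, w i ^ p.1 i) * ∏ i, (starRingEnd ℂ (w i)) ^ p.2 i) /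
        ((multiFactorial p.1 : ℂ) * (multiFactorial p.2 : ℂ)) =
      poly (degLE ι r) (fun a => u (γ + a) 0) w := by
  symm
  refine Finset.sum_of_injOn (fun a => (a, 0)) (fun a _ b _ h => (Prod.mk.inj h).1) ?_ ?_ ?_
  · intro a ha
    have := mem_degLE.1 (Finset.mem_coe.1 ha)
    exact Finset.mem_coe.2 (mem_indexPairs.2 (by simpa using this))
  · rintro ⟨a, b⟩ hp hnp
    have hb : b ≠ 0 := by
      rintro rfl
      refine hnp ⟨a, Finset.mem_coe.2 (mem_degLE.2 ?_), rfl⟩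
      simpa using mem_indexPairs.1 hp
    simp [hu _ b hb]
  · intro a _
    simp [multiFactorial]

/-- A holomorphic function with bounded derivatives on a quasi-convex open set has a Whitney
extension to the closure. -/
theorem exists_isWhitneyExtension {L : ℝ} (hL : 0 < L) (hS : IsOpen S)
    (hquasi : IsQuasiConvex L S) (hf : AnalyticOnNhd ℂ f S)
    (hbdd : ∀ γ, ∃ M, ∀ z ∈ S, ‖iteratedPartial γ f z‖ ≤ M) :
    ∃ u, IsWhitneyExtension S f u := by
  -- The Taylor estimate of order zero says that every derivative is Lipschitz, hence extends
  -- continuously.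
  have hext : ∀ γ, ∃ e : Cn ι → ℂ, Continuous e ∧ EqOn (iteratedPartial γ f) e S := by
    intro γ
    obtain ⟨K, hK, h⟩ := exists_norm_taylorRemainder_le hL hS hquasi hf hbdd 0 γ
    have hlip : LipschitzOnWith ⟨K, hK⟩ (iteratedPartial γ f) S := by
      refine LipschitzOnWith.of_dist_le_mul fun y hy x hx => ?_
      rw [dist_eq_norm, dist_eq_norm]
      have h1 := h x hx y hy
      have h2 : degLE ι 0 = {0} := by
        ext a
        simp only [mem_degLE, Nat.le_zero, Finset.sum_eq_zero_iff, Finset.mem_univ, true_imp_iff,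
          Finset.mem_singleton]
        exact ⟨fun h => funext h, fun h i => by simp [h]⟩
      have h3 : poly (degLE ι 0) (fun a => iteratedPartial (γ + a) f x) (y - x) =
          iteratedPartial γ f x := by
        rw [h2]
        simp [poly, multiFactorial]
      rw [taylorRemainder, h3, zero_add, pow_one] at h1
      exact h1
    obtain ⟨e, he, heq⟩ := hlip.extend_finite_dimension
    exact ⟨e, he.continuous, heq⟩
  choose e he heq using hext
  set u : (ι → ℕ) → (ι → ℕ) → Cn ι → ℂ := fun γ δ => if δ = 0 then e γ else 0 with hu
  have hu0 : ∀ γ, u γ 0 = e γ := fun γ => by simp [hu]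
  have hu1 : ∀ γ δ, δ ≠ 0 → u γ δ = 0 := fun γ δ h => by simp [hu, h]
  refine ⟨u, ⟨fun γ δ => ?_, fun T hT _ γ δ r η hη => ?_⟩, fun γ => ?_, fun γ δ hδ => ?_⟩
  · by_cases h : δ = 0
    · rw [h, hu0]
      exact (he γ).continuousOn
    · rw [hu1 γ δ h]
      exact continuousOn_const
  · by_cases h : δ = 0
    swap
    -- With an antiholomorphic derivative present all components in the formula vanish.
    · refine ⟨1, one_pos, fun x _ y _ _ => ?_⟩
      have h1 : ∀ p : (ι → ℕ) × (ι → ℕ), u (γ + p.1) (δ + p.2) = 0 := fun p =>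
        hu1 _ _ fun h2 => h (add_eq_zero.1 h2).1
      simp only [h1, hu1 γ δ h, Pi.zero_apply, zero_mul, zero_div, Finset.sum_const_zero,
        sub_zero, norm_zero]
      positivity
    subst h
    obtain ⟨K, hK, hKle⟩ := exists_norm_taylorRemainder_le hL hS hquasi hf hbdd r γ
    set R : Cn ι × Cn ι → ℂ := fun p =>
      e γ p.2 - poly (degLE ι r) (fun a => e (γ + a) p.1) (p.2 - p.1) with hR
    have hRc : Continuous R := by
      simp only [hR, poly]
      fun_prop
    -- The Taylor estimate is a closed condition on the pair of points and passes to the closure of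
    -- `S ×ˢ S`.
    have hclosed : IsClosed {p : Cn ι × Cn ι | ‖R p‖ ≤ K * ‖p.2 - p.1‖ ^ (r + 1)} :=
      isClosed_le hRc.norm (by fun_prop)
    have hsub : closure (S ×ˢ S) ⊆ {p : Cn ι × Cn ι | ‖R p‖ ≤ K * ‖p.2 - p.1‖ ^ (r + 1)} := by
      refine closure_minimal ?_ hclosed
      rintro ⟨x, y⟩ ⟨hx, hy⟩
      have h1 := hKle x hx y hy
      have h2 : taylorRemainder f r γ x y = R (x, y) := by
        simp only [taylorRemainder, hR, poly, ← heq _ hx, ← heq _ hy]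
      rw [h2] at h1
      exact h1
    -- The remainder is bounded by the power `r + 1`, and one factor `‖y - x‖` is used to make the
    -- constant at most `η`; `K + 1` avoids division by zero.
    refine ⟨η / (K + 1), by positivity, fun x hx y hy hxy => ?_⟩
    have h1 : ‖R (x, y)‖ ≤ K * ‖y - x‖ ^ (r + 1) := by
      refine hsub (a := (x, y)) ?_
      rw [closure_prod_eq]
      exact ⟨hT hx, hT hy⟩
    have h2 := sum_indexPairs_eq (fun γ δ => u γ δ x) (fun γ δ h => by rw [hu1 γ δ h]; rfl) γ r
      (y - x)
    simp only [hu0, PiLp.sub_apply] at h2 ⊢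
    rw [h2]
    refine h1.trans ?_
    rw [pow_succ', ← mul_assoc]
    refine mul_le_mul_of_nonneg_right ?_ (by positivity)
    rw [lt_div_iff₀ (by positivity)] at hxy
    nlinarith [norm_nonneg (y - x)]
  · rw [hu0]
    exact (heq γ).symm
  · rw [hu1 γ δ hδ]
    exact fun _ _ => rfl

end TaylorRemainders

/-! ### Whitney extensions of developable functions. -/

section WhitneyExtensions

variable {ι κ : Type*} [Fintype ι] [DecidableEq ι] [Fintype κ] [DecidableEq κ]
  {I : κ → Finset ι} {D D' : ConeData I} {f : Cn ι → ℂ} {F : Family I}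

theorem app_zero (F : Family I) (z : Cn ι) : app I F 0 z = 0 := by
  refine Finset.sum_eq_zero fun J hJ => ?_
  obtain ⟨j, hj⟩ : J.Nonempty := by simpa using hJ
  have h : indexSet I J 0 = ∅ := by
    refine Finset.eq_empty_of_forall_notMem fun α hα => ?_
    exact absurd (mem_indexSet.1 hα j hj) (Nat.not_lt_zero _)
  simp [taylor, h]

/-- This is the estimate for `N = 0`: all truncations are empty and all weights are zero. -/
theorem IsExpansion.exists_bound (h : IsExpansion D f F) (hD' : D'.IsProper)
    (hD'D : D'.ProperlyContained D) : ∃ M, ∀ z ∈ D'.S, ‖f z‖ ≤ M := by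
  obtain ⟨C, _, hC⟩ := h.developable D' hD' hD'D 0
  refine ⟨C, fun z hz => ?_⟩
  have h1 := hC z hz
  simpa [app_zero, weight_zero] using h1

/-- A multi-asymptotically developable function has Whitney extensions. -/
theorem IsExpansion.exists_isWhitneyExtension (hI : IsAdmissible I) (hD : D.IsProper)
    (h : IsExpansion D f F) (hD' : D'.IsProper) (hD'D : D'.ProperlyContained D) :
    ∃ u, IsWhitneyExtension D'.S f u := by
  obtain ⟨L, hL, hpath⟩ := hD'D.exists_path hI hD hD'
  exact MultiAsymp.exists_isWhitneyExtension hL hD'.isOpen_S hpath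
    (h.analytic.mono (hD'D.S_subset hI hD'))
    -- Each derivative is itself developable and therefore bounded.
    fun γ => (h.iteratedPartial hI hD γ).exists_bound hD' hD'D

end WhitneyExtensions

/-! ### The coefficients as boundary values. -/

section BoundaryValues

variable {ι κ : Type*} [Fintype ι] [DecidableEq ι] [Fintype κ] [DecidableEq κ]
  {I : κ → Finset ι} {D D' : ConeData I} {f : Cn ι → ℂ} {F : Family I}

theorem continuous_scale_zero (A : Finset ι) : Continuous (scale A 0) := by
  have h : scale A 0 = fun z => extend Aᶜ (coords Aᶜ z) := funext fun z => scale_zero_eq A z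
  rw [h]
  exact (continuous_extend _).comp (continuous_coords _)

theorem union_union (J K : Finset κ) : union I (J ∪ K) = union I J ∪ union I K := by
  ext i
  simp only [mem_union, Finset.mem_union]
  constructor
  · rintro ⟨j, hj | hj, hi⟩
    · exact Or.inl ⟨j, hj, hi⟩
    · exact Or.inr ⟨j, hj, hi⟩
  · rintro (⟨j, hj, hi⟩ | ⟨j, hj, hi⟩)
    · exact ⟨j, Or.inl hj, hi⟩
    · exact ⟨j, Or.inr hj, hi⟩

theorem tendsto_incl_proj_scale (J K : Finset κ) (z : Cn ι) :
    Tendsto (fun t : ℝ => incl I K (proj I K (scale (union I J) t z))) (𝓝[>] 0)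
      (𝓝 (incl I (J ∪ K) (proj I (J ∪ K) z))) := by
  have h1 : incl I (J ∪ K) (proj I (J ∪ K) z) =
      scale (union I K) 0 (incl I J (proj I J z)) := by
    rw [incl_proj, incl_proj, union_union]
    ext i
    by_cases hJ : i ∈ union I J <;> by_cases hK : i ∈ union I K <;> simp [scale_apply, hJ, hK]
  rw [h1]
  simp only [incl_proj K]
  exact ((continuous_scale_zero _).tendsto _).comp (tendsto_scale_union J z)

/-- Inclusion-exclusion: the alternating sum over all subsets of `J` is zero, and the empty set
contributes 1. -/
theorem sum_nonempty_subsets (J : Finset κ) (hJ : J.Nonempty) :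
    ∑ K ∈ Finset.univ.filter (fun K : Finset κ => K.Nonempty),
      (-1 : ℂ) ^ (K.card + 1) * (if K ⊆ J then 1 else 0) = 1 := by
  have h1 : ∑ K ∈ J.powerset, (-1 : ℂ) ^ K.card = 0 := by
    exact_mod_cast congrArg (Int.cast : ℤ → ℂ)
      (Finset.sum_powerset_neg_one_pow_card_of_nonempty hJ)
  have h2 : J.powerset.erase ∅ =
      (Finset.univ.filter (fun K : Finset κ => K.Nonempty)).filter (fun K => K ⊆ J) := by
    ext K
    simp [Finset.nonempty_iff_ne_empty]
  rw [← Finset.add_sum_erase _ _ (Finset.empty_mem_powerset J), h2] at h1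
  simp only [mul_ite, mul_one, mul_zero]
  rw [← Finset.sum_filter]
  simp only [pow_succ, mul_neg, mul_one, Finset.sum_neg_distrib]
  simp only [Finset.card_empty, pow_zero] at h1
  linear_combination -h1

/-- For the indicator function of `J`, the Taylor polynomials reduce to the values of `f_{K,0}`. -/
theorem taylor_indicator (F : Family I) (J : Finset κ) {K : Finset κ} (z : Cn ι) : taylor I F K (fun j => if j ∈ J then 1 else 0) z =
      if K ⊆ J then F K 0 (proj I K z) else 0 := by
  by_cases h : K ⊆ J
  · have h1 : indexSet I K (fun j => if j ∈ J then 1 else 0) = {0} := by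
      ext α
      rw [mem_indexSet, Finset.mem_singleton]
      constructor
      · intro hα
        funext i
        obtain ⟨j, hj, hij⟩ := mem_union.1 i.2
        have h2 := hα j hj
        rw [if_pos (h hj), Nat.lt_one_iff, Finset.sum_eq_zero_iff] at h2
        exact h2 i (by simpa using hij)
      · rintro rfl j hj
        simp [h hj]
    simp [taylor, h1, h, multiFactorial]
  · obtain ⟨j, hj, hjJ⟩ := Finset.not_subset.1 h
    have h1 : indexSet I K (fun j => if j ∈ J then 1 else 0) = ∅ := by
      refine Finset.eq_empty_of_forall_notMem fun α hα => ?_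
      have h2 := mem_indexSet.1 hα j hj
      simp [hjJ] at h2
    simp [taylor, h1, h]

/-- The limit of the factors with `I_j ⊄ I_J` on the right hand side of the estimates. -/
theorem tendsto_prod_dist (hI : IsAdmissible I) (hD : D.IsProper) (J : Finset κ) {z : Cn ι}
    (hz : z ∈ D.S) (w : κ → ℤ) :
    Tendsto (fun t : ℝ => ∏ j ∈ Finset.univ.filter (fun j => ¬ I j ⊆ union I J),
        Metric.infDist (scale (union I J) t z) (Z I j) ^ w j) (𝓝[>] 0)
      (𝓝 (∏ j ∈ Finset.univ.filter (fun j => ¬ I j ⊆ union I J),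
        ‖coords (I j) (incl I J (proj I J z))‖ ^ w j)) := by
  refine tendsto_finsetProd _ fun j hj => ?_
  have hj' : ¬ I j ⊆ union I J := by simpa using hj
  have h0 : 0 < ‖coords (I j) (incl I J (proj I J z))‖ := by
    refine lt_of_lt_of_le ?_ (norm_coords_mono (hat_subset j) _)
    rw [incl_proj, coords_scale_of_disjoint (hI.disjoint_hat_union hj')]
    exact hD.norm_coords_hat_pos hz j
  simp only [infDist_Z]
  refine Tendsto.zpow₀ ?_ _ (Or.inl h0.ne')
  exact ((continuous_coords (I j)).norm.tendsto _).comp (tendsto_scale_union J z)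

/-- Distances to `Z_j` with `I j ⊆ I_J` are homogeneous in `t`; the other factors are kept aside
since they have a finite limit. -/
theorem prod_dist_eq (J : Finset κ) (z : Cn ι) (w : κ → ℤ) {t : ℝ} (ht : 0 < t) :
    ∏ j, Metric.infDist (scale (union I J) t z) (Z I j) ^ w j =
      t ^ (∑ j ∈ Finset.univ.filter (fun j => I j ⊆ union I J), w j) *
        (∏ j ∈ Finset.univ.filter (fun j => I j ⊆ union I J), ‖coords (I j) z‖ ^ w j) *
        ∏ j ∈ Finset.univ.filter (fun j => ¬ I j ⊆ union I J),
          Metric.infDist (scale (union I J) t z) (Z I j) ^ w j := by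
  rw [← Finset.prod_filter_mul_prod_filter_not Finset.univ (fun j => I j ⊆ union I J)]
  congr 1
  have h1 : t ^ (∑ j ∈ Finset.univ.filter (fun j => I j ⊆ union I J), w j) =
      ∏ j ∈ Finset.univ.filter (fun j => I j ⊆ union I J), t ^ w j := by
    induction Finset.univ.filter (fun j => I j ⊆ union I J) using Finset.induction_on with
    | empty => simp
    | insert a s ha ih => rw [Finset.sum_insert ha, Finset.prod_insert ha, zpow_add₀ ht.ne', ih]
  rw [h1, ← Finset.prod_mul_distrib]
  refine Finset.prod_congr rfl fun j hj => ?_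
  have hj' : I j ⊆ union I J := by simpa using hj
  rw [infDist_Z, coords_scale_of_subset hj', norm_smul, Real.norm_of_nonneg ht.le, mul_zpow]

/-- The continuous extension of `f` to the closure of `S'` has the values `f_{J,0}` on `S'_J`. -/
theorem IsExpansion.boundary_value (hI : IsAdmissible I)
    (h : IsExpansion D f F) (hD' : D'.IsProper) (hD'D : D'.ProperlyContained D) {u : Cn ι → ℂ}
    (hu : ContinuousOn u (closure D'.S)) (huf : EqOn u f D'.S) (J : Finset κ) (hJ : J.Nonempty) :
    ∀ z ∈ D'.S, u (incl I J (proj I J z)) = F J 0 (proj I J z) := by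
  induction J using Finset.strongInduction with
  | H J ih =>
  intro z hz
  set N : κ → ℕ := fun j => if j ∈ J then 1 else 0 with hN
  obtain ⟨C, hC, hbound⟩ := h.developable D' hD' hD'D N
  set w := incl I J (proj I J z) with hw
  set zt : ℝ → Cn ι := fun t => scale (union I J) t z with hzt
  have hztS : ∀ᶠ t in 𝓝[>] 0, zt t ∈ D'.S := hD'.eventually_scale_mem_S hI J hz
  -- Projecting to `Z_K` with `K ⊆ J` does not change the limit point, and `u` is continuous on the
  -- closure.
  have hlim : ∀ K : Finset κ, K ⊆ J →
      Tendsto (fun t => u (incl I K (proj I K (zt t)))) (𝓝[>] 0) (𝓝 (u w)) := by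
    intro K hK
    have h1 := tendsto_incl_proj_scale (I := I) J K z
    rw [Finset.union_eq_left.2 hK] at h1
    refine (hu w (hD'.incl_proj_mem_closure hI J hz)).tendsto.comp
      (tendsto_nhdsWithin_iff.2 ⟨h1, ?_⟩)
    filter_upwards [hztS] with t ht using hD'.incl_proj_mem_closure hI K ht
  have hlimf : Tendsto (fun t => f (zt t)) (𝓝[>] 0) (𝓝 (u w)) := by
    have h1 : Tendsto (fun t => u (zt t)) (𝓝[>] 0) (𝓝 (u w)) := by
      refine (hu w (hD'.incl_proj_mem_closure hI J hz)).tendsto.comp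
        (tendsto_nhdsWithin_iff.2 ⟨tendsto_scale_union J z, ?_⟩)
      filter_upwards [hztS] with t ht using subset_closure ht
    refine h1.congr' ?_
    filter_upwards [hztS] with t ht using huf ht
  -- The term `K = J` is constant in `t`; for smaller `K` the coefficients are values of `u` by
  -- induction.
  have hlimapp : Tendsto (fun t => app I F N (zt t)) (𝓝[>] 0)
      (𝓝 (∑ K ∈ Finset.univ.filter (fun K : Finset κ => K.Nonempty),
        (-1) ^ (K.card + 1) *
          if K ⊆ J then (if K = J then F J 0 (proj I J z) else u w) else 0)) := by
    refine tendsto_finsetSum _ fun K hK => Tendsto.const_mul _ ?_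
    have hK' : K.Nonempty := by simpa using hK
    simp only [hN, taylor_indicator F J]
    by_cases hKJ : K ⊆ J
    · simp only [hKJ, if_true]
      by_cases hKeq : K = J
      · subst hKeq
        simp only [if_true, hzt, proj_scale subset_rfl]
        exact tendsto_const_nhds
      · simp only [hKeq, if_false]
        refine (hlim K hKJ).congr' ?_
        filter_upwards [hztS] with t ht
        exact ih K (hKJ.ssubset_of_ne hKeq) hK' (zt t) ht
    · simp only [hKJ, if_false]
      exact tendsto_const_nhds
  have hrhs : Tendsto (fun t => C * ∏ j, Metric.infDist (zt t) (Z I j) ^ weight I N j)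
      (𝓝[>] 0) (𝓝 0) := by
    have hs := hI.one_le_sum_weight hJ
    set s := ∑ j ∈ Finset.univ.filter (fun j => I j ⊆ union I J), weight I N j with hsdef
    have h1 : Tendsto (fun t : ℝ => t ^ s) (𝓝[>] 0) (𝓝 0) := by
      have hs0 : s ≠ 0 := by
        have : 1 ≤ s := hs
        omega
      have h2 : ContinuousAt (fun t : ℝ => t ^ s) 0 :=
        -- The total exponent of `t` is at least 1, so the bound tends to zero even if single
        -- weights are negative.
        continuousAt_zpow₀ _ _ (Or.inr (by have : 1 ≤ s := hs; omega))
      have h3 := h2.tendsto.mono_left (nhdsWithin_le_nhds (s := Ioi 0))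
      rwa [zero_zpow _ hs0] at h3
    have h2 := ((h1.mul_const (∏ j ∈ Finset.univ.filter (fun j => I j ⊆ union I J),
      ‖coords (I j) z‖ ^ weight I N j)).mul
        (tendsto_prod_dist hI hD' J hz (weight I N))).const_mul C
    rw [zero_mul, zero_mul, mul_zero] at h2
    refine h2.congr' ?_
    filter_upwards [self_mem_nhdsWithin] with t ht
    rw [prod_dist_eq J z (weight I N) ht]
  have hle : ‖u w - ∑ K ∈ Finset.univ.filter (fun K : Finset κ => K.Nonempty),
      (-1) ^ (K.card + 1) *
        (if K ⊆ J then (if K = J then F J 0 (proj I J z) else u w) else 0)‖ ≤ 0 := by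
    refine le_of_tendsto_of_tendsto (hlimf.sub hlimapp).norm hrhs ?_
    filter_upwards [hztS] with t ht using hbound _ ht
  have hzero := norm_le_zero_iff.1 hle
  -- If the term of `J` were `u w` as well, the sum would be `u w` by inclusion-exclusion; only the
  -- deviation in that term remains.
  have hsplit : ∑ K ∈ Finset.univ.filter (fun K : Finset κ => K.Nonempty),
      (-1 : ℂ) ^ (K.card + 1) *
        (if K ⊆ J then (if K = J then F J 0 (proj I J z) else u w) else 0) =
      u w + (-1) ^ (J.card + 1) * (F J 0 (proj I J z) - u w) := by
    have h1 : ∀ K : Finset κ, (-1 : ℂ) ^ (K.card + 1) *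
        (if K ⊆ J then (if K = J then F J 0 (proj I J z) else u w) else 0) =
        u w * ((-1 : ℂ) ^ (K.card + 1) * (if K ⊆ J then 1 else 0)) +
        if K = J then (-1 : ℂ) ^ (J.card + 1) * (F J 0 (proj I J z) - u w) else 0 := by
      intro K
      by_cases hK : K = J
      · subst hK
        simp only [subset_rfl, if_true]
        ring
      · by_cases hKJ : K ⊆ J
        · simp only [hK, hKJ, if_true, if_false]
          ring
        · simp [hK, hKJ]
    simp only [h1]
    rw [Finset.sum_add_distrib, ← Finset.mul_sum, sum_nonempty_subsets J hJ, mul_one,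
      Finset.sum_ite_eq' _ J]
    simp [hJ]
  rw [hsplit, sub_add_cancel_left, neg_eq_zero, mul_eq_zero] at hzero
  rcases hzero with h1 | h1
  · exact absurd h1 (pow_ne_zero _ (by norm_num))
  · exact (sub_eq_zero.1 h1).symm

end BoundaryValues

/-! ### Identification of coordinate spaces of `Z_J` with those of the ambient space. -/

section Transport

variable {ι : Type*} [Fintype ι] [DecidableEq ι] {A B : Finset ι} {A' : Finset ↥B}

/-- The identification `ℂ^{A'} → ℂ^A` of coordinate spaces for `A' ⊆ B ⊆ ι` and `A ⊆ ι` with the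
same elements. -/
def upL (A : Finset ι) (A' : Finset ↥B) : Cn A' →L[ℂ] Cn A :=
  (coordsL A).comp ((extendL B).comp (extendL A'))

/-- The inverse of `upL`. -/
def downL (A : Finset ι) (A' : Finset ↥B) : Cn A →L[ℂ] Cn A' :=
  (coordsL A').comp ((coordsL B).comp (extendL A))

theorem upL_apply (v : Cn A') : upL A A' v = coords A (extend B (extend A' v)) := rfl

theorem downL_apply (w : Cn A) : downL A A' w = coords A' (coords B (extend A w)) := rfl

theorem norm_upL_le (v : Cn A') : ‖upL A A' v‖ ≤ ‖v‖ := by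
  rw [upL_apply]
  exact (norm_coords_le _ _).trans_eq (by rw [norm_extend, norm_extend])

theorem norm_downL_le (w : Cn A) : ‖downL A A' w‖ ≤ ‖w‖ := by
  rw [downL_apply]
  exact (norm_coords_le _ _).trans ((norm_coords_le _ _).trans_eq (norm_extend _ _))

section

variable (hA : ∀ i : ↥B, i ∈ A' ↔ i.1 ∈ A)

include hA

theorem downL_coords (z : Cn ι) : downL A A' (coords A z) = coords A' (coords B z) := by
  ext i
  rw [downL_apply, coords_apply, coords_apply, coords_apply, coords_apply,
    extend_apply_mem _ ((hA i.1).1 i.2), coords_apply]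

theorem downL_upL (v : Cn A') : downL A A' (upL A A' v) = v := by
  rw [upL_apply, downL_coords hA, coords_extend, coords_extend]

variable (hAB : A ⊆ B)

include hAB

theorem upL_coords (v : Cn B) : upL A A' (coords A' v) = coords A (extend B v) := by
  rw [upL_apply]
  refine coords_eq_iff.2 fun i hi => ?_
  rw [extend_apply_mem _ (hAB hi), extend_apply_mem _ (hAB hi),
    extend_apply_mem _ ((hA ⟨i, hAB hi⟩).2 hi), coords_apply]

theorem upL_downL (w : Cn A) : upL A A' (downL A A' w) = w := by
  rw [downL_apply, upL_coords hA hAB]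
  ext i
  rw [coords_apply, extend_apply_mem _ (hAB i.2), coords_apply, extend_apply_mem _ i.2]

/-- The two identifications are inverse to each other and neither increases the norm. -/
theorem norm_coords_transport (v : Cn B) : ‖coords A' v‖ = ‖coords A (extend B v)‖ := by
  refine le_antisymm ?_ ?_
  · conv_lhs => rw [← downL_upL hA (coords A' v)]
    rw [upL_coords hA hAB]
    exact norm_downL_le _
  · rw [← upL_coords hA hAB]
    exact norm_upL_le _

end

end Transport

/-! ### The induced family and multi-cone in `Z_J`. -/

section Star

variable {ι κ : Type*} [Fintype ι] [DecidableEq ι] [Fintype κ] [DecidableEq κ]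
  {I : κ → Finset ι} {D D' : ConeData I} {f : Cn ι → ℂ} {F : Family I} {J : Finset κ}

theorem mem_starFamily {j : StarIndex I J} {i : ↥(union I J)ᶜ} :
    i ∈ starFamily I J j ↔ i.1 ∈ I j.1 := by
  simp [starFamily]

section Combinatorics

variable (hI : IsAdmissible I)

include hI

theorem IsAdmissible.exists_starFamily_mem_hat (j : StarIndex I J) :
    ∃ i : ↥(union I J)ᶜ, i.1 ∈ hat I j.1 := by
  obtain ⟨i, hi⟩ := hI.hat_nonempty j.1
  exact ⟨⟨i, Finset.mem_compl.2 (Finset.disjoint_left.1 (hI.disjoint_hat_union j.2) hi)⟩, hi⟩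

/-- For `k ∈ J^*` the points of `hat I k` survive the removal of `I_J`, and a single one of them
detects all members containing `I k`. -/
theorem IsAdmissible.starFamily_ssubset {j k : StarIndex I J} :
    starFamily I J k ⊂ starFamily I J j ↔ I k.1 ⊂ I j.1 := by
  have hsub : ∀ {j k : StarIndex I J}, starFamily I J k ⊆ starFamily I J j → I k.1 ⊆ I j.1 := by
    intro j k h
    obtain ⟨i, hi⟩ := hI.exists_starFamily_mem_hat k
    exact hI.subset_of_mem_hat hi (mem_starFamily.1 (h (mem_starFamily.2 (hat_subset _ hi))))
  have hsub' : ∀ {j k : StarIndex I J}, I k.1 ⊆ I j.1 → starFamily I J k ⊆ starFamily I J j :=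
    fun h i hi => mem_starFamily.2 (h (mem_starFamily.1 hi))
  constructor
  · intro h
    exact ⟨hsub h.1, fun h' => h.2 (hsub' h')⟩
  · intro h
    exact ⟨hsub' h.1, fun h' => h.2 (hsub h')⟩

/-- The members that are lost in `Z_J` lie in `I_J` and contain none of the remaining coordinates.
-/
theorem IsAdmissible.mem_hat_starFamily {j : StarIndex I J} {i : ↥(union I J)ᶜ} :
    i ∈ hat (starFamily I J) j ↔ i.1 ∈ hat I j.1 := by
  rw [mem_hat, mem_hat, mem_starFamily]
  refine and_congr_right fun _ => ⟨fun h k hk hik => ?_, fun h k hk hik => ?_⟩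
  · have hk' : ¬ I k ⊆ union I J := fun h' => Finset.mem_compl.1 i.2 (h' hik)
    exact h ⟨k, hk'⟩ (hI.starFamily_ssubset.2 hk) (mem_starFamily.2 hik)
  · exact h k.1 (hI.starFamily_ssubset.1 hk) (mem_starFamily.1 hik)

omit hI in
theorem mem_free_starFamily {i : ↥(union I J)ᶜ} :
    i ∈ free (starFamily I J) ↔ i.1 ∈ free I := by
  rw [mem_free, mem_free]
  refine ⟨fun h j hij => ?_, fun h j hij => h j.1 (mem_starFamily.1 hij)⟩
  have hj : ¬ I j ⊆ union I J := fun h' => Finset.mem_compl.1 i.2 (h' hij)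
  exact h ⟨j, hj⟩ (mem_starFamily.2 hij)

omit hI in
theorem free_subset_compl : free I ⊆ (union I J)ᶜ := fun _ hi =>
  Finset.mem_compl.2 (Finset.disjoint_left.1 (disjoint_free_union J) hi)

theorem IsAdmissible.hat_subset_compl (j : StarIndex I J) : hat I j.1 ⊆ (union I J)ᶜ :=
  fun _ hi => Finset.mem_compl.2 (Finset.disjoint_left.1 (hI.disjoint_hat_union j.2) hi)

theorem IsAdmissible.starFamily : IsAdmissible (starFamily I J) where
  nested j k hjk := by
    rcases hI.nested j.1 k.1 (fun h => hjk (Subtype.ext h)) with h | h | h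
    · exact Or.inl (hI.starFamily_ssubset.2 h)
    · exact Or.inr (Or.inl (hI.starFamily_ssubset.2 h))
    · refine Or.inr (Or.inr (Finset.disjoint_left.2 fun i hi hi' => ?_))
      exact Finset.disjoint_left.1 h (mem_starFamily.1 hi) (mem_starFamily.1 hi')
  strict j := by
    refine ⟨fun i hi => ?_, fun h => ?_⟩
    · obtain ⟨k, hk, hik⟩ := Finset.mem_biUnion.1 hi
      exact (Finset.mem_filter.1 hk).2.subset hik
    · obtain ⟨i, hi⟩ := hI.exists_starFamily_mem_hat j
      obtain ⟨k, hk, hik⟩ := Finset.mem_biUnion.1 (h (mem_starFamily.2 (hat_subset _ hi)))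
      exact (mem_hat.1 hi).2 k.1 (hI.starFamily_ssubset.1 (Finset.mem_filter.1 hk).2)
        (mem_starFamily.1 hik)

/-- Extension of exponents by zero from `J^*` to all indices. -/
def extendExponent (I : κ → Finset ι) (J : Finset κ) (N : StarIndex I J → ℕ) (k : κ) : ℕ :=
  if h : ¬ I k ⊆ union I J then N ⟨k, h⟩ else 0

omit hI in
theorem extendExponent_coe (N : StarIndex I J → ℕ) (j : StarIndex I J) :
    extendExponent I J N j.1 = N j := by
  simp [extendExponent, j.2]

omit hI in
theorem extendExponent_of_subset (N : StarIndex I J → ℕ) {k : κ} (h : I k ⊆ union I J) :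
    extendExponent I J N k = 0 := by
  simp [extendExponent, h]

omit hI in
theorem weight_extendExponent_of_subset (N : StarIndex I J → ℕ) {j : κ} (h : I j ⊆ union I J) :
    weight I (extendExponent I J N) j = 0 := by
  rw [weight_eq, extendExponent_of_subset N h, Finset.sum_eq_zero]
  · simp
  · intro k hk
    rw [extendExponent_of_subset N ((mem_children.1 hk).1.subset.trans h)]
    simp

/-- Children of `j` outside `J^*` carry the exponent zero. The others are children in both families,
because everything above an index of `J^*` belongs to `J^*`. -/
theorem IsAdmissible.weight_starFamily (N : StarIndex I J → ℕ) (j : StarIndex I J) :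
    weight (MultiAsymp.starFamily I J) N j = weight I (extendExponent I J N) j.1 := by
  rw [weight_eq, weight_eq, extendExponent_coe]
  congr 1
  refine Finset.sum_of_injOn Subtype.val Subtype.val_injective.injOn ?_ ?_ ?_
  · intro k hk
    have hk' := mem_children.1 (Finset.mem_coe.1 hk)
    refine Finset.mem_coe.2 (mem_children.2 ⟨hI.starFamily_ssubset.1 hk'.1, fun m hm => ?_⟩)
    have hmJ : ¬ I m ⊆ union I J := fun h => k.2 (hm.1.subset.trans h)
    exact hk'.2 ⟨m, hmJ⟩ ⟨hI.starFamily_ssubset.2 hm.1, hI.starFamily_ssubset.2 hm.2⟩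
  · intro k hk hnk
    have hkJ : I k ⊆ union I J := by
      by_contra hkJ
      have hk' := mem_children.1 hk
      refine hnk ⟨⟨k, hkJ⟩, Finset.mem_coe.2 (mem_children.2
        ⟨hI.starFamily_ssubset.2 hk'.1, fun m hm => ?_⟩), rfl⟩
      exact hk'.2 m.1 ⟨hI.starFamily_ssubset.1 hm.1, hI.starFamily_ssubset.1 hm.2⟩
    rw [extendExponent_of_subset N hkJ]
    simp
  · intro k _
    rw [extendExponent_coe]

end Combinatorics

section StarGeometry

variable (hI : IsAdmissible I)

include hI

theorem IsAdmissible.norm_coords_hat_star (j : StarIndex I J) (w : ZSpace I J) :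
    ‖coords (hat (MultiAsymp.starFamily I J) j) w‖ = ‖coords (hat I j.1) (incl I J w)‖ :=
  norm_coords_transport (fun _ => hI.mem_hat_starFamily) (hI.hat_subset_compl j) w

theorem ConeData.IsProper.star (hD : D.IsProper) : (D.star J).IsProper where
  r_pos j := hD.r_pos j.1
  W_open := hD.W_open.preimage (upL (free I) (free (starFamily I J))).continuous
  W_convex := hD.W_convex.linear_preimage
    ((upL (free I) (free (starFamily I J))).restrictScalars ℝ).toLinearMap
  W_nonempty := by
    obtain ⟨w, hw⟩ := hD.W_nonempty
    refine ⟨downL (free I) (free (starFamily I J)) w, ?_⟩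
    change upL (free I) (free (starFamily I J)) _ ∈ D.W
    rwa [upL_downL (fun _ => mem_free_starFamily) free_subset_compl]
  G_open j := (hD.G_open j.1).preimage (upL (hat I j.1) (hat (starFamily I J) j)).continuous
  G_convex j := (hD.G_convex j.1).linear_preimage
    ((upL (hat I j.1) (hat (starFamily I J) j)).restrictScalars ℝ).toLinearMap
  G_nonempty j := by
    obtain ⟨w, hw⟩ := hD.G_nonempty j.1
    refine ⟨downL (hat I j.1) (hat (starFamily I J) j) w, ?_⟩
    change upL (hat I j.1) (hat (starFamily I J) j) _ ∈ D.G j.1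
    rwa [upL_downL (fun _ => hI.mem_hat_starFamily) (hI.hat_subset_compl j)]
  G_cone j t ht v hv := by
    have h := hD.G_cone j.1 t ht _ hv
    change upL (hat I j.1) (hat (starFamily I J) j) (t • v) ∈ D.G j.1
    rw [ContinuousLinearMap.map_smul_of_tower]
    exact h
  G_proper j v hv hv' := by
    refine hD.G_proper j.1 _ hv ?_
    change upL (hat I j.1) (hat (starFamily I J) j) (-v) ∈ D.G j.1 at hv'
    rw [map_neg] at hv'
    exact hv'
  ε_pos := hD.ε_pos

/-- `S_J` is the multi-cone with the data `D.star J`. -/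
theorem ConeData.IsProper.star_S (hD : D.IsProper) : (D.star J).S = proj I J '' D.S := by
  have hG : ∀ (w : ZSpace I J) (j : StarIndex I J), coords (hat (starFamily I J) j) w ∈
      (D.star J).G j ↔ coords (hat I j.1) (incl I J w) ∈ D.G j.1 := fun w j => by
    change upL (hat I j.1) (hat (starFamily I J) j) _ ∈ D.G j.1 ↔ _
    rw [upL_coords (fun _ => hI.mem_hat_starFamily) (hI.hat_subset_compl j)]
    rfl
  have hW : ∀ w : ZSpace I J, coords (free (starFamily I J)) w ∈ (D.star J).W ↔
      coords (free I) (incl I J w) ∈ D.W := fun w => by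
    change upL (free I) (free (starFamily I J)) _ ∈ D.W ↔ _
    rw [upL_coords (fun _ => mem_free_starFamily) free_subset_compl]
    rfl
  ext w
  rw [mem_S]
  simp only [hG, hW, hI.norm_coords_hat_star, hI.starFamily_ssubset]
  constructor
  · rintro ⟨h1, h2, h3, h4⟩
    obtain ⟨z, hz, hzw⟩ := hD.exists_lift hI J (incl I J w) (fun k hk => h1 ⟨k, hk⟩)
      (fun k hk => h3 ⟨k, hk⟩) (fun j k hkj hk =>
        h4 ⟨j, fun h => hk (hkj.subset.trans h)⟩ ⟨k, hk⟩ hkj) h2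
    exact ⟨z, hz, hzw.trans (proj_incl J w)⟩
  · rintro ⟨z, hz, rfl⟩
    have hz' := mem_S.1 hz
    have hc : ∀ j : StarIndex I J, coords (hat I j.1) (incl I J (proj I J z)) =
        coords (hat I j.1) z := fun j => by
      rw [incl_proj, coords_scale_of_disjoint (hI.disjoint_hat_union j.2)]
    simp only [hc]
    refine ⟨fun j => hz'.1 j.1, ?_, fun j => hz'.2.2.1 j.1, fun j k hkj => hz'.2.2.2 j.1 k.1 hkj⟩
    rw [incl_proj, coords_scale_of_disjoint (disjoint_free_union J)]
    exact hz'.2.1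

/-- A multi-cone properly contained in `S_J` is covered by the projection of a multi-cone properly
contained in `S`. -/
theorem ConeData.ProperlyContained.exists_cover_of_star (hD : D.IsProper)
    {E : ConeData (starFamily I J)} (hE : E.IsProper) (h : E.ProperlyContained (D.star J)) :
    ∃ D' : ConeData I, D'.IsProper ∧ D'.ProperlyContained D ∧ E.S ⊆ proj I J '' D'.S := by
  have hsub : ∀ j, ∃ G : Set (Cn ↥(hat I j)), IsProperCone G ∧ closure G \ {0} ⊆ D.G j := by
    intro j
    obtain ⟨x, hx⟩ := hD.G_nonempty j
    obtain ⟨G, hG, _, hGD⟩ := (hD.isProperCone j).exists_subcone hx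
    exact ⟨G, hG, hGD⟩
  -- For `j ∈ J^*` the cones are those of `E`, transported; for the other indices any cone with
  -- closure inside `D.G j` will do.
  have hcone : ∀ j, ∃ G : Set (Cn ↥(hat I j)), IsProperCone G ∧ closure G \ {0} ⊆ D.G j ∧
      ∀ hj : ¬ I j ⊆ union I J, G =
        downL (hat I j) (hat (starFamily I J) ⟨j, hj⟩) ⁻¹' E.G ⟨j, hj⟩ := by
    intro j
    by_cases hj : I j ⊆ union I J
    · obtain ⟨G, hG, hGD⟩ := hsub j
      exact ⟨G, hG, hGD, fun hj' => absurd hj hj'⟩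
    · set T := downL (hat I j) (hat (starFamily I J) ⟨j, hj⟩) with hT
      have hTinv : ∀ w, upL (hat I j) (hat (starFamily I J) ⟨j, hj⟩) (T w) = w :=
        upL_downL (fun _ => hI.mem_hat_starFamily) (hI.hat_subset_compl ⟨j, hj⟩)
      refine ⟨T ⁻¹' E.G ⟨j, hj⟩, ⟨(hE.G_open _).preimage T.continuous,
        (hE.G_convex _).linear_preimage (T.restrictScalars ℝ).toLinearMap, ?_, ?_, ?_⟩, ?_,
        fun _ => rfl⟩
      · obtain ⟨v, hv⟩ := hE.G_nonempty ⟨j, hj⟩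
        refine ⟨upL (hat I j) (hat (starFamily I J) ⟨j, hj⟩) v, ?_⟩
        rwa [mem_preimage, hT, downL_upL (A' := hat (starFamily I J) ⟨j, hj⟩)
          fun _ => hI.mem_hat_starFamily]
      · intro t ht v hv
        rw [mem_preimage, ContinuousLinearMap.map_smul_of_tower]
        exact hE.G_cone _ t ht _ hv
      · intro v hv hv'
        rw [mem_preimage, map_neg] at hv'
        exact hE.G_proper _ _ hv hv'
      · rintro v ⟨hv, hv0 : v ≠ 0⟩
        have h1 : T v ∈ closure (E.G ⟨j, hj⟩) := map_mem_closure T.continuous hv fun _ hw => hw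
        have h2 : T v ≠ 0 := fun h0 => hv0 (by rw [← hTinv v, h0, map_zero])
        have h3 := h.G_subset ⟨j, hj⟩ ⟨h1, h2⟩
        change upL (hat I j) (hat (starFamily I J) ⟨j, hj⟩) (T v) ∈ D.G j at h3
        rwa [hTinv] at h3
  choose G hG hGD hGE using hcone
  set T := downL (free I) (free (starFamily I J)) with hT
  have hTinv : ∀ w, upL (free I) (free (starFamily I J)) (T w) = w :=
    upL_downL (fun _ => mem_free_starFamily) free_subset_compl
  have hWcl : closure (T ⁻¹' E.W) ⊆ upL (free I) (free (starFamily I J)) '' closure E.W :=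
    fun v hv => ⟨T v, map_mem_closure T.continuous hv fun _ hw => hw, hTinv v⟩
  -- The radii outside `J^*` are arbitrary below those of `D`, since the lift can be taken with
  -- small components there.
  set r : κ → ℝ := fun j => if hj : ¬ I j ⊆ union I J then E.r ⟨j, hj⟩ else D.r j / 2 with hr
  have hr1 : ∀ j (hj : ¬ I j ⊆ union I J), r j = E.r ⟨j, hj⟩ := fun j hj => by simp [hr, hj]
  have hr2 : ∀ j, I j ⊆ union I J → r j = D.r j / 2 := fun j hj => by simp [hr, hj]
  have hproper : (⟨r, T ⁻¹' E.W, G, E.ε⟩ : ConeData I).IsProper := by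
    refine ⟨fun j => ?_, hE.W_open.preimage T.continuous,
      hE.W_convex.linear_preimage (T.restrictScalars ℝ).toLinearMap, ?_, fun j => (hG j).isOpen,
      fun j => (hG j).convex, fun j => (hG j).nonempty, fun j => (hG j).isCone,
      fun j => (hG j).proper, hE.ε_pos⟩
    · change 0 < r j
      by_cases hj : I j ⊆ union I J
      · rw [hr2 j hj]
        exact half_pos (hD.r_pos j)
      · rw [hr1 j hj]
        exact hE.r_pos _
    · obtain ⟨v, hv⟩ := hE.W_nonempty
      refine ⟨upL (free I) (free (starFamily I J)) v, ?_⟩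
      change T _ ∈ E.W
      rwa [hT, downL_upL fun _ => mem_free_starFamily]
  refine ⟨⟨r, T ⁻¹' E.W, G, E.ε⟩, hproper,
    properlyContained_of h.ε_lt (fun j => ?_) ?_ ?_ hGD, fun w hw => ?_⟩
  · change r j < D.r j
    by_cases hj : I j ⊆ union I J
    · rw [hr2 j hj]
      exact half_lt_self (hD.r_pos j)
    · rw [hr1 j hj]
      exact h.r_lt hI.starFamily hE ⟨j, hj⟩
  · exact ((h.isCompact_closure_W hE).image
      (upL (free I) (free (starFamily I J))).continuous).of_isClosed_subset isClosed_closure hWcl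
  · intro v hv
    obtain ⟨x, hx, rfl⟩ := hWcl hv
    exact h.closure_W_subset hE hx
  · have hw' := mem_S.1 hw
    suffices hl : ∃ z ∈ (⟨r, T ⁻¹' E.W, G, E.ε⟩ : ConeData I).S,
        proj I J z = proj I J (incl I J w) by
      obtain ⟨z, hz, hzw⟩ := hl
      exact ⟨z, hz, hzw.trans (proj_incl J w)⟩
    refine hproper.exists_lift hI J (incl I J w) (fun k hk => ?_) (fun k hk => ?_)
      (fun j k hkj hk => ?_) ?_
    · change _ < r k
      rw [hr1 k hk, ← hI.norm_coords_hat_star ⟨k, hk⟩]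
      exact hw'.1 ⟨k, hk⟩
    · change _ ∈ G k
      rw [hGE k hk, mem_preimage, downL_coords (A' := hat (starFamily I J) ⟨k, hk⟩)
        fun _ => hI.mem_hat_starFamily]
      have : coords (union I J)ᶜ (incl I J w) = w := proj_incl J w
      rw [this]
      exact hw'.2.2.1 ⟨k, hk⟩
    · have hj : ¬ I j ⊆ union I J := fun h' => hk (hkj.subset.trans h')
      rw [← hI.norm_coords_hat_star ⟨k, hk⟩, ← hI.norm_coords_hat_star ⟨j, hj⟩]
      exact hw'.2.2.2 ⟨j, hj⟩ ⟨k, hk⟩ (hI.starFamily_ssubset.2 hkj)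
    · change T _ ∈ E.W
      rw [hT, downL_coords fun _ => mem_free_starFamily]
      have : coords (union I J)ᶜ (incl I J w) = w := proj_incl J w
      rw [this]
      exact hw'.2.1

end StarGeometry

end Star

/-! ### The expansion of the coefficients on `S_J`. -/

section StarExpansion

variable {ι κ : Type*} [Fintype ι] [DecidableEq ι] [Fintype κ] [DecidableEq κ]
  {I : κ → Finset ι} {D D' : ConeData I} {f : Cn ι → ℂ} {F : Family I} {J : Finset κ}

/-- The index set in the family `I` of a set of indices of the family `starFamily I J`. -/
def unstar (K : Finset (StarIndex I J)) : Finset κ := K.map (Function.Embedding.subtype _)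

theorem mem_unstar {K : Finset (StarIndex I J)} {k : κ} :
    k ∈ unstar K ↔ ∃ h : ¬ I k ⊆ union I J, (⟨k, h⟩ : StarIndex I J) ∈ K := by
  simp [unstar]

theorem coe_mem_unstar {K : Finset (StarIndex I J)} {k : StarIndex I J} :
    k.1 ∈ unstar K ↔ k ∈ K := by
  rw [mem_unstar]
  exact ⟨fun ⟨_, h⟩ => h, fun h => ⟨k.2, h⟩⟩

theorem card_unstar (K : Finset (StarIndex I J)) : (unstar K).card = K.card :=
  Finset.card_map _

theorem mem_union_starFamily {K : Finset (StarIndex I J)} {i : ↥(union I J)ᶜ} :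
    i ∈ union (starFamily I J) K ↔ i.1 ∈ union I (unstar K) := by
  rw [mem_union, mem_union]
  constructor
  · rintro ⟨k, hk, hi⟩
    exact ⟨k.1, coe_mem_unstar.2 hk, mem_starFamily.1 hi⟩
  · rintro ⟨k, hk, hi⟩
    obtain ⟨h, hk'⟩ := mem_unstar.1 hk
    exact ⟨⟨k, h⟩, hk', mem_starFamily.2 hi⟩

/-- A multi-index for `Z_K ∩ Z_J` in `Z_J` as a multi-index on `ι`. -/
def fullIndex (K : Finset (StarIndex I J)) (β : ↥(union (starFamily I J) K) → ℕ) : ι → ℕ :=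
  extendIndex (union I J)ᶜ (extendIndex (union (starFamily I J) K) β)

theorem fullIndex_coe {K : Finset (StarIndex I J)} (β : ↥(union (starFamily I J) K) → ℕ)
    (i : ↥(union (starFamily I J) K)) : fullIndex K β i.1.1 = β i := by
  rw [fullIndex, extendIndex_coe, extendIndex_coe]

theorem fullIndex_of_mem {K : Finset (StarIndex I J)} (β : ↥(union (starFamily I J) K) → ℕ)
    {i : ι} (hi : i ∈ union I J) : fullIndex K β i = 0 :=
  extendIndex_apply_notMem _ (by simpa using hi)

theorem fullIndex_of_notMem {K : Finset (StarIndex I J)} (β : ↥(union (starFamily I J) K) → ℕ)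
    {i : ι} (hi : i ∉ union I (unstar K)) : fullIndex K β i = 0 := by
  by_cases hJ : i ∈ union I J
  · exact fullIndex_of_mem β hJ
  · rw [fullIndex, extendIndex_apply_mem _ (Finset.mem_compl.2 hJ), extendIndex_apply_notMem]
    exact fun h => hi (mem_union_starFamily.1 h)

theorem fullIndex_injective (K : Finset (StarIndex I J)) :
    Function.Injective (fullIndex K) := by
  intro β β' h
  funext i
  rw [← fullIndex_coe β, ← fullIndex_coe β', h]

/-- The family of coefficients of `f_{J,0}` on `S_J`. -/
def starCoefficients (F : Family I) (J : Finset κ) : Family (starFamily I J) := fun K β v =>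
  F (J ∪ unstar K) (fun i => fullIndex K β i.1)
    (proj I (J ∪ unstar K) (incl I J (incl (starFamily I J) K v)))

theorem proj_union_incl_incl (K : Finset (StarIndex I J)) (z : Cn ι) :
    proj I (J ∪ unstar K) (incl I J (incl (starFamily I J) K
      (proj (starFamily I J) K (proj I J z)))) = proj I (J ∪ unstar K) z := by
  refine coords_eq_iff.2 fun i hi => ?_
  rw [union_union, Finset.mem_compl, Finset.mem_union, not_or] at hi
  have h1 : i ∈ (union I J)ᶜ := Finset.mem_compl.2 hi.1
  have h2 : (⟨i, h1⟩ : ↥(union I J)ᶜ) ∈ (union (starFamily I J) K)ᶜ :=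
    Finset.mem_compl.2 fun h => hi.2 (mem_union_starFamily.1 h)
  rw [incl, extend_apply_mem _ h1, incl, extend_apply_mem _ h2]
  rfl

theorem starCoefficients_isCoefficientFamily (hI : IsAdmissible I) (hD : D.IsProper)
    (hJ : J.Nonempty) (hF : D.IsCoefficientFamily F) :
    (D.star J).IsCoefficientFamily (starCoefficients F J) := by
  intro K _ β v hv
  rw [(hD.star hI).SJ_eq hI.starFamily, hD.star_S hI] at hv
  obtain ⟨_, ⟨z, hz, rfl⟩, rfl⟩ := hv
  set T : ZSpace (starFamily I J) K →L[ℂ] ZSpace I (J ∪ unstar K) :=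
    (coordsL (union I (J ∪ unstar K))ᶜ).comp ((extendL (union I J)ᶜ).comp
      (extendL (union (starFamily I J) K)ᶜ)) with hT
  have hmem : T (proj (starFamily I J) K (proj I J z)) ∈ D.SJ (J ∪ unstar K) := by
    change proj I (J ∪ unstar K) (incl I J (incl (starFamily I J) K _)) ∈ _
    rw [proj_union_incl_incl]
    exact hD.proj_mem_SJ hI _ hz
  exact (hF (J ∪ unstar K) (hJ.mono Finset.subset_union_left) _ _ hmem).comp (T.analyticAt _)

theorem sum_filter_extendIndex {A : Finset ι} (a : A → ℕ) (p : ι → Prop) [DecidablePred p] :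
    ∑ i ∈ Finset.univ.filter (fun i : A => p i.1), a i =
      ∑ i ∈ Finset.univ.filter p, extendIndex A a i := by
  rw [Finset.sum_filter, Finset.sum_filter]
  have h1 := Finset.sum_subset (Finset.subset_univ A)
    (f := fun i => if p i then extendIndex A a i else 0) fun i _ hi => by
      rw [extendIndex_apply_notMem a hi, ite_self]
  rw [← h1, ← Finset.sum_coe_sort A]
  simp only [extendIndex_coe]

theorem extendIndex_restrict {A : Finset ι} {γ : ι → ℕ} (h : ∀ i, i ∉ A → γ i = 0) :
    extendIndex A (fun i => γ i.1) = γ := by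
  funext i
  by_cases hi : i ∈ A
  · rw [extendIndex_apply_mem _ hi]
  · rw [extendIndex_apply_notMem _ hi, h i hi]

theorem restrict_fullIndex_mem_indexSet {K : Finset (StarIndex I J)} {N : StarIndex I J → ℕ}
    {β : ↥(union (starFamily I J) K) → ℕ} :
    (fun i : ↥(union I (unstar K)) => fullIndex K β i.1) ∈
      indexSet I (unstar K) (extendExponent I J N) ↔ β ∈ indexSet (starFamily I J) K N := by
  have key : ∀ k : StarIndex I J,
      ∑ i ∈ Finset.univ.filter (fun i : ↥(union I (unstar K)) => i.1 ∈ I k.1),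
        fullIndex K β i.1 =
      ∑ i ∈ Finset.univ.filter
        (fun i : ↥(union (starFamily I J) K) => i.1 ∈ starFamily I J k), β i := by
    intro k
    rw [sum_filter_extendIndex (fun i : ↥(union I (unstar K)) => fullIndex K β i.1)
      (fun i => i ∈ I k.1), extendIndex_restrict fun i hi => fullIndex_of_notMem β hi,
      sum_filter_extendIndex β (fun i => i ∈ starFamily I J k)]
    simp only [mem_starFamily]
    rw [sum_filter_extendIndex (extendIndex (union (starFamily I J) K) β) (fun i => i ∈ I k.1)]
    rfl
  rw [mem_indexSet, mem_indexSet]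
  constructor
  · intro h k hk
    have h1 := h k.1 (coe_mem_unstar.2 hk)
    rw [extendExponent_coe] at h1
    rwa [← key k]
  · intro h k hk
    obtain ⟨hkJ, hk'⟩ := mem_unstar.1 hk
    have h1 := h ⟨k, hkJ⟩ hk'
    rw [← key ⟨k, hkJ⟩] at h1
    rw [extendExponent_coe (J := J) N ⟨k, hkJ⟩]
    exact h1

/-- The limits of the Taylor polynomials of `F` at the points of `S_J`. -/
def limitTaylor (F : Family I) (J K : Finset κ) (M : κ → ℕ) (z : Cn ι) : ℂ :=
  ∑ β ∈ indexSet I K M, F (J ∪ K) (fun i => extendIndex (union I K) β i.1) (proj I (J ∪ K) z) *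
    (∏ i, incl I J (proj I J z) i.1 ^ β i) / (multiFactorial β : ℂ)

/-- The right hand side has additional indices `β`, those with a positive exponent at a coordinate
in `I_J`. Such a coordinate vanishes on `Z_J`, so their terms are zero. -/
theorem limitTaylor_unstar (F : Family I) (K : Finset (StarIndex I J)) (N : StarIndex I J → ℕ)
    (z : Cn ι) : taylor (starFamily I J) (starCoefficients F J) K N (proj I J z) =
      limitTaylor F J (unstar K) (extendExponent I J N) z := by
  refine Finset.sum_of_injOn (fun β => fun i : ↥(union I (unstar K)) => fullIndex K β i.1)
    ?_ ?_ ?_ ?_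
  · intro β _ β' _ h
    refine fullIndex_injective K ?_
    have h1 := extendIndex_restrict (A := union I (unstar K)) fun i hi => fullIndex_of_notMem β hi
    have h2 := extendIndex_restrict (A := union I (unstar K)) fun i hi => fullIndex_of_notMem β' hi
    exact h1.symm.trans ((congrArg _ h).trans h2)
  · intro β hβ
    exact Finset.mem_coe.2 (restrict_fullIndex_mem_indexSet.2 (Finset.mem_coe.1 hβ))
  · intro β hβ hn
    by_cases h0 : ∀ i : ↥(union I (unstar K)), i.1 ∈ union I J → β i = 0
    · exfalso
      set β' : ↥(union (starFamily I J) K) → ℕ :=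
        fun i => β ⟨i.1.1, mem_union_starFamily.1 i.2⟩ with hβ'
      have h1 : (fun i : ↥(union I (unstar K)) => fullIndex K β' i.1) = β := by
        funext i
        by_cases hi : i.1 ∈ union I J
        · rw [fullIndex_of_mem _ hi, h0 i hi]
        · have h2 : (⟨i.1, Finset.mem_compl.2 hi⟩ : ↥(union I J)ᶜ) ∈
              union (starFamily I J) K := mem_union_starFamily.2 i.2
          exact fullIndex_coe β' ⟨⟨i.1, Finset.mem_compl.2 hi⟩, h2⟩
      refine hn ⟨β', Finset.mem_coe.2 (restrict_fullIndex_mem_indexSet.1 ?_), h1⟩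
      rwa [h1]
    · push Not at h0
      obtain ⟨i, hi, hβi⟩ := h0
      rw [Finset.prod_eq_zero (Finset.mem_univ i), mul_zero, zero_div]
      rw [incl, extend_apply_notMem _ (by simpa using hi), zero_pow hβi]
  · intro β _
    have h1 : extendIndex (union I (unstar K))
        (fun i : ↥(union I (unstar K)) => fullIndex K β i.1) = fullIndex K β :=
      extendIndex_restrict fun i hi => fullIndex_of_notMem β hi
    have h2 : ∏ i : ↥(union I (unstar K)), incl I J (proj I J z) i.1 ^ fullIndex K β i.1 =
        ∏ i : ↥(union (starFamily I J) K), proj I J z i.1 ^ β i := by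
      rw [← prod_extendIndex (union I (unstar K)) (fun i => fullIndex K β i.1)
        (fun i m => incl I J (proj I J z) i ^ m) (fun i => pow_zero _), h1, fullIndex,
        prod_extendIndex (union I J)ᶜ _ (fun i m => incl I J (proj I J z) i ^ m)
        (fun i => pow_zero _), ← prod_extendIndex (union (starFamily I J) K) β
        (fun i m => proj I J z i ^ m) (fun i => pow_zero _)]
      refine Finset.prod_congr rfl fun i _ => ?_
      rw [incl, extend_apply_mem _ i.2]
    have h3 : multiFactorial (fun i : ↥(union I (unstar K)) => fullIndex K β i.1) =
        multiFactorial β := by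
      rw [← multiFactorial_extendIndex, h1, fullIndex, multiFactorial_extendIndex,
        multiFactorial_extendIndex]
    rw [h1, h2, h3, starCoefficients, proj_union_incl_incl]

/-- The exponent of `k` is zero, and no multi-index has a degree below zero. -/
theorem limitTaylor_eq_zero (F : Family I) {K : Finset κ} (N : StarIndex I J → ℕ) (z : Cn ι)
    {k : κ} (hk : k ∈ K) (hkJ : I k ⊆ union I J) :
    limitTaylor F J K (extendExponent I J N) z = 0 := by
  have h : indexSet I K (extendExponent I J N) = ∅ := by
    refine Finset.eq_empty_of_forall_notMem fun α hα => ?_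
    have h1 := mem_indexSet.1 hα k hk
    rw [extendExponent_of_subset N hkJ] at h1
    exact Nat.not_lt_zero _ h1
  simp [limitTaylor, h]

theorem app_starFamily (F : Family I) (N : StarIndex I J → ℕ) (z : Cn ι) :
    app (starFamily I J) (starCoefficients F J) N (proj I J z) =
      ∑ K ∈ Finset.univ.filter (fun K : Finset κ => K.Nonempty),
        (-1) ^ (K.card + 1) * limitTaylor F J K (extendExponent I J N) z := by
  refine Finset.sum_of_injOn unstar ?_ ?_ ?_ ?_
  · intro K _ K' _ h
    exact Finset.map_injective _ h
  · intro K hK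
    have hK' : K.Nonempty := by simpa using hK
    simpa [unstar] using hK'
  · intro K hK hn
    by_cases h0 : ∀ k ∈ K, ¬ I k ⊆ union I J
    · exfalso
      have h1 : unstar (K.subtype fun k => ¬ I k ⊆ union I J) = K := by
        ext k
        rw [mem_unstar]
        simp only [Finset.mem_subtype]
        exact ⟨fun ⟨_, hk⟩ => hk, fun hk => ⟨h0 k hk, hk⟩⟩
      obtain ⟨k, hk⟩ : K.Nonempty := by simpa using hK
      exact hn ⟨K.subtype fun k => ¬ I k ⊆ union I J, Finset.mem_coe.2 (Finset.mem_filter.2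
        ⟨Finset.mem_univ _, ⟨⟨k, h0 k hk⟩, Finset.mem_subtype.2 hk⟩⟩), h1⟩
    · push Not at h0
      obtain ⟨k, hk, hkJ⟩ := h0
      rw [limitTaylor_eq_zero F N z hk hkJ, mul_zero]
  · intro K _
    rw [card_unstar, limitTaylor_unstar]

namespace IsExpansion

variable (hI : IsAdmissible I) (hD : D.IsProper) (h : IsExpansion D f F) (hD' : D'.IsProper)
  (hD'D : D'.ProperlyContained D)

include hI hD h hD' hD'D

/-- Both coefficients are boundary values of the same derivative `∂^γ f`, with `γ` the extension of
`β` by zero: one on `Z_K`, the other on the smaller `Z_{J ∪ K}`. Continuity of the extension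
connects them. -/
theorem tendsto_coefficient (K : Finset κ) (hK : K.Nonempty) (β : ↥(union I K) → ℕ) {z : Cn ι}
    (hz : z ∈ D'.S) :
    Tendsto (fun t : ℝ => F K β (proj I K (scale (union I J) t z))) (𝓝[>] 0)
      (𝓝 (F (J ∪ K) (fun i => extendIndex (union I K) β i.1) (proj I (J ∪ K) z))) := by
  set γ := extendIndex (union I K) β with hγ
  have hexp := h.iteratedPartial hI hD γ
  obtain ⟨u, hu⟩ := hexp.exists_isWhitneyExtension hI hD hD' hD'D
  have huf : EqOn (u 0 0) (MultiAsymp.iteratedPartial γ f) D'.S := by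
    have h1 := hu.eqOn_holomorphic 0
    rwa [iteratedPartial_zero] at h1
  have huc := hu.isWhitneyJet.continuousOn 0 0
  have hcoef : ∀ L : Finset κ, K ⊆ L → iteratedFam γ F L 0 = F L fun i => γ i.1 := by
    intro L hL
    rw [iteratedFam_apply F fun i hi => extendIndex_apply_notMem β
      fun hiK => hi (union_mono hL hiK), zero_add]
  have hval : ∀ L : Finset κ, L.Nonempty → K ⊆ L → ∀ z ∈ D'.S,
      u 0 0 (incl I L (proj I L z)) = F L (fun i => γ i.1) (proj I L z) := by
    intro L hL hKL z hz
    rw [hexp.boundary_value hI hD' hD'D huc huf L hL z hz, hcoef L hKL]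
  have hγK : (fun i : ↥(union I K) => γ i.1) = β := by
    funext i
    exact extendIndex_coe β i
  rw [← hval (J ∪ K) (hK.mono Finset.subset_union_right) Finset.subset_union_right z hz]
  have hztS := hD'.eventually_scale_mem_S hI J hz
  have h1 : Tendsto (fun t : ℝ => u 0 0 (incl I K (proj I K (scale (union I J) t z)))) (𝓝[>] 0)
      (𝓝 (u 0 0 (incl I (J ∪ K) (proj I (J ∪ K) z)))) := by
    refine (huc _ (hD'.incl_proj_mem_closure hI _ hz)).tendsto.comp
      (tendsto_nhdsWithin_iff.2 ⟨tendsto_incl_proj_scale J K z, ?_⟩)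
    filter_upwards [hztS] with t ht using hD'.incl_proj_mem_closure hI K ht
  refine h1.congr' ?_
  filter_upwards [hztS] with t ht
  rw [hval K hK subset_rfl _ ht, hγK]

theorem tendsto_app (M : κ → ℕ) {z : Cn ι} (hz : z ∈ D'.S) :
    Tendsto (fun t : ℝ => app I F M (scale (union I J) t z)) (𝓝[>] 0)
      (𝓝 (∑ K ∈ Finset.univ.filter (fun K : Finset κ => K.Nonempty),
        (-1) ^ (K.card + 1) * limitTaylor F J K M z)) := by
  refine tendsto_finsetSum _ fun K hK => Tendsto.const_mul _ ?_
  have hK' : K.Nonempty := by simpa using hK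
  refine tendsto_finsetSum _ fun β _ => Tendsto.div_const (Tendsto.mul ?_ ?_) _
  · exact h.tendsto_coefficient hI hD hD' hD'D K hK' β hz
  · refine tendsto_finsetProd _ fun i _ => Tendsto.pow ?_ _
    have hc : Continuous fun z : Cn ι => z i.1 := by fun_prop
    exact (hc.tendsto _).comp (tendsto_scale_union J z)

omit hD' hD'D in
/-- The coefficient `f_{J,0}` is multi-asymptotically developable on `S_J`. -/
theorem developable_star (hJ : J.Nonempty) : (D.star J).Developable (F J 0) := by
  refine ⟨?_, starCoefficients F J,
    starCoefficients_isCoefficientFamily hI hD hJ h.coefficients, ?_⟩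
  · rw [hD.star_S hI, ← hD.SJ_eq hI]
    exact h.coefficients J hJ 0
  intro E hE hED N
  obtain ⟨D', hD', hD'D, hcover⟩ := hED.exists_cover_of_star hI hD hE
  obtain ⟨u, hu⟩ := h.exists_isWhitneyExtension hI hD hD' hD'D
  have huf : EqOn (u 0 0) f D'.S := by
    have h1 := hu.eqOn_holomorphic 0
    rwa [iteratedPartial_zero] at h1
  have huc := hu.isWhitneyJet.continuousOn 0 0
  -- Exponents zero outside `J^*` make the weights with `I j ⊆ I_J` vanish, so the bound has a
  -- finite limit as `t → 0`.
  set M := extendExponent I J N with hM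
  obtain ⟨C, hC, hbound⟩ := h.developable D' hD' hD'D M
  refine ⟨C, hC, fun w hw => ?_⟩
  obtain ⟨z, hz, rfl⟩ := hcover hw
  have hztS := hD'.eventually_scale_mem_S hI J hz
  have hlimf : Tendsto (fun t : ℝ => f (scale (union I J) t z)) (𝓝[>] 0)
      (𝓝 (F J 0 (proj I J z))) := by
    rw [← h.boundary_value hI hD' hD'D huc huf J hJ z hz]
    have h1 : Tendsto (fun t : ℝ => u 0 0 (scale (union I J) t z)) (𝓝[>] 0)
        (𝓝 (u 0 0 (incl I J (proj I J z)))) := by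
      refine (huc _ (hD'.incl_proj_mem_closure hI J hz)).tendsto.comp
        (tendsto_nhdsWithin_iff.2 ⟨tendsto_scale_union J z, ?_⟩)
      filter_upwards [hztS] with t ht using subset_closure ht
    refine h1.congr' ?_
    filter_upwards [hztS] with t ht using huf ht
  have hw0 : ∀ j, I j ⊆ union I J → weight I M j = 0 := fun j hj =>
    weight_extendExponent_of_subset N hj
  have hrhs : Tendsto (fun t : ℝ => C * ∏ j,
      Metric.infDist (scale (union I J) t z) (Z I j) ^ weight I M j) (𝓝[>] 0)
      (𝓝 (C * ∏ j, Metric.infDist (proj I J z) (Z (starFamily I J) j) ^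
        weight (starFamily I J) N j)) := by
    have h1 : ∏ j, Metric.infDist (proj I J z) (Z (starFamily I J) j) ^
        weight (starFamily I J) N j = ∏ j ∈ Finset.univ.filter (fun j => ¬ I j ⊆ union I J),
          ‖coords (I j) (incl I J (proj I J z))‖ ^ weight I M j := by
      refine Finset.prod_of_injOn Subtype.val Subtype.val_injective.injOn ?_ ?_ ?_
      · intro j _
        simp
      · intro j hj hn
        exact absurd ⟨⟨j, (Finset.mem_filter.1 hj).2⟩, by simp, rfl⟩ hn
      · intro j _
        rw [infDist_Z, hI.weight_starFamily]
        congr 1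
        -- The coordinates in `I j ∩ I_J` vanish on `Z_J`, so both norms are sums over the same
        -- coordinates.
        refine le_antisymm (le_of_sq_le_sq ?_ (norm_nonneg _)) (le_of_sq_le_sq ?_ (norm_nonneg _))
        all_goals
          rw [norm_coords_sq, norm_coords_sq]
          refine le_of_eq ?_
        · refine Finset.sum_of_injOn Subtype.val Subtype.val_injective.injOn ?_ ?_ ?_
          · intro i hi
            exact mem_starFamily.1 hi
          · intro i hi hn
            have hiJ : i ∉ (union I J)ᶜ := fun h' => hn ⟨⟨i, h'⟩, mem_starFamily.2 hi, rfl⟩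
            rw [incl, extend_apply_notMem _ hiJ]
            simp
          · intro i _
            rw [incl, extend_apply_mem _ i.2]
        · symm
          refine Finset.sum_of_injOn Subtype.val Subtype.val_injective.injOn ?_ ?_ ?_
          · intro i hi
            exact mem_starFamily.1 hi
          · intro i hi hn
            have hiJ : i ∉ (union I J)ᶜ := fun h' => hn ⟨⟨i, h'⟩, mem_starFamily.2 hi, rfl⟩
            rw [incl, extend_apply_notMem _ hiJ]
            simp
          · intro i _
            rw [incl, extend_apply_mem _ i.2]
    rw [h1]
    refine ((tendsto_prod_dist hI hD' J hz (weight I M)).const_mul C).congr' ?_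
    filter_upwards [self_mem_nhdsWithin] with t ht
    rw [prod_dist_eq J z (weight I M) ht, Finset.sum_eq_zero fun j hj =>
      hw0 j (Finset.mem_filter.1 hj).2, zpow_zero, one_mul,
      Finset.prod_eq_one (s := Finset.univ.filter fun j => I j ⊆ union I J) fun j hj => by
        rw [hw0 j (Finset.mem_filter.1 hj).2, zpow_zero], one_mul]
  have hlimapp := h.tendsto_app hI hD hD' hD'D (J := J) M hz
  rw [hM, ← app_starFamily, ← hM] at hlimapp
  refine le_of_tendsto_of_tendsto (hlimf.sub hlimapp).norm hrhs ?_
  filter_upwards [hztS] with t ht using hbound _ ht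

end IsExpansion

/-- This reduces every assertion on `f_{J,α}` to the coefficient with index zero of the derivative
`∂^α f`. -/
theorem IsExpansion.coefficient_eq (F : Family I) (J : Finset κ)
    (α : ↥(union I J) → ℕ) : iteratedFam (extendIndex (union I J) α) F J 0 = F J α := by
  rw [iteratedFam_apply F fun i hi => extendIndex_apply_notMem α hi, zero_add]
  congr 1
  funext i
  exact extendIndex_coe α i

/-- The coefficients are the boundary values of the derivatives. -/
theorem IsExpansion.isWhitneyRestriction (hI : IsAdmissible I) (hD : D.IsProper)
    (h : IsExpansion D f F) (hJ : J.Nonempty) (α : ↥(union I J) → ℕ) :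
    D.IsWhitneyRestriction (MultiAsymp.iteratedPartial (extendIndex (union I J) α) f) J
      (F J α) where
  exists_extension D' hD' hD'D :=
    (h.iteratedPartial hI hD _).exists_isWhitneyExtension hI hD hD' hD'D
  eqOn D' hD' hD'D u hu w hw := by
    rw [hD'.SJ_eq hI] at hw
    obtain ⟨z, hz, rfl⟩ := hw
    have huf := hu.eqOn_holomorphic 0
    rw [iteratedPartial_zero] at huf
    rw [(h.iteratedPartial hI hD _).boundary_value hI hD' hD'D
      (hu.isWhitneyJet.continuousOn 0 0) huf J hJ z hz, IsExpansion.coefficient_eq]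
  cover _ hw := hD.exists_properlyContained_mem_SJ hI hw

/-- Uniqueness of the coefficients. -/
theorem IsExpansion.unique (hI : IsAdmissible I) (hD : D.IsProper) (h : IsExpansion D f F)
    {F' : Family I} (h' : IsExpansion D f F') (hJ : J.Nonempty) (α : ↥(union I J) → ℕ) :
    EqOn (F' J α) (F J α) (D.SJ J) := by
  intro w hw
  have h1 := h.isWhitneyRestriction hI hD hJ α
  have h2 := h'.isWhitneyRestriction hI hD hJ α
  obtain ⟨D', hD', hD'D, hwD'⟩ := h1.cover w hw
  obtain ⟨u, hu⟩ := h1.exists_extension D' hD' hD'D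
  -- One and the same Whitney extension computes both coefficients.
  rw [← h1.eqOn D' hD' hD'D u hu w hwD', ← h2.eqOn D' hD' hD'D u hu w hwD']

end StarExpansion

end MultiAsymp

end

/-! ### The proposition. -/

theorem proposition7p14 {n ℓ : ℕ} (I : Fin ℓ → Finset (Fin n)) (hI : MultiAsymp.IsAdmissible I)
    (D : MultiAsymp.ConeData I) (hD : D.IsProper)
    (f : MultiAsymp.Cn (Fin n) → ℂ) (hf : AnalyticOnNhd ℂ f D.S)
    (F : MultiAsymp.Family I) (hF : D.IsCoefficientFamily F) (hfF : D.DevelopableTo f F) :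
    (∀ J : Finset (Fin ℓ), J.Nonempty → ∀ α : ↥(MultiAsymp.union I J) → ℕ,
      D.IsWhitneyRestriction
        (MultiAsymp.iteratedPartial (MultiAsymp.extendIndex (MultiAsymp.union I J) α) f)
        J (F J α)) ∧
    (∀ F' : MultiAsymp.Family I, D.IsCoefficientFamily F' → D.DevelopableTo f F' →
      ∀ J : Finset (Fin ℓ), J.Nonempty → ∀ α : ↥(MultiAsymp.union I J) → ℕ,
        Set.EqOn (F' J α) (F J α) (D.SJ J)) ∧
    (∀ J : Finset (Fin ℓ), J.Nonempty → ∀ α : ↥(MultiAsymp.union I J) → ℕ,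
      (D.star J).Developable (F J α)) := by
  have h : MultiAsymp.IsExpansion D f F := ⟨hf, hF, hfF⟩
  refine ⟨fun J hJ α => h.isWhitneyRestriction hI hD hJ α,
    fun F' hF' hfF' J hJ α => h.unique hI hD ⟨hf, hF', hfF'⟩ hJ α, fun J hJ α => ?_⟩
  -- The case of index zero is applied to the derivative `∂^α f`, which is again developable.
  rw [← MultiAsymp.IsExpansion.coefficient_eq F J α]
  exact (h.iteratedPartial hI hD _).developable_star hI hD hJ
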